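/- Let $D \ge 2$. For integers $k_1,\dots,k_{D-1},i$, the cell of level $i$ is $\prod_{j=1}^{D-1}[k_j2^i,(k_j+1)2^i]\times[2^i,2^{i+1}]$, and $\mathbb{B}^D$ is the set of the centers of all cells; a point of $\mathbb{B}^D$ is given by the integers $k_1,\dots,k_{D-1},i$ of its cell. The parent of a cell $C$ of level $i$ is the cell of level $i+1$ whose bottom facet contains the upper facet of $C$, and $C$ is then a child of it; two different cells of the same level are horizontal neighbors if they intersect. The same words are used for the centers. A move goes from a point to its parent, to one of its children, or to one of its horizontal neighbors (a horizontal move). Let $d_1(p,q)$ be the minimum number of moves needed to go from $p$ to $q$, and $d_2(p,q)$ the minimum number of moves of a path from $p$ to $q$ with at most one horizontal move. There are a constant $c$ and a single algorithm such that, for every $D\ge 2$ and every set $P\subset\mathbb{B}^D$ of $n$ points, the algorithm computes, within $2^{cD}\,n\log_2 n$ steps if $n\ge 2$, a finite weighted graph $S$ whose vertices are points of $\mathbb{B}^D$, such that (i) $P$ is contained in the vertex set of $S$, and $S$ has at most $2^{cD}n$ Steiner vertices (vertices not in $P$) and at most $2^{cD}n$ edges; (ii) every edge $uv$ of $S$ has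 length $d_1(u,v)$; (iii) for all $p,q\in P$ there is a path in $S$ from $p$ to $q$ of length $d_2(p,q)$, and $d_1(p,q)\le d_2(p,q)\le d_1(p,q)+2$; (iv) $S$ is a $2$-additive spanner of $P$ for $d_1$: the shortest path distance $d_S$ of $S$ satisfies $d_1(p,q)\le d_S(p,q)\le d_1(p,q)+2$ for all $p,q\in P$. Steps are counted on a random access machine whose registers and memory locations hold integers, and on which each of the following takes one step: using a literal, reading a register, reading from or writing to memory (with indirect addressing), writing to a register, testing $a<b$, $a+b$, $a-b$, $\lfloor a/2^b\rfloor$ (with $b$ replaced by $0$ if negative), bitwise exclusive or (two's complement), and $\lfloor\log_2|a|\rfloor$ (with the value $0$ for $a=0$). The input is $n$, $D$ and the list of the points; the output is the list of the vertices and the list of the edges with their lengths. -/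

import Mathlib

namespace HypTiling

/-! ### The discrete hyperbolic space -/

/-- The cell `∏ⱼ [kⱼ 2ⁱ, (kⱼ + 1) 2ⁱ] × [2ⁱ, 2ⁱ⁺¹]` of the binary tiling of the upper halfspace of
dimension `D`, given by its integers `k₁, …, k_{D-1}` (`idx`) and its level `i` (`lev`). A point of
the discrete space is the center of a cell; cells and their centers correspond one to one
(`Cell.center_injective`), so a point is given by its cell. -/
@[ext] structure Cell (D : ℕ) where
  idx : Fin (D - 1) → ℤ
  lev : ℤ

namespace Cell

variable {D : ℕ}

/-- The cell as a closed subset of the halfspace, whose points are pairs `(x, z)`. -/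
def box (C : Cell D) : Set ((Fin (D - 1) → ℝ) × ℝ) :=
  {p | (∀ j, (C.idx j : ℝ) * 2 ^ C.lev ≤ p.1 j ∧ p.1 j ≤ ((C.idx j : ℝ) + 1) * 2 ^ C.lev) ∧
    (2 : ℝ) ^ C.lev ≤ p.2 ∧ p.2 ≤ (2 : ℝ) ^ (C.lev + 1)}

/-- The center of the cell. -/
noncomputable def center (C : Cell D) : (Fin (D - 1) → ℝ) × ℝ :=
  (fun j => ((C.idx j : ℝ) + 1 / 2) * 2 ^ C.lev, 3 * (2 : ℝ) ^ (C.lev - 1))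

theorem center_injective : Function.Injective (center : Cell D → _) := by
  intro C C' h
  have h2 : (3 : ℝ) * (2 : ℝ) ^ (C.lev - 1) = 3 * (2 : ℝ) ^ (C'.lev - 1) := congrArg Prod.snd h
  have h3 : (2 : ℝ) ^ (C.lev - 1) = (2 : ℝ) ^ (C'.lev - 1) := by linarith
  have h4 : C.lev - 1 = C'.lev - 1 := zpow_right_injective₀ (by norm_num) (by norm_num) h3
  have hl : C.lev = C'.lev := by omega
  refine Cell.ext (funext fun j => ?_) hl
  have h5 : ((C.idx j : ℝ) + 1 / 2) * (2 : ℝ) ^ C.lev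
      = ((C'.idx j : ℝ) + 1 / 2) * (2 : ℝ) ^ C'.lev := congrFun (congrArg Prod.fst h) j
  rw [hl] at h5
  have h6 := mul_right_cancel₀ (zpow_ne_zero C'.lev (by norm_num : (2 : ℝ) ≠ 0)) h5
  exact_mod_cast (by linarith : (C.idx j : ℝ) = C'.idx j)

def upperFacet (C : Cell D) : Set ((Fin (D - 1) → ℝ) × ℝ) :=
  {p ∈ C.box | p.2 = (2 : ℝ) ^ (C.lev + 1)}

def lowerFacet (C : Cell D) : Set ((Fin (D - 1) → ℝ) × ℝ) :=
  {p ∈ C.box | p.2 = (2 : ℝ) ^ C.lev}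

/-- `C'` is the parent of `C`; equivalently, `C` is a child of `C'`. -/
def IsParent (C C' : Cell D) : Prop :=
  C'.lev = C.lev + 1 ∧ C.upperFacet ⊆ C'.lowerFacet

/-- `C` and `C'` are different cells of the same level that meet. -/
def HorizontalNeighbor (C C' : Cell D) : Prop :=
  C.lev = C'.lev ∧ C ≠ C' ∧ (C.box ∩ C'.box).Nonempty

end Cell

/-- `MovePath p q m h`: there is a path from `p` to `q` of `m` moves, `h` of them horizontal. -/
inductive MovePath {D : ℕ} (p : Cell D) : Cell D → ℕ → ℕ → Prop
  | refl : MovePath p p 0 0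
  | up {q r : Cell D} {m h : ℕ} : MovePath p q m h → q.IsParent r → MovePath p r (m + 1) h
  | down {q r : Cell D} {m h : ℕ} : MovePath p q m h → r.IsParent q → MovePath p r (m + 1) h
  | horizontal {q r : Cell D} {m h : ℕ} :
      MovePath p q m h → q.HorizontalNeighbor r → MovePath p r (m + 1) (h + 1)

/-- The minimum number of moves from `p` to `q` (it would be `⊤` if there were no path). -/
noncomputable def d1 {D : ℕ} (p q : Cell D) : ℕ∞ :=
  ⨅ (m : ℕ) (_ : ∃ h, MovePath p q m h), (m : ℕ∞)

/-- The minimum number of moves of a path from `p` to `q` with at most one horizontal move. -/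
noncomputable def d2 {D : ℕ} (p q : Cell D) : ℕ∞ :=
  ⨅ (m : ℕ) (_ : ∃ h ≤ 1, MovePath p q m h), (m : ℕ∞)

/-! ### Weighted graphs embedded in the discrete space, and spanners -/

/-- A finite weighted graph whose vertices are points of the discrete space. Only the weights of
its edges matter. -/
structure EmbeddedGraph (D : ℕ) where
  verts : Finset (Cell D)
  edges : Finset (Sym2 (Cell D))
  not_isDiag : ∀ e ∈ edges, ¬ e.IsDiag
  mem_verts : ∀ e ∈ edges, ∀ v ∈ e, v ∈ verts
  weight : Sym2 (Cell D) → ℕ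

namespace EmbeddedGraph

variable {D : ℕ} (S : EmbeddedGraph D)

def graph : SimpleGraph (Cell D) := SimpleGraph.fromEdgeSet (S.edges : Set (Sym2 (Cell D)))

/-- The length of a walk: the sum of the weights of its edges. -/
def length {p q : Cell D} (w : S.graph.Walk p q) : ℕ := (w.edges.map S.weight).sum

/-- The shortest path distance of the weighted graph. -/
noncomputable def dist (p q : Cell D) : ℕ∞ := ⨅ w : S.graph.Walk p q, (S.length w : ℕ∞)

/-- `S` is a purely-additive spanner of `P` for the distance `d1`, with distortion `Δ`. The Steiner
vertices are the vertices that are not in `P`. -/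
def IsAdditiveSpanner (P : Set (Cell D)) (Δ : ℕ) : Prop :=
  P ⊆ (S.verts : Set (Cell D)) ∧
  (∀ u v : Cell D, s(u, v) ∈ S.edges → (S.weight s(u, v) : ℕ∞) = d1 u v) ∧
  ∀ p ∈ P, ∀ q ∈ P, d1 p q ≤ S.dist p q ∧ S.dist p q ≤ d1 p q + (Δ : ℕ∞)

end EmbeddedGraph

/-! ### A random access machine with unit costs -/

/-- The contents of the registers and of the memory. Each register and each memory location holds
an integer. -/
structure State where
  reg : ℕ → ℤ
  mem : ℤ → ℤ

/-- Expressions: integer literals, registers, indirect access to the memory, sum, difference,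
shift to the right, bitwise exclusive or, and integer logarithm. There is no multiplication. -/
inductive Expr where
  | lit (z : ℤ)
  | reg (r : ℕ)
  | mem (a : Expr)
  | add (a b : Expr)
  | sub (a b : Expr)
  | shr (a b : Expr)
  | xor (a b : Expr)
  | log (a : Expr)

/-- Values. A shift to the right by `b ≥ 0` yields `⌊a / 2 ^ b⌋`; exclusive or works on two's
complement representations; `log a` is `⌊log₂ |a|⌋` if `a ≠ 0`, and `0` if `a = 0`. -/
def Expr.eval (s : State) : Expr → ℤ
  | lit z => z
  | reg r => s.reg r
  | mem a => s.mem (a.eval s)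
  | add a b => a.eval s + b.eval s
  | sub a b => a.eval s - b.eval s
  | shr a b => a.eval s / 2 ^ (b.eval s).toNat
  | xor a b => Int.xor (a.eval s) (b.eval s)
  | log a => (Nat.log 2 (a.eval s).natAbs : ℤ)

/-- Each literal, access and operation in an expression takes one step. -/
def Expr.cost : Expr → ℕ
  | lit _ => 1
  | reg _ => 1
  | mem a => a.cost + 1
  | add a b => a.cost + b.cost + 1
  | sub a b => a.cost + b.cost + 1
  | shr a b => a.cost + b.cost + 1
  | xor a b => a.cost + b.cost + 1
  | log a => a.cost + 1

/-- Programs: no operation, assignment to a register, assignment to the memory location with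
address `a`, sequential composition, and branching and looping on the test `a < b`. -/
inductive Program where
  | skip
  | set (r : ℕ) (e : Expr)
  | store (a e : Expr)
  | seq (p q : Program)
  | ite (a b : Expr) (p q : Program)
  | loop (a b : Expr) (p : Program)

/-- `Exec p s t s'`: the program `p`, started in the state `s`, halts in the state `s'` after `t`
steps. Every assignment and every test takes one step, plus the cost of its expressions. -/
inductive Exec : Program → State → ℕ → State → Prop
  | skip (s : State) : Exec .skip s 1 s
  | set (s : State) (r : ℕ) (e : Expr) :
      Exec (.set r e) s (e.cost + 1) ⟨Function.update s.reg r (e.eval s), s.mem⟩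
  | store (s : State) (a e : Expr) :
      Exec (.store a e) s (a.cost + e.cost + 1)
        ⟨s.reg, Function.update s.mem (a.eval s) (e.eval s)⟩
  | seq {p q : Program} {s s' s'' : State} {t t' : ℕ} :
      Exec p s t s' → Exec q s' t' s'' → Exec (.seq p q) s (t + t') s''
  | ite_true {a b : Expr} {p q : Program} {s s' : State} {t : ℕ} :
      a.eval s < b.eval s → Exec p s t s' → Exec (.ite a b p q) s (a.cost + b.cost + 1 + t) s'
  | ite_false {a b : Expr} {p q : Program} {s s' : State} {t : ℕ} :
      ¬ a.eval s < b.eval s → Exec q s t s' → Exec (.ite a b p q) s (a.cost + b.cost + 1 + t) s'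
  | loop_true {a b : Expr} {p : Program} {s s' s'' : State} {t t' : ℕ} :
      a.eval s < b.eval s → Exec p s t s' → Exec (.loop a b p) s' t' s'' →
        Exec (.loop a b p) s (a.cost + b.cost + 1 + t + t') s''
  | loop_false {a b : Expr} {p : Program} {s : State} :
      ¬ a.eval s < b.eval s → Exec (.loop a b p) s (a.cost + b.cost + 1) s

/-! ### Input and output -/

variable {D : ℕ}

/-- The `D` memory locations from address `a` on hold `k₁, …, k_{D-1}` and the level of `C`. -/
def HoldsPoint (s : State) (a : ℤ) (C : Cell D) : Prop :=
  (∀ l : Fin (D - 1), s.mem (a + (l : ℕ)) = C.idx l) ∧ s.mem (a + (D - 1 : ℕ)) = C.lev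

/-- The input: `n` in register 0, `D` in register 1, and the `n` points in the memory, one after
the other from address 0 on. Nothing is assumed about the other registers and locations. -/
def IsInput {n : ℕ} (pts : Fin n → Cell D) (s : State) : Prop :=
  s.reg 0 = n ∧ s.reg 1 = D ∧ ∀ j : Fin n, HoldsPoint s ((j : ℕ) * D) (pts j)

/-- The output: register 0 holds the number of vertices, register 1 the number of edges, register 2
the address of a table that lists every vertex exactly once, by its integers and level, and
register 3 the address of a table that lists every edge exactly once, by the positions of its
endpoints in the first table and its weight. -/
def IsOutput (S : EmbeddedGraph D) (s : State) : Prop :=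
  s.reg 0 = S.verts.card ∧ s.reg 1 = S.edges.card ∧
  ∃ v : Fin S.verts.card → Cell D,
    Function.Injective v ∧ Set.range v = (S.verts : Set (Cell D)) ∧
    (∀ j : Fin S.verts.card, HoldsPoint s (s.reg 2 + (j : ℕ) * D) (v j)) ∧
    ∃ a b : Fin S.edges.card → Fin S.verts.card,
      Function.Injective (fun j => s(v (a j), v (b j))) ∧
      Set.range (fun j => s(v (a j), v (b j))) = (S.edges : Set (Sym2 (Cell D))) ∧
      ∀ j : Fin S.edges.card,
        s.mem (s.reg 3 + 3 * (j : ℕ)) = (a j : ℕ) ∧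
        s.mem (s.reg 3 + 3 * (j : ℕ) + 1) = (b j : ℕ) ∧
        s.mem (s.reg 3 + 3 * (j : ℕ) + 2) = S.weight s(v (a j), v (b j))

end HypTiling

/-!
The number of moves between two points is governed by one level. Write `p.up i` for the ancestor of
`p` at the level `i`. A path from `p` to `q` that reaches the level `i` but no higher level must cross
at that level by horizontal moves, and each level further up halves the horizontal distance, at the
price of two more vertical moves. So there is a critical level (`IsCrit`), the lowest level at which
the ancestors of `p` and `q` are equal or horizontal neighbors. Going up to it, across by at most one
horizontal move, and down again takes `d2 p q` moves (`IsCrit.d2_eq`), and no path is shorter by more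
than two moves (`IsCrit.d2_le`).

The spanner therefore has to contain, for all `p` and `q`, the two cells at the critical level, a
horizontal edge between them, and shortest vertical paths to them. Its vertex set `V` is built from
the points in three steps, each of which multiplies their number by `2 ^ O(D)`. The closure `U` of the
points (`closeList`) adds the branching cells of the forest of their ancestors, and the children of
these. For each `u` in `U` and each cell `v` next to it, one point `p` below or at `u` and one point
`q` below or at `v` are looked up, and the ancestors of `p` at the two levels that can be critical for
`p` and `q` are candidates (`candCells`). Finally `V` is the closure of the candidates and their
horizontal neighbors. The main point is that this is enough for all pairs of points
(`IsCrit.up_mem_of_isCandList`): going up from the critical level of `p` and `q`, one meets a cell of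
`U` above one of the two points before the subtree of either one acquires any point that has another
ancestor just below the critical level, so that the points that are looked up have the critical level
of `p` and `q`.

The closure is computed by sorting. The cells are ordered depth first (`key`), so that the descendants
of a cell are consecutive, and a cell comes before them. Then each branching cell is the lowest common
ancestor of two neighbors in the sorted list (`up_split_mem_closeList`). In particular `V` contains
the lowest common ancestors of its cells, hence the lowest vertex above a vertex `v` is the lowest
common ancestor of `v` and its predecessor. With the vertical edges from each vertex to the lowest
vertex above it (`IsVertexList.exists_edge`) every vertex is joined to every vertex above it by a path
of the right length. A horizontal edge joins any two vertices that are horizontal neighbors.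

The comparison of two cells needs the highest level at which their ancestors differ, which is a matter
of the binary logarithm of the exclusive or of two coordinates (`coordLevel`), so it takes `O(D)`
steps (`wp_splitCmp`). Merge sort, binary search, and tables of `2 ^ O(D)` neighbors per cell give the
bound for the number of steps. The programs only append to the memory, at the address in register 50,
and are verified with weakest preconditions that also carry the time (`WP`).
-/

namespace HypTiling

/-! ### Reasoning about programs -/

/-- `s` with register `r` set to `v`. -/
def State.setReg (s : State) (r : ℕ) (v : ℤ) : State := ⟨Function.update s.reg r v, s.mem⟩

/-- `s` with the memory location `a` set to `v`. -/
def State.setMem (s : State) (a v : ℤ) : State := ⟨s.reg, Function.update s.mem a v⟩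

@[simp] theorem State.setReg_reg (s : State) (r : ℕ) (v : ℤ) (r' : ℕ) :
    (s.setReg r v).reg r' = if r' = r then v else s.reg r' := by
  simp [State.setReg, Function.update_apply]

@[simp] theorem State.setReg_mem (s : State) (r : ℕ) (v : ℤ) : (s.setReg r v).mem = s.mem := rfl

@[simp] theorem State.setMem_reg (s : State) (a v : ℤ) : (s.setMem a v).reg = s.reg := rfl

theorem State.setMem_mem (s : State) (a v x : ℤ) :
    (s.setMem a v).mem x = if x = a then v else s.mem x := by
  simp [State.setMem, Function.update_apply]

/-- Total correctness with a clock: started in `s` at time `t`, the program `p` halts, in a state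
and at a time that satisfy `Q`. -/
def WP (p : Program) (s : State) (t : ℕ) (Q : ℕ → State → Prop) : Prop :=
  ∃ t' s', Exec p s t' s' ∧ Q (t + t') s'

theorem WP.mono {p : Program} {s : State} {t : ℕ} {Q Q' : ℕ → State → Prop}
    (h : WP p s t Q) (hQ : ∀ t s, Q t s → Q' t s) : WP p s t Q' := by
  obtain ⟨t', s', h1, h2⟩ := h
  exact ⟨t', s', h1, hQ _ _ h2⟩

theorem wp_skip {s : State} {t : ℕ} {Q : ℕ → State → Prop} :
    WP .skip s t Q ↔ Q (t + 1) s := by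
  constructor
  · rintro ⟨t', s', h1, h2⟩
    cases h1
    exact h2
  · exact fun h => ⟨1, s, .skip s, h⟩

theorem wp_set {s : State} {t r : ℕ} {e : Expr} {Q : ℕ → State → Prop} :
    WP (.set r e) s t Q ↔ Q (t + (e.cost + 1)) (s.setReg r (e.eval s)) := by
  constructor
  · rintro ⟨t', s', h1, h2⟩
    cases h1
    exact h2
  · exact fun h => ⟨_, _, .set s r e, h⟩

theorem wp_store {s : State} {t : ℕ} {a e : Expr} {Q : ℕ → State → Prop} :
    WP (.store a e) s t Q ↔
      Q (t + (a.cost + e.cost + 1)) (s.setMem (a.eval s) (e.eval s)) := by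
  constructor
  · rintro ⟨t', s', h1, h2⟩
    cases h1
    exact h2
  · exact fun h => ⟨_, _, .store s a e, h⟩

theorem wp_seq {p q : Program} {s : State} {t : ℕ} {Q : ℕ → State → Prop} :
    WP (.seq p q) s t Q ↔ WP p s t (fun t' s' => WP q s' t' Q) := by
  constructor
  · rintro ⟨t', s', h1, h2⟩
    cases h1 with
    | seq h3 h4 => exact ⟨_, _, h3, _, _, h4, by rwa [add_assoc]⟩
  · rintro ⟨t1, s1, h1, t2, s2, h2, h3⟩
    exact ⟨t1 + t2, s2, .seq h1 h2, by rwa [← add_assoc]⟩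

theorem wp_ite {p q : Program} {a b : Expr} {s : State} {t : ℕ} {Q : ℕ → State → Prop} :
    WP (.ite a b p q) s t Q ↔
      (a.eval s < b.eval s → WP p s (t + (a.cost + b.cost + 1)) Q) ∧
      (¬ a.eval s < b.eval s → WP q s (t + (a.cost + b.cost + 1)) Q) := by
  constructor
  · rintro ⟨t', s', h1, h2⟩
    cases h1 with
    | ite_true h3 h4 => exact ⟨fun _ => ⟨_, _, h4, by rwa [add_assoc]⟩, fun h => absurd h3 h⟩
    | ite_false h3 h4 => exact ⟨fun h => absurd h h3, fun _ => ⟨_, _, h4, by rwa [add_assoc]⟩⟩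
  · rintro ⟨h1, h2⟩
    by_cases h : a.eval s < b.eval s
    · obtain ⟨t', s', h3, h4⟩ := h1 h
      exact ⟨_, s', .ite_true h h3, by rwa [← add_assoc]⟩
    · obtain ⟨t', s', h3, h4⟩ := h2 h
      exact ⟨_, s', .ite_false h h3, by rwa [← add_assoc]⟩

/-- The loop rule. The invariant `I v` carries a natural number `v` that decreases, and an iteration
that decreases it by `d` may take `K * d` steps. -/
theorem wp_loop {p : Program} {a b : Expr} {s : State} {t : ℕ} {Q : ℕ → State → Prop}
    (I : ℕ → State → Prop) (K v : ℕ) (h0 : I v s)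
    (step : ∀ v s t, I v s → a.eval s < b.eval s →
      WP p s t (fun t' s' => ∃ v' < v, I v' s' ∧
        t' + (a.cost + b.cost + 1) + K * v' ≤ t + K * v))
    (done : ∀ v' s' t', v' ≤ v → I v' s' → ¬ a.eval s' < b.eval s' →
      t' ≤ t + K * v + (a.cost + b.cost + 1) → Q t' s') :
    WP (.loop a b p) s t Q := by
  have key : ∀ n v, v ≤ n → ∀ s, I v s → ∀ t, ∃ t' s' v', Exec (.loop a b p) s t' s' ∧ v' ≤ v ∧
      I v' s' ∧ ¬ a.eval s' < b.eval s' ∧ t + t' ≤ t + K * v + (a.cost + b.cost + 1) := by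
    intro n
    induction n with
    | zero =>
      intro v hv s hI t
      by_cases hc : a.eval s < b.eval s
      · obtain ⟨_, _, _, v', hv', _⟩ := step v s t hI hc
        omega
      · exact ⟨_, s, v, .loop_false hc, le_rfl, hI, hc, by omega⟩
    | succ n ih =>
      intro v hv s hI t
      by_cases hc : a.eval s < b.eval s
      · obtain ⟨t1, s1, h1, v', hv', hI', ht'⟩ := step v s t hI hc
        obtain ⟨t2, s2, v2, h2, hv2, hI2, hc2, ht2⟩ := ih v' (by omega) s1 hI' (t + t1)
        exact ⟨_, s2, v2, .loop_true hc h1 h2, by omega, hI2, hc2, by omega⟩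
      · exact ⟨_, s, v, .loop_false hc, le_rfl, hI, hc, by omega⟩
  obtain ⟨t', s', v', h1, h2, h3, h4, h5⟩ := key v v le_rfl s h0 t
  exact ⟨t', s', h1, done v' s' _ h2 h3 h4 h5⟩

/-- The program `p` followed by `q`. -/
infixr:60 " ;; " => Program.seq

/-- The loop `for r = 0, 1, …, e - 1`. -/
def Program.forUpto (r : ℕ) (e : Expr) (p : Program) : Program :=
  .set r (.lit 0) ;; .loop (.reg r) e (p ;; .set r (.add (.reg r) (.lit 1)))

/-- The rule for counting loops: `J i` holds after `i` iterations, each of which takes at most `K`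
steps together with the counting and the test. -/
theorem wp_forUpto {p : Program} {r : ℕ} {e : Expr} {s : State} {t : ℕ} {Q : ℕ → State → Prop}
    (N : ℕ) (J : ℕ → State → Prop) (K : ℕ)
    (h0 : J 0 (s.setReg r 0))
    (hreg : ∀ i s, J i s → s.reg r = i ∧ e.eval s = N)
    (step : ∀ i s t, i < N → J i s →
      WP p s t (fun t' s' => s'.reg r = i ∧ J (i + 1) (s'.setReg r (i + 1)) ∧
        t' + (e.cost + 6) ≤ t + K))
    (done : ∀ s' t', J N s' → t' ≤ t + K * N + (e.cost + 4) → Q t' s') :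
    WP (.forUpto r e p) s t Q := by
  rw [Program.forUpto, wp_seq, wp_set]
  refine wp_loop (fun v s => ∃ i, i + v = N ∧ J i s) K N ⟨0, by simp, by simpa [Expr.eval] using h0⟩
    ?_ ?_
  · rintro v s1 t1 ⟨i, hi, hJ⟩ hc
    obtain ⟨hr, he⟩ := hreg i s1 hJ
    simp only [Expr.eval, hr, he, Nat.cast_lt] at hc
    rw [wp_seq]
    refine (step i s1 t1 hc hJ).mono ?_
    rintro t2 s2 ⟨h1, h2, h3⟩
    rw [wp_set]
    refine ⟨v - 1, by omega, ⟨i + 1, by omega, by simpa [Expr.eval, h1] using h2⟩, ?_⟩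
    obtain ⟨w, rfl⟩ : ∃ w, v = w + 1 := ⟨v - 1, by omega⟩
    simp only [Expr.cost, Nat.add_sub_cancel, mul_add, mul_one]
    omega
  · rintro v s1 t1 hv ⟨i, hi, hJ⟩ hc ht
    obtain ⟨hr, he⟩ := hreg i s1 hJ
    simp only [Expr.eval, hr, he, Nat.cast_lt] at hc
    obtain rfl : i = N := by omega
    refine done s1 t1 hJ ?_
    simp only [Expr.cost] at ht
    omega

variable {D : ℕ}

/-! ### Ancestors -/

/-- The ancestor of `p` at level `i`, and `p` itself if `i` is at most the level of `p`. -/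
def Cell.up (i : ℤ) (p : Cell D) : Cell D :=
  ⟨fun j => p.idx j / 2 ^ (i - p.lev).toNat, max i p.lev⟩

namespace Cell

theorem up_lev (i : ℤ) (p : Cell D) : (p.up i).lev = max i p.lev := rfl

theorem up_idx (i : ℤ) (p : Cell D) (j) :
    (p.up i).idx j = p.idx j / 2 ^ (i - p.lev).toNat := rfl

theorem up_of_le {i : ℤ} {p : Cell D} (h : i ≤ p.lev) : p.up i = p := by
  ext j
  · simp [up, Int.toNat_of_nonpos (sub_nonpos.2 h)]
  · simp [up, h]

@[simp] theorem up_self (p : Cell D) : p.up p.lev = p := up_of_le le_rfl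

theorem _root_.HypTiling.ediv_pow_ediv_pow (x : ℤ) (a b : ℕ) :
    x / 2 ^ a / 2 ^ b = x / 2 ^ (a + b) := by
  rw [pow_add, Int.ediv_ediv_of_nonneg (by positivity)]

theorem up_up {i i' : ℤ} (h : i ≤ i') (p : Cell D) : (p.up i).up i' = p.up i' := by
  ext j
  · simp only [up, ediv_pow_ediv_pow]
    congr 2
    omega
  · simp only [up]
    omega

theorem up_idx_of_le {i i' : ℤ} {p : Cell D} (hp : p.lev ≤ i) (hi : i ≤ i') (j) :
    (p.up i').idx j = (p.up i).idx j / 2 ^ (i' - i).toNat := by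
  rw [up_idx, up_idx, ediv_pow_ediv_pow]
  congr 2
  omega

theorem up_eq_of_le {i i' : ℤ} (h : i ≤ i') {p q : Cell D} (hpq : p.up i = q.up i) :
    p.up i' = q.up i' := by
  rw [← up_up h p, hpq, up_up h]

theorem isParent_iff {p q : Cell D} : p.IsParent q ↔ q = p.up (p.lev + 1) := by
  have hpos : (0 : ℝ) < 2 ^ p.lev := by positivity
  have h2 : (2 : ℝ) ^ (p.lev + 1) = 2 * 2 ^ p.lev := by
    rw [zpow_add₀ (by norm_num), zpow_one, mul_comm]
  constructor
  · rintro ⟨hl, hf⟩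
    have hlow := @hf (fun j => (p.idx j : ℝ) * 2 ^ p.lev, (2 : ℝ) ^ (p.lev + 1))
      ⟨⟨fun j => ⟨le_rfl, by nlinarith⟩, by simp only [h2]; linarith, le_rfl⟩, rfl⟩
    have hhigh := @hf (fun j => ((p.idx j : ℝ) + 1) * 2 ^ p.lev, (2 : ℝ) ^ (p.lev + 1))
      ⟨⟨fun j => ⟨by nlinarith, le_rfl⟩, by simp only [h2]; linarith, le_rfl⟩, rfl⟩
    ext j
    · have a1 := (hlow.1.1 j).1
      have a2 := (hhigh.1.1 j).2
      simp only [hl, h2] at a1 a2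
      have b1 : (q.idx j : ℝ) * 2 ≤ p.idx j := by
        by_contra! hc
        nlinarith
      have b2 : (p.idx j : ℝ) + 1 ≤ (q.idx j + 1) * 2 := by
        by_contra! hc
        nlinarith
      have c1 : q.idx j * 2 ≤ p.idx j := by exact_mod_cast b1
      have c2 : p.idx j + 1 ≤ (q.idx j + 1) * 2 := by exact_mod_cast b2
      simp only [up, add_sub_cancel_left, Int.toNat_one, pow_one]
      omega
    · simp [up, hl]
  · rintro rfl
    have hl : (p.up (p.lev + 1)).lev = p.lev + 1 := by simp [up]
    refine ⟨hl, ?_⟩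
    rintro ⟨x, z⟩ ⟨⟨hx, hz1, hz2⟩, hz⟩
    simp only at hx hz1 hz2 hz
    refine ⟨⟨fun j => ?_, ?_, ?_⟩, ?_⟩
    · rw [hl, h2]
      have hj := hx j
      have e : (p.up (p.lev + 1)).idx j = p.idx j / 2 := by simp [up]
      rw [e]
      have c1 : ((p.idx j / 2 : ℤ) : ℝ) * 2 ≤ p.idx j := by
        have : p.idx j / 2 * 2 ≤ p.idx j := by omega
        exact_mod_cast this
      have c2 : (p.idx j : ℝ) + 1 ≤ (((p.idx j / 2 : ℤ) : ℝ) + 1) * 2 := by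
        have : p.idx j + 1 ≤ (p.idx j / 2 + 1) * 2 := by omega
        exact_mod_cast this
      constructor <;> simp only <;> nlinarith
    · simp only [hl]; rw [hz]
    · simp only [hl]; rw [hz]
      exact zpow_le_zpow_right₀ (by norm_num) (by omega)
    · simp only [hl]; rw [hz]

/-- The indices of the two cells differ by at most `d`. For cells of the same level and `d = 1` this
means that the cells meet. -/
def Near (d : ℤ) (p q : Cell D) : Prop := ∀ j, |p.idx j - q.idx j| ≤ d

theorem Near.symm {d : ℤ} {p q : Cell D} (h : Near d p q) : Near d q p := fun j => by
  rw [abs_sub_comm]; exact h j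

theorem near_refl {d : ℤ} (hd : 0 ≤ d) (p : Cell D) : Near d p p := fun j => by simpa using hd

theorem near_zero {p q : Cell D} (hl : p.lev = q.lev) : Near 0 p q ↔ p = q := by
  constructor
  · intro h
    ext j
    · have := h j
      rw [abs_le] at this
      omega
    · exact hl
  · rintro rfl
    exact near_refl le_rfl _

theorem horizontalNeighbor_iff {p q : Cell D} :
    p.HorizontalNeighbor q ↔ p.lev = q.lev ∧ p ≠ q ∧ Near 1 p q := by
  unfold HorizontalNeighbor
  refine and_congr_right fun hl => and_congr_right fun _ => ?_
  have hpos : (0 : ℝ) < 2 ^ p.lev := by positivity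
  constructor
  · rintro ⟨⟨x, z⟩, ⟨h1, -⟩, ⟨h2, -⟩⟩ j
    have a := h1 j
    have b := h2 j
    rw [← hl] at b
    simp only at a b
    have c1 : (p.idx j : ℝ) ≤ q.idx j + 1 := by
      by_contra! hc
      nlinarith
    have c2 : (q.idx j : ℝ) ≤ p.idx j + 1 := by
      by_contra! hc
      nlinarith
    have d1 : p.idx j ≤ q.idx j + 1 := by exact_mod_cast c1
    have d2 : q.idx j ≤ p.idx j + 1 := by exact_mod_cast c2
    rw [abs_le]
    omega
  · intro h
    refine ⟨(fun j => ((max (p.idx j) (q.idx j) : ℤ) : ℝ) * 2 ^ p.lev, 2 ^ p.lev), ?_, ?_⟩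
    · refine ⟨fun j => ?_, le_rfl, zpow_le_zpow_right₀ (by norm_num) (by omega)⟩
      have := abs_le.1 (h j)
      have e1 : (p.idx j : ℝ) ≤ (max (p.idx j) (q.idx j) : ℤ) := by
        exact_mod_cast le_max_left _ _
      have e2 : ((max (p.idx j) (q.idx j) : ℤ) : ℝ) ≤ p.idx j + 1 := by
        exact_mod_cast max_le (by omega) (by omega)
      constructor <;> simp only <;> nlinarith
    · rw [hl]
      refine ⟨fun j => ?_, le_rfl, zpow_le_zpow_right₀ (by norm_num) (by omega)⟩
      have := abs_le.1 (h j)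
      have hq : (0 : ℝ) < 2 ^ q.lev := by positivity
      have e1 : (q.idx j : ℝ) ≤ (max (p.idx j) (q.idx j) : ℤ) := by
        exact_mod_cast le_max_right _ _
      have e2 : ((max (p.idx j) (q.idx j) : ℤ) : ℝ) ≤ q.idx j + 1 := by
        exact_mod_cast max_le (by omega) (by omega)
      constructor <;> simp only <;> nlinarith

theorem _root_.HypTiling.abs_ediv_sub_ediv_le {x y d : ℤ} (h : |x - y| ≤ d) (s : ℕ) :
    |x / 2 ^ s - y / 2 ^ s| ≤ d := by
  have hd : 0 ≤ d := (abs_nonneg _).trans h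
  have h2 : (1 : ℤ) ≤ 2 ^ s := one_le_pow₀ (by norm_num)
  have hm : d ≤ d * 2 ^ s := le_mul_of_one_le_right hd h2
  rw [abs_le] at h ⊢
  constructor
  · have : y / 2 ^ s ≤ (x + d * 2 ^ s) / 2 ^ s := Int.ediv_le_ediv (by positivity) (by omega)
    rw [Int.add_mul_ediv_right _ _ (by positivity)] at this
    omega
  · have : x / 2 ^ s ≤ (y + d * 2 ^ s) / 2 ^ s := Int.ediv_le_ediv (by positivity) (by omega)
    rw [Int.add_mul_ediv_right _ _ (by positivity)] at this
    omega

theorem _root_.HypTiling.abs_ediv_sub_ediv_le_one {x y : ℤ} {s : ℕ} (h : |x - y| ≤ 2 ^ s) :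
    |x / 2 ^ s - y / 2 ^ s| ≤ 1 := by
  rw [abs_le] at h ⊢
  constructor
  · have : y / 2 ^ s ≤ (x + 1 * 2 ^ s) / 2 ^ s := Int.ediv_le_ediv (by positivity) (by omega)
    rw [Int.add_mul_ediv_right _ _ (by positivity)] at this
    omega
  · have : x / 2 ^ s ≤ (y + 1 * 2 ^ s) / 2 ^ s := Int.ediv_le_ediv (by positivity) (by omega)
    rw [Int.add_mul_ediv_right _ _ (by positivity)] at this
    omega

theorem _root_.HypTiling.abs_sub_lt_of_abs_ediv_sub_ediv_le_one {x y : ℤ} {s : ℕ}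
    (h : |x / 2 ^ s - y / 2 ^ s| ≤ 1) : |x - y| < 2 ^ (s + 1) := by
  have h2 : (0 : ℤ) < 2 ^ s := by positivity
  have hx := Int.ediv_mul_add_emod x (2 ^ s)
  have hy := Int.ediv_mul_add_emod y (2 ^ s)
  have hx0 := Int.emod_nonneg x h2.ne'
  have hy0 := Int.emod_nonneg y h2.ne'
  have hx1 := Int.emod_lt_of_pos x h2
  have hy1 := Int.emod_lt_of_pos y h2
  rw [abs_le] at h
  rw [abs_lt, pow_succ]
  constructor <;> nlinarith

theorem Near.up {d : ℤ} {p q : Cell D} {i i' : ℤ} (h : Near d (p.up i) (q.up i))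
    (hi : i ≤ i') (hp : p.lev ≤ i) (hq : q.lev ≤ i) : Near d (p.up i') (q.up i') := by
  intro j
  rw [up_idx_of_le hp hi, up_idx_of_le hq hi]
  exact abs_ediv_sub_ediv_le (h j) _

end Cell

open Cell

/-! ### Distances -/

/-- The ancestors at a level `M` not below the path: vertical moves do not change them, a horizontal
move changes their indices by at most one. -/
theorem MovePath.exists_level {p q : Cell D} {m h : ℕ} (hm : MovePath p q m h) :
    ∃ M : ℤ, p.lev ≤ M ∧ q.lev ≤ M ∧ 2 * M - p.lev - q.lev + h ≤ m ∧
      Near h (p.up M) (q.up M) := by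
  induction hm with
  | refl => exact ⟨p.lev, le_rfl, le_rfl, by push_cast; omega, near_refl (by simp) _⟩
  | @up q r m h hm hqr ih =>
    obtain ⟨M, h1, h2, h3, h4⟩ := ih
    rw [isParent_iff] at hqr
    have hl : r.lev = q.lev + 1 := by rw [hqr, up_lev]; omega
    by_cases hM : q.lev + 1 ≤ M
    · refine ⟨M, h1, by omega, by push_cast; omega, ?_⟩
      rw [hqr, up_up hM]
      exact h4
    · refine ⟨M + 1, by omega, by omega, by push_cast; omega, ?_⟩
      rw [hqr, up_up (by omega)]
      exact h4.up (by omega) h1 h2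
  | @down q r m h hm hqr ih =>
    obtain ⟨M, h1, h2, h3, h4⟩ := ih
    rw [isParent_iff] at hqr
    have hl : q.lev = r.lev + 1 := by rw [hqr, up_lev]; omega
    refine ⟨M, h1, by omega, by push_cast; omega, ?_⟩
    rw [hqr, up_up (by omega)] at h4
    exact h4
  | @horizontal q r m h hm hqr ih =>
    obtain ⟨M, h1, h2, h3, h4⟩ := ih
    obtain ⟨hl, -, hn⟩ := horizontalNeighbor_iff.1 hqr
    refine ⟨M, h1, by omega, by push_cast; omega, fun j => ?_⟩
    have hn' : Near 1 (q.up M) (r.up M) :=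
      Near.up (i := q.lev) (by rw [up_self, hl, up_self]; exact hn) h2 le_rfl (by omega)
    have := abs_sub_le ((p.up M).idx j) ((q.up M).idx j) ((r.up M).idx j)
    have a := h4 j
    have b := hn' j
    push_cast
    omega

theorem MovePath.trans {p q r : Cell D} {m h m' h' : ℕ} (h1 : MovePath p q m h)
    (h2 : MovePath q r m' h') : MovePath p r (m + m') (h + h') := by
  induction h2 with
  | refl => exact h1
  | up _ hqr ih => exact ih.up hqr
  | down _ hqr ih => exact ih.down hqr
  | horizontal _ hqr ih => exact ih.horizontal hqr

theorem MovePath.symm {p q : Cell D} {m h : ℕ} (hm : MovePath p q m h) : MovePath q p m h := by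
  induction hm with
  | refl => exact .refl
  | up _ hqr ih =>
    have := (MovePath.down .refl hqr).trans ih
    rwa [zero_add, zero_add, add_comm] at this
  | down _ hqr ih =>
    have := (MovePath.up .refl hqr).trans ih
    rwa [zero_add, zero_add, add_comm] at this
  | @horizontal q r m h _ hqr ih =>
    have hr : r.HorizontalNeighbor q := by
      rw [horizontalNeighbor_iff] at hqr ⊢
      exact ⟨hqr.1.symm, hqr.2.1.symm, hqr.2.2.symm⟩
    have := (MovePath.horizontal .refl hr).trans ih
    rwa [zero_add, add_comm 1, add_comm 1] at this

theorem movePath_up (p : Cell D) (i : ℤ) : MovePath p (p.up i) (i - p.lev).toNat 0 := by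
  by_cases hi : i ≤ p.lev
  · rw [up_of_le hi, Int.toNat_of_nonpos (by omega)]
    exact .refl
  obtain ⟨n, rfl⟩ : ∃ n : ℕ, i = p.lev + n := ⟨(i - p.lev).toNat, by omega⟩
  clear hi
  rw [add_sub_cancel_left, Int.toNat_natCast]
  induction n with
  | zero => simpa using MovePath.refl
  | succ n ih =>
    refine ih.up (isParent_iff.2 ?_)
    rw [up_up (by rw [up_lev]; omega), up_lev]
    congr 1
    push_cast
    omega

theorem d1_le {p q : Cell D} {m h : ℕ} (hm : MovePath p q m h) : d1 p q ≤ m :=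
  iInf₂_le_of_le m ⟨h, hm⟩ le_rfl

theorem le_d1 {p q : Cell D} {c : ℕ∞} (H : ∀ m h, MovePath p q m h → c ≤ m) : c ≤ d1 p q :=
  le_iInf₂ fun m ⟨h, hm⟩ => H m h hm

theorem d1_triangle (p q r : Cell D) : d1 p r ≤ d1 p q + d1 q r := by
  unfold d1
  simp only [ENat.iInf_add, ENat.add_iInf]
  refine le_iInf₂ fun m ⟨h, hm⟩ => le_iInf₂ fun m' ⟨h', hm'⟩ => ?_
  exact_mod_cast d1_le (hm'.trans hm)

theorem d1_self (p : Cell D) : d1 p p = 0 := by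
  simpa using d1_le (MovePath.refl (p := p))

theorem d1_comm (p q : Cell D) : d1 p q = d1 q p :=
  le_antisymm (le_d1 fun _ _ h => d1_le h.symm) (le_d1 fun _ _ h => d1_le h.symm)

theorem d1_le_d2 (p q : Cell D) : d1 p q ≤ d2 p q :=
  le_iInf₂ fun _ ⟨_, _, hm⟩ => d1_le hm

theorem d1_up (p : Cell D) {i : ℤ} : d1 p (p.up i) = ((i - p.lev).toNat : ℕ) := by
  refine le_antisymm (d1_le (movePath_up p i)) (le_d1 fun m h hm => ?_)
  obtain ⟨M, h1, h2, h3, -⟩ := hm.exists_level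
  rw [up_lev] at h2 h3
  rw [Nat.cast_le]
  omega

theorem d1_horizontalNeighbor {p q : Cell D} (hpq : p.HorizontalNeighbor q) : d1 p q = 1 := by
  refine le_antisymm (by simpa using d1_le (MovePath.horizontal .refl hpq)) (le_d1 fun m h hm => ?_)
  rw [Nat.one_le_cast]
  rcases Nat.eq_zero_or_pos m with rfl | h'
  · cases hm
    exact absurd rfl hpq.2.1
  · exact h'

/-- `i` is the lowest level at which `p` and `q` both have ancestors (or are themselves) and these
are equal or horizontal neighbors. -/
structure IsCrit (p q : Cell D) (i : ℤ) : Prop where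
  left : p.lev ≤ i
  right : q.lev ≤ i
  near : Near 1 (p.up i) (q.up i)
  not_near : p.lev < i → q.lev < i → ¬ Near 1 (p.up (i - 1)) (q.up (i - 1))

theorem IsCrit.symm {p q : Cell D} {i : ℤ} (h : IsCrit p q i) : IsCrit q p i :=
  ⟨h.right, h.left, h.near.symm, fun a b c => h.not_near b a c.symm⟩

theorem exists_isCrit {p q : Cell D} {M : ℤ} (hp : p.lev ≤ M) (hq : q.lev ≤ M)
    (hM : Near 1 (p.up M) (q.up M)) : ∃ i ≤ M, IsCrit p q i := by
  classical
  have hex : ∃ n : ℕ, Near 1 (p.up (max p.lev q.lev + n)) (q.up (max p.lev q.lev + n)) :=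
    ⟨(M - max p.lev q.lev).toNat, by
      rw [Int.toNat_of_nonneg (by omega), add_sub_cancel]; exact hM⟩
  have hspec := Nat.find_spec hex
  have hmin := @Nat.find_min _ _ hex
  have hle : Nat.find hex ≤ (M - max p.lev q.lev).toNat := Nat.find_min' hex (by
      rw [Int.toNat_of_nonneg (by omega), add_sub_cancel]; exact hM)
  refine ⟨max p.lev q.lev + Nat.find hex, by omega, by omega, by omega, hspec, ?_⟩
  intro h1 h2
  have := @hmin (Nat.find hex - 1) (by omega)
  have e : max p.lev q.lev + ((Nat.find hex - 1 : ℕ) : ℤ)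
    = max p.lev q.lev + (Nat.find hex : ℤ) - 1 := by omega
  rwa [e] at this

open Classical in
/-- The length of the path that goes up from `p` and from `q` to level `i`, and from one of the
ancestors to the other one by at most one horizontal move. -/
noncomputable def critLength (p q : Cell D) (i : ℤ) : ℕ :=
  (i - p.lev).toNat + (i - q.lev).toNat + if p.up i = q.up i then 0 else 1

theorem IsCrit.d2_eq {p q : Cell D} {i : ℤ} (h : IsCrit p q i) : d2 p q = critLength p q i := by
  have hl : (p.up i).lev = (q.up i).lev := by
    rw [up_lev, up_lev, max_eq_left h.left, max_eq_left h.right]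
  apply le_antisymm
  · by_cases he : p.up i = q.up i
    · have := (movePath_up p i).trans (he ▸ (movePath_up q i).symm)
      refine iInf₂_le_of_le _ ⟨0, zero_le_one, this⟩ ?_
      rw [critLength, if_pos he]
      simp
    · have := ((movePath_up p i).horizontal
        (horizontalNeighbor_iff.2 ⟨hl, he, h.near⟩)).trans (movePath_up q i).symm
      refine iInf₂_le_of_le _ ⟨1, le_rfl, this⟩ ?_
      rw [critLength, if_neg he, Nat.cast_le]
      omega
  · refine le_iInf₂ fun m ⟨k, hk, hm⟩ => ?_
    obtain ⟨M, h1, h2, h3, h4⟩ := hm.exists_level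
    rw [Nat.cast_le, critLength]
    have hM : i ≤ M := by
      by_contra! hc
      refine h.not_near (by omega) (by omega) (Near.up (i := M) ?_ (by omega) h1 h2)
      exact fun j => (h4 j).trans (by exact_mod_cast hk)
    have a := h.left
    have b := h.right
    rcases hM.lt_or_eq with hM | rfl
    · split_ifs <;> omega
    · split_ifs with he
      · omega
      · have : k ≠ 0 := by
          rintro rfl
          exact he ((near_zero hl).1 (by simpa using h4))
        omega

theorem IsCrit.critLength_le {p q : Cell D} {i : ℤ} (h : IsCrit p q i) {m k : ℕ}
    (hm : MovePath p q m k) : critLength p q i ≤ m + 2 := by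
  obtain ⟨M, h1, h2, h3, h4⟩ := hm.exists_level
  have hc : critLength p q i ≤ (i - p.lev).toNat + (i - q.lev).toNat + 1 := by
    rw [critLength]
    split_ifs <;> omega
  have a := h.left
  have b := h.right
  by_cases hM : i ≤ M
  · omega
  obtain ⟨t, ht⟩ : ∃ t : ℕ, M = i - 1 - t := ⟨(i - 1 - M).toNat, by omega⟩
  have hk : 2 ^ t < k := by
    by_contra! hk
    refine h.not_near (by omega) (by omega) fun j => ?_
    have hs : (i - 1 - M).toNat = t := by omega
    rw [up_idx_of_le (i := M) h1 (by omega), up_idx_of_le (i := M) h2 (by omega), hs]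
    exact abs_ediv_sub_ediv_le_one ((h4 j).trans (by exact_mod_cast hk))
  have ht2 : 2 * (t + 1) ≤ 2 ^ t + 2 := by
    clear hk ht
    induction t with
    | zero => norm_num
    | succ t ih =>
      rcases t with _ | t
      · norm_num
      · have := Nat.one_le_two_pow (n := t)
        rw [pow_succ] at ih ⊢
        omega
  omega

theorem IsCrit.d2_le {p q : Cell D} {i : ℤ} (h : IsCrit p q i) : d2 p q ≤ d1 p q + 2 := by
  rw [h.d2_eq]
  unfold d1
  simp only [ENat.iInf_add]
  refine le_iInf₂ fun m ⟨k, hm⟩ => ?_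
  exact_mod_cast h.critLength_le hm

/-! ### The preorder of the forest of cells below a root level -/

namespace Cell

/-- `x` is an ancestor of `p` or equal to it. -/
def IsAnc (x p : Cell D) : Prop := p.lev ≤ x.lev ∧ p.up x.lev = x

theorem isAnc_refl (p : Cell D) : IsAnc p p := ⟨le_rfl, up_self p⟩

theorem isAnc_up {p : Cell D} {i : ℤ} : IsAnc (p.up i) p := by
  refine ⟨by rw [up_lev]; omega, ?_⟩
  rw [up_lev]
  rcases le_total p.lev i with h | h
  · rw [max_eq_left h]
  · rw [max_eq_right h, up_of_le h, up_self]

theorem IsAnc.up_eq {x p : Cell D} (h : IsAnc x p) {i : ℤ} (hi : x.lev ≤ i) :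
    p.up i = x.up i := by
  rw [← up_up hi p, h.2]

theorem IsAnc.trans {x y p : Cell D} (h : IsAnc x y) (h' : IsAnc y p) : IsAnc x p :=
  ⟨h'.1.trans h.1, by rw [h'.up_eq h.1, h.2]⟩

theorem IsAnc.eq_of_lev {x y p : Cell D} (h : IsAnc x p) (h' : IsAnc y p) (hl : x.lev = y.lev) :
    x = y := by
  rw [← h.2, ← h'.2, hl]

theorem IsAnc.isAnc_of_le {x y p : Cell D} (h : IsAnc x p) (h' : IsAnc y p)
    (hl : y.lev ≤ x.lev) : IsAnc x y :=
  ⟨hl, by rw [← h'.up_eq hl, h.2]⟩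

/-- The sort key of a cell: the indices of its ancestors, from the level `R` downwards, with `⊥`
below the level of the cell. The lexicographic order of the keys is a depth first order, in which
a cell comes before its descendants. -/
noncomputable def key (R : ℤ) (p : Cell D) : Lex (ℕ → WithBot (Lex (Fin (D - 1) → ℤ))) :=
  toLex fun n => if p.lev ≤ R - n then ((toLex (p.up (R - n)).idx : Lex (Fin (D - 1) → ℤ)) :
    WithBot (Lex (Fin (D - 1) → ℤ))) else ⊥

theorem key_of_le {R : ℤ} {p : Cell D} {n : ℕ} (h : p.lev ≤ R - n) :
    ofLex (key R p) n = ((toLex (p.up (R - n)).idx : Lex (Fin (D - 1) → ℤ)) :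
      WithBot (Lex (Fin (D - 1) → ℤ))) := by
  simp [key, h]

theorem key_of_lt {R : ℤ} {p : Cell D} {n : ℕ} (h : R - n < p.lev) :
    ofLex (key R p) n = ⊥ := by
  simp [key, h]

theorem _root_.HypTiling.lex_lt_iff {β : Type*} [LinearOrder β] {a b : Lex (ℕ → β)} :
    a < b ↔ ∃ n, (∀ k < n, ofLex a k = ofLex b k) ∧ ofLex a n < ofLex b n := Iff.rfl

theorem _root_.HypTiling.lex_lt_iff_of_first {β : Type*} [LinearOrder β] {a b : Lex (ℕ → β)}
    {n : ℕ} (h : ∀ k < n, ofLex a k = ofLex b k) (hn : ofLex a n ≠ ofLex b n) :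
    a < b ↔ ofLex a n < ofLex b n := by
  rw [lex_lt_iff]
  constructor
  · rintro ⟨m, h1, h2⟩
    rcases lt_trichotomy m n with hmn | rfl | hmn
    · exact absurd (h m hmn) h2.ne
    · exact h2
    · exact absurd (h1 n hmn) hn
  · exact fun h' => ⟨n, h, h'⟩

theorem isAnc_iff_key {R : ℤ} {x p : Cell D} (hx : x.lev ≤ R) :
    IsAnc x p ↔ ∀ n : ℕ, n ≤ (R - x.lev).toNat → ofLex (key R x) n = ofLex (key R p) n := by
  constructor
  · intro h n hn
    rw [key_of_le (by omega), key_of_le (by have := h.1; omega), h.up_eq (by omega)]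
  · intro h
    have := h _ le_rfl
    have e : R - ((R - x.lev).toNat : ℤ) = x.lev := by omega
    rw [key_of_le (by omega), e] at this
    by_cases hp : p.lev ≤ x.lev
    · rw [key_of_le (by omega), e, WithBot.coe_inj, toLex_inj, up_self] at this
      refine ⟨hp, ?_⟩
      ext j
      · rw [this]
      · rw [up_lev, max_eq_left hp]
    · rw [key_of_lt (by omega)] at this
      exact absurd this WithBot.coe_ne_bot

theorem IsAnc.key_le {R : ℤ} {x p : Cell D} (hx : x.lev ≤ R) (h : IsAnc x p) :
    key R x ≤ key R p := by
  by_contra! hc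
  obtain ⟨n, -, h2⟩ := lex_lt_iff.1 hc
  by_cases hn : n ≤ (R - x.lev).toNat
  · exact h2.ne' ((isAnc_iff_key hx).1 h n hn)
  · rw [key_of_lt (p := x) (by omega)] at h2
    exact not_lt_bot h2

theorem key_injective {R : ℤ} {p q : Cell D} (hp : p.lev ≤ R) (hq : q.lev ≤ R)
    (h : key R p = key R q) : p = q := by
  have h1 : IsAnc p q := (isAnc_iff_key hp).2 fun n _ => by rw [h]
  have h2 : IsAnc q p := (isAnc_iff_key hq).2 fun n _ => by rw [h]
  rw [← h1.2, up_of_le h2.1]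

/-- The descendants of a cell are consecutive in the order of the keys. -/
theorem IsAnc.of_key_mem {R : ℤ} {x p w : Cell D} (hx : x.lev ≤ R) (h : IsAnc x p)
    (h1 : key R x ≤ key R w) (h2 : key R w ≤ key R p) : IsAnc x w := by
  classical
  rw [isAnc_iff_key hx]
  by_contra! hc
  obtain ⟨hn, hne⟩ := Nat.find_spec hc
  have hmin : ∀ k < Nat.find hc, ofLex (key R x) k = ofLex (key R w) k := by
    intro k hk
    have := Nat.find_min hc hk
    push Not at this
    exact this (by omega)
  have hlt : key R x < key R w :=
    lt_of_le_of_ne h1 fun he => hne (congrFun (congrArg ofLex he) _)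
  rw [lex_lt_iff_of_first hmin hne] at hlt
  have hxp := (isAnc_iff_key hx).1 h
  refine absurd h2 (not_le.2 (lex_lt_iff.2 ⟨Nat.find hc, fun k hk => ?_, ?_⟩))
  · rw [← hmin k hk, hxp k (by omega)]
  · rw [← hxp _ hn]
    exact hlt

theorem IsAnc.of_key_mem' {R : ℤ} {x p q w : Cell D} (hx : x.lev ≤ R) (hq : IsAnc x q)
    (h : IsAnc x p) (h1 : key R q ≤ key R w) (h2 : key R w ≤ key R p) : IsAnc x w :=
  h.of_key_mem hx ((hq.key_le hx).trans h1) h2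

/-- `m` is the highest level up to `R` at which the ancestors of `p` and `q` are different. If one
of the two cells is an ancestor of the other one, then `m` is just below it. -/
structure IsSplit (R : ℤ) (p q : Cell D) (m : ℤ) : Prop where
  left : p.lev ≤ m + 1
  right : q.lev ≤ m + 1
  le : m ≤ R
  eq : ∀ i, m < i → i ≤ R → p.up i = q.up i
  ne : p.lev ≤ m → q.lev ≤ m → p.up m ≠ q.up m

theorem IsSplit.key_lt_iff {R : ℤ} {p q : Cell D} {m : ℤ} (h : IsSplit R p q m) (hp : p.lev ≤ m)
    (hq : q.lev ≤ m) :
    key R p < key R q ↔ toLex (p.up m).idx < toLex (q.up m).idx := by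
  have e : R - ((R - m).toNat : ℤ) = m := by have := h.le; omega
  have hk1 := key_of_le (R := R) (n := (R - m).toNat) (p := p) (by omega)
  have hk2 := key_of_le (R := R) (n := (R - m).toNat) (p := q) (by omega)
  rw [e] at hk1 hk2
  rw [lex_lt_iff_of_first (n := (R - m).toNat), hk1, hk2, WithBot.coe_lt_coe]
  · exact Iff.rfl
  · intro k hk
    rw [key_of_le (by omega), key_of_le (by omega), h.eq _ (by omega) (by omega)]
  · rw [hk1, hk2, Ne, WithBot.coe_inj, toLex_inj]
    intro h'
    refine h.ne hp hq (Cell.ext h' ?_)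
    rw [up_lev, up_lev, max_eq_left hp, max_eq_left hq]

theorem IsSplit.key_lt_iff' {R : ℤ} {p q : Cell D} {m : ℤ} (h : IsSplit R p q m)
    (hpR : p.lev ≤ R) (hqR : q.lev ≤ R) (hm : ¬ (p.lev ≤ m ∧ q.lev ≤ m)) :
    key R p < key R q ↔ q.lev < p.lev := by
  have h1 := h.left
  have h2 := h.right
  have h3 := h.le
  have heq := h.eq (m + 1) (by omega) (by omega)
  rcases lt_trichotomy p.lev q.lev with hl | hl | hl
  · have : IsAnc q p := ⟨hl.le, by
      have : q.lev = m + 1 := by omega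
      rw [this, heq, ← this, up_self]⟩
    exact iff_of_false (not_lt.2 (this.key_le hqR)) hl.not_gt
  · have : p = q := by
      rw [up_of_le (by omega), up_of_le (by omega)] at heq
      exact heq
    rw [this]
    exact iff_of_false (lt_irrefl _) (lt_irrefl _)
  · have : IsAnc p q := ⟨hl.le, by
      have : p.lev = m + 1 := by omega
      rw [this, ← heq, ← this, up_self]⟩
    simp only [hl, iff_true]
    exact lt_of_le_of_ne (this.key_le hpR) fun he =>
      hl.ne' (congrArg Cell.lev (key_injective hpR hqR he))

theorem IsSplit.unique {R : ℤ} {p q : Cell D} {m m' : ℤ} (h : IsSplit R p q m)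
    (h' : IsSplit R p q m') : m = m' := by
  have aux : ∀ {m m' : ℤ}, IsSplit R p q m → IsSplit R p q m' → ¬ m < m' := by
    intro m m' h h' hlt
    exact h'.ne (by have := h.left; omega) (by have := h.right; omega) (h.eq m' hlt h'.le)
  have := aux h h'
  have := aux h' h
  omega

open Classical in
/-- The level `m` with `IsSplit R p q m`. -/
noncomputable def split (R : ℤ) (p q : Cell D) : ℤ :=
  if h : ∃ m, IsSplit R p q m then h.choose else 0

theorem IsSplit.split_eq {R : ℤ} {p q : Cell D} {m : ℤ} (h : IsSplit R p q m) :
    split R p q = m := by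
  have hex : ∃ m, IsSplit R p q m := ⟨m, h⟩
  rw [split, dif_pos hex]
  exact hex.choose_spec.unique h

/-- A common ancestor at level at most `R` is at a level above the split. -/
theorem IsSplit.lt_of_isAnc {R : ℤ} {p q x : Cell D} {m : ℤ} (h : IsSplit R p q m)
    (hp : IsAnc x p) (hq : IsAnc x q) : m < x.lev := by
  by_contra! hc
  refine h.ne (hp.1.trans hc) (hq.1.trans hc) ?_
  rw [hp.up_eq hc, hq.up_eq hc]

/-- The cell has level at most `M`, and it is at most `c` cells of level `M` away from the
origin. -/
def Bdd (M : ℤ) (c : ℤ) (p : Cell D) : Prop :=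
  p.lev ≤ M ∧ ∀ j, -(c * 2 ^ (M - p.lev).toNat) ≤ p.idx j ∧ p.idx j < c * 2 ^ (M - p.lev).toNat

theorem Bdd.mono {M c c' : ℤ} {p : Cell D} (h : Bdd M c p) (hc : c ≤ c') : Bdd M c' p := by
  refine ⟨h.1, fun j => ?_⟩
  have h1 := h.2 j
  have h2 : c * 2 ^ (M - p.lev).toNat ≤ c' * 2 ^ (M - p.lev).toNat :=
    mul_le_mul_of_nonneg_right hc (by positivity)
  omega

theorem _root_.HypTiling.ediv_pow_bounds {x c : ℤ} {a s : ℕ} (h1 : -(c * 2 ^ (a + s)) ≤ x)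
    (h2 : x < c * 2 ^ (a + s)) : -(c * 2 ^ a) ≤ x / 2 ^ s ∧ x / 2 ^ s < c * 2 ^ a := by
  have hs : (0 : ℤ) < 2 ^ s := by positivity
  rw [pow_add, ← mul_assoc] at h1 h2
  refine ⟨?_, Int.ediv_lt_of_lt_mul hs h2⟩
  rw [Int.le_ediv_iff_mul_le hs]
  linarith

theorem Bdd.up {M c : ℤ} {p : Cell D} (h : Bdd M c p) {i : ℤ} (hi : i ≤ M) :
    Bdd M c (p.up i) := by
  have hl := h.1
  refine ⟨by rw [up_lev]; omega, fun j => ?_⟩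
  rw [up_idx, up_lev]
  obtain ⟨h1, h2⟩ := h.2 j
  have e : (M - p.lev).toNat = (M - max i p.lev).toNat + (i - p.lev).toNat := by omega
  rw [e] at h1 h2
  exact ediv_pow_bounds h1 h2

theorem Bdd.near {M c : ℤ} {p q : Cell D} (h : Bdd M c p) (hl : p.lev = q.lev)
    (hpq : Near 1 p q) : Bdd M (c + 1) q := by
  refine ⟨hl ▸ h.1, fun j => ?_⟩
  have h1 := h.2 j
  have h2 := abs_le.1 (hpq j)
  have h3 : (1 : ℤ) ≤ 2 ^ (M - p.lev).toNat := one_le_pow₀ (by norm_num)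
  rw [← hl, add_mul]
  omega

/-- At the root level, two levels up, the cell and the origin meet. -/
theorem Bdd.root {M : ℤ} {p : Cell D} (h : Bdd M 4 p) : Bdd (M + 2) 1 p := by
  have hl := h.1
  refine ⟨by omega, fun j => ?_⟩
  have e : (M + 2 - p.lev).toNat = (M - p.lev).toNat + 2 := by omega
  have := h.2 j
  rw [e, pow_add]
  omega

end Cell

/-! ### Memory that only grows

Register 1 holds the dimension, register 2 a bound for the levels, and register 50 the first free
address. A routine leaves the registers below a threshold and the memory below the first free address
unchanged. -/

/-- The change from `s` to `s'` keeps the registers below `k` and the memory below the first free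
address, which may grow. -/
structure Ext (k : ℕ) (s s' : State) : Prop where
  reg : ∀ r < k, s'.reg r = s.reg r
  mem : ∀ x < s.reg 50, s'.mem x = s.mem x
  top : s.reg 50 ≤ s'.reg 50

theorem Ext.refl (k : ℕ) (s : State) : Ext k s s := ⟨fun _ _ => rfl, fun _ _ => rfl, le_rfl⟩

theorem Ext.trans {k : ℕ} {s s' s'' : State} (h : Ext k s s') (h' : Ext k s' s'') : Ext k s s'' :=
  ⟨fun r hr => (h'.reg r hr).trans (h.reg r hr),
    fun x hx => (h'.mem x (hx.trans_le h.top)).trans (h.mem x hx), h.top.trans h'.top⟩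

theorem Ext.mono {k k' : ℕ} {s s' : State} (h : Ext k s s') (hk : k' ≤ k) : Ext k' s s' :=
  ⟨fun r hr => h.reg r (hr.trans_le hk), h.mem, h.top⟩

@[simp] theorem ext_setReg {k : ℕ} {s s' : State} {r : ℕ} {v : ℤ} (hr : k ≤ r)
    (hr' : 50 ≠ r) : Ext k s (s'.setReg r v) ↔ Ext k s s' := by
  constructor
  · exact fun h => ⟨fun x hx => by simpa [show x ≠ r by omega] using h.reg x hx,
      fun x hx => by simpa using h.mem x hx, by simpa [hr'] using h.top⟩
  · exact fun h => ⟨fun x hx => by simpa [show x ≠ r by omega] using h.reg x hx,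
      fun x hx => by simpa using h.mem x hx, by simpa [hr'] using h.top⟩

@[simp] theorem ext_self (k : ℕ) (s : State) : Ext k s s := Ext.refl k s

/-- The point `C` is stored at the address `a`, below the first free address. -/
def At (s : State) (a : ℤ) (C : Cell D) : Prop := HoldsPoint s a C ∧ a + (D - 1 : ℕ) < s.reg 50

theorem At.ext {k : ℕ} {s s' : State} {a : ℤ} {C : Cell D} (h : At s a C) (he : Ext k s s') :
    At s' a C := by
  obtain ⟨⟨h1, h2⟩, h3⟩ := h
  refine ⟨⟨fun l => ?_, ?_⟩, h3.trans_le he.top⟩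
  · rw [he.mem _ (by have := l.2; omega), h1]
  · rw [he.mem _ h3, h2]

@[simp] theorem holdsPoint_setReg {s : State} {r : ℕ} {v a : ℤ} {C : Cell D} :
    HoldsPoint (s.setReg r v) a C ↔ HoldsPoint s a C := Iff.rfl

@[simp] theorem at_setReg {s : State} {r : ℕ} {v a : ℤ} {C : Cell D} (hr : 50 ≠ r) :
    At (s.setReg r v) a C ↔ At s a C := by
  simp [At, hr]

/-- Appends the value of `e` to the memory. -/
def push (e : Expr) : Program := .store (.reg 50) e ;; .set 50 (.add (.reg 50) (.lit 1))

/-- `s` with `v` appended to the memory. -/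
def State.pushed (s : State) (v : ℤ) : State :=
  (s.setMem (s.reg 50) v).setReg 50 (s.reg 50 + 1)

@[simp] theorem State.pushed_reg (s : State) (v : ℤ) (r : ℕ) :
    (s.pushed v).reg r = if r = 50 then s.reg 50 + 1 else s.reg r := by
  simp [State.pushed]

theorem State.pushed_mem (s : State) (v x : ℤ) :
    (s.pushed v).mem x = if x = s.reg 50 then v else s.mem x := by
  simp [State.pushed, State.setMem_mem]

theorem wp_push {s : State} {t : ℕ} {e : Expr} {Q : ℕ → State → Prop} :
    WP (push e) s t Q ↔ Q (t + (e.cost + 6)) (s.pushed (e.eval s)) := by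
  rw [push, wp_seq, wp_store, wp_set]
  simp only [Expr.eval, Expr.cost, State.pushed, State.setMem_reg]
  rw [show t + (1 + e.cost + 1) + (1 + 1 + 1 + 1) = t + (e.cost + 6) by omega]

theorem Ext.pushed {k : ℕ} {s s' : State} (h : Ext k s s') (v : ℤ) (hk : k ≤ 50) :
    Ext k s (s'.pushed v) := by
  refine ⟨fun x hx => ?_, fun x hx => ?_, ?_⟩
  · simpa [show x ≠ 50 by omega] using h.reg x hx
  · have := h.top
    simpa [State.pushed_mem, show x ≠ s'.reg 50 by omega] using h.mem x hx
  · have := h.top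
    simp only [State.pushed_reg, if_true]
    omega

/-- Sets the register `r` to `e` if `a < b`, and to `e'` otherwise. -/
def Program.setIf (r : ℕ) (a b e e' : Expr) : Program := .ite a b (.set r e) (.set r e')

theorem wp_setIf {s : State} {t r : ℕ} {a b e e' : Expr} {Q : ℕ → State → Prop}
    (H : ∀ t', t' ≤ t + (a.cost + b.cost + e.cost + e'.cost + 2) →
      Q t' (s.setReg r (if a.eval s < b.eval s then e.eval s else e'.eval s))) :
    WP (.setIf r a b e e') s t Q := by
  rw [Program.setIf, wp_ite, wp_set, wp_set]
  constructor
  · intro h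
    have := H (t + (a.cost + b.cost + 1) + (e.cost + 1)) (by omega)
    rwa [if_pos h] at this
  · intro h
    have := H (t + (a.cost + b.cost + 1) + (e'.cost + 1)) (by omega)
    rwa [if_neg h] at this

/-- Appends the ancestor at the level `l`, but at most at the level in register 2, of the cell at the
address `a`. -/
def pushAnc (a l : Expr) : Program :=
  .set 40 a ;; .set 41 l ;;
  .set 42 (.mem (.add (.reg 40) (.sub (.reg 1) (.lit 1)))) ;;
  .setIf 41 (.reg 2) (.reg 41) (.reg 2) (.reg 41) ;;
  .setIf 41 (.reg 41) (.reg 42) (.reg 42) (.reg 41) ;;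
  .forUpto 43 (.sub (.reg 1) (.lit 1))
    (push (.shr (.mem (.add (.reg 40) (.reg 43))) (.sub (.reg 41) (.reg 42)))) ;;
  push (.reg 41)

theorem wp_pushAnc {ea el : Expr} {s : State} {t : ℕ} {Q : ℕ → State → Prop} {a l M : ℤ}
    {p : Cell D} (hD : 1 ≤ D) (h1 : s.reg 1 = D) (h2 : s.reg 2 = M) (ha : ea.eval s = a)
    (hl : el.eval (s.setReg 40 a) = l) (hp : At s a p)
    (H : ∀ t' s', t' ≤ t + (ea.cost + el.cost + 50 * D) → Ext 40 s s' →
      s'.reg 50 = s.reg 50 + D → HoldsPoint s' (s.reg 50) (p.up (min l M)) → Q t' s') :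
    WP (pushAnc ea el) s t Q := by
  obtain ⟨N, rfl⟩ : ∃ N, D = N + 1 := ⟨D - 1, by omega⟩
  obtain ⟨⟨hp1, hp2⟩, hp3⟩ := hp
  simp only [Nat.add_sub_cancel] at hp1 hp2
  have h1' : s.reg 1 - 1 = N := by rw [h1]; push_cast; ring
  simp only [pushAnc, wp_seq, wp_set, Expr.eval, ha, hl]
  refine wp_setIf fun t1 ht1 => wp_setIf fun t2 ht2 => ?_
  simp only [Expr.eval, Expr.cost, State.setReg_reg, State.setReg_mem] at ht1 ht2 ⊢
  simp only [h1', h2, hp2, if_true, if_false, Nat.reduceEqDiff]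
  have e1 : (if M < l then M else l) = min l M := by omega
  have e2 : ∀ x : ℤ, (if x < p.lev then p.lev else x) = max x p.lev := fun x => by omega
  rw [e1, e2]
  refine wp_forUpto N (fun i s1 => Ext 40 s s1 ∧ s1.reg 40 = a ∧
      s1.reg 41 = max (min l M) p.lev ∧ s1.reg 42 = p.lev ∧ s1.reg 43 = i ∧
      s1.reg 50 = s.reg 50 + i ∧
      ∀ j : Fin N, (j : ℕ) < i → s1.mem (s.reg 50 + (j : ℕ)) = (p.up (min l M)).idx j) 30
      (by simp) ?_ ?_ ?_
  · rintro i s1 ⟨e1, g40, g41, g42, g43, g50, gm⟩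
    refine ⟨g43, ?_⟩
    simp [Expr.eval, e1.reg 1 (by norm_num), h1]
  · rintro i s1 t1 hi ⟨e1, g40, g41, g42, g43, g50, gm⟩
    have hm : s1.mem (a + i) = p.idx ⟨i, hi⟩ := by
      rw [e1.mem _ (by omega)]
      exact hp1 ⟨i, hi⟩
    simp only [wp_push, Expr.eval, Expr.cost, g40, g41, g42, g43, hm]
    refine ⟨by simp [g43], ⟨?_, by simp [g40], by simp [g41], by simp [g42], by simp, by
      simp [g50]; ring, ?_⟩, by omega⟩
    · simpa using e1.pushed _ (by norm_num)
    · intro j hj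
      rw [State.setReg_mem, State.pushed_mem, g50]
      split_ifs with hij
      · have : j = ⟨i, hi⟩ := Fin.ext (by simp only; omega)
        rw [this, up_idx]
        congr 2
        omega
      · exact gm j (by omega)
  · rintro s1 t3 ⟨e1, g40, g41, g42, g43, g50, gm⟩ ht3
    simp only [wp_push, Expr.eval, Expr.cost] at ht3 ⊢
    refine H _ _ (by omega) (e1.pushed _ (by norm_num)) (by simp [g50]; ring) ⟨fun j => ?_, ?_⟩
    · rw [State.pushed_mem, if_neg (by have := j.2; omega)]
      exact gm j j.2
    · rw [State.pushed_mem, if_pos (by simp [g50]), g41, up_lev]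

/-! ### Comparing two cells -/

theorem negSucc_ediv_two_pow (m t : ℕ) : Int.negSucc m / 2 ^ t = Int.negSucc (m / 2 ^ t) := by
  have h : (0 : ℤ) < 2 ^ t := by positivity
  rw [Int.ediv_eq_iff_of_pos h, Int.negSucc_eq, Int.negSucc_eq]
  have h1 := Nat.div_mul_le_self m (2 ^ t)
  have h2 := Nat.lt_div_mul_add (a := m) (b := 2 ^ t) (by positivity)
  zify at h1 h2
  push_cast
  constructor <;> linarith

theorem ediv_two_pow_eq_iff_of_xor {x y : ℤ} (h : 0 ≤ x.xor y) (t : ℕ) :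
    x / 2 ^ t = y / 2 ^ t ↔ (x.xor y).natAbs < 2 ^ t := by
  have key : ∀ m n : ℕ, m / 2 ^ t = n / 2 ^ t ↔ m ^^^ n < 2 ^ t := by
    intro m n
    rw [← Nat.xor_eq_zero_iff, ← Nat.xor_div_two_pow, Nat.div_eq_zero_iff]
    simp
  rcases x with m | m <;> rcases y with n | n
  · simp only [Int.xor, Int.ofNat_eq_natCast, Int.natAbs_natCast, ← key]
    norm_cast
  · simp [Int.xor] at h
  · simp [Int.xor] at h
  · simp only [Int.xor, negSucc_ediv_two_pow, Int.negSucc_inj, Int.natAbs_natCast, key]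

theorem nonneg_iff_of_xor_neg {x y : ℤ} (h : x.xor y < 0) : 0 ≤ x ↔ y < 0 := by
  rcases x with m | m <;> rcases y with n | n
  · simp only [Int.xor] at h
    omega
  · simp
  · simp
  · simp only [Int.xor] at h
    omega

theorem nonneg_iff_of_xor_nonneg {x y : ℤ} (h : 0 ≤ x.xor y) : 0 ≤ x ↔ 0 ≤ y := by
  rcases x with m | m <;> rcases y with n | n
  · simp
  · simp [Int.xor] at h
  · simp [Int.xor] at h
  · constructor <;> intro h' <;> omega

/-- The highest level up to `M + 2` at which the intervals with the indices `x` and `y` at level `L`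
have different ancestors, and `L - 1` if there is none. -/
def coordLevel (M L x y : ℤ) : ℤ :=
  if x.xor y < 0 then M + 2
  else if 0 < x.xor y then L + Nat.log 2 (x.xor y).natAbs else L - 1

theorem coordLevel_spec {M L x y : ℤ} (hL : L ≤ M + 2)
    (hx : -(2 ^ (M + 2 - L).toNat) ≤ x ∧ x < 2 ^ (M + 2 - L).toNat)
    (hy : -(2 ^ (M + 2 - L).toNat) ≤ y ∧ y < 2 ^ (M + 2 - L).toNat) :
    L - 1 ≤ coordLevel M L x y ∧ coordLevel M L x y ≤ M + 2 ∧
    (∀ t, L ≤ t → coordLevel M L x y < t → t ≤ M + 2 →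
      x / 2 ^ (t - L).toNat = y / 2 ^ (t - L).toNat) ∧
    (L ≤ coordLevel M L x y → x / 2 ^ (coordLevel M L x y - L).toNat ≠
      y / 2 ^ (coordLevel M L x y - L).toNat) := by
  have hpos : (0 : ℤ) < 2 ^ (M + 2 - L).toNat := by positivity
  unfold coordLevel
  split_ifs with h1 h2
  · refine ⟨by omega, le_rfl, fun t _ h h' => by omega, fun _ he => ?_⟩
    have h0 := nonneg_iff_of_xor_neg h1
    by_cases hx0 : 0 ≤ x
    · have a := Int.ediv_nonneg hx0 hpos.le
      have b := Int.ediv_neg_of_neg_of_pos (h0.1 hx0) hpos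
      omega
    · have a := Int.ediv_nonneg (by omega : 0 ≤ y) hpos.le
      have b := Int.ediv_neg_of_neg_of_pos (by omega : x < 0) hpos
      omega
  · have h0 : 0 ≤ x.xor y := h2.le
    have hz : (x.xor y).natAbs ≠ 0 := by omega
    have hlog : (Nat.log 2 (x.xor y).natAbs : ℤ) < (M + 2 - L).toNat := by
      have : (x.xor y).natAbs < 2 ^ (M + 2 - L).toNat := by
        rw [← ediv_two_pow_eq_iff_of_xor h0]
        have h3 := nonneg_iff_of_xor_nonneg h0
        by_cases hx0 : 0 ≤ x
        · rw [Int.ediv_eq_zero_of_lt hx0 hx.2, Int.ediv_eq_zero_of_lt (h3.1 hx0) hy.2]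
        · have e : ∀ z : ℤ, z < 0 → -(2 ^ (M + 2 - L).toNat) ≤ z →
              z / 2 ^ (M + 2 - L).toNat = -1 := by
            intro z hz hz'
            have a := Int.ediv_neg_of_neg_of_pos hz hpos
            have b := (Int.le_ediv_iff_mul_le (a := -1) (b := z) hpos).2 (by omega)
            omega
          rw [e x (by omega) hx.1, e y (by omega) hy.1]
      exact_mod_cast (Nat.log_lt_iff_lt_pow one_lt_two hz).2 this
    refine ⟨by omega, by omega, fun t h3 h4 h5 => ?_, fun _ => ?_⟩
    · rw [ediv_two_pow_eq_iff_of_xor h0, ← Nat.log_lt_iff_lt_pow one_lt_two hz]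
      omega
    · rw [Ne, ediv_two_pow_eq_iff_of_xor h0, ← Nat.log_lt_iff_lt_pow one_lt_two hz]
      omega
  · have hxy : x = y := by
      have := ediv_two_pow_eq_iff_of_xor (not_lt.1 h1) 0
      simp only [pow_zero, Int.ediv_one] at this
      rw [this]
      omega
    exact ⟨le_rfl, by omega, fun t _ _ _ => by rw [hxy], by omega⟩

theorem lt_iff_of_ediv_ne {x y : ℤ} {s : ℕ} (h : x / 2 ^ s ≠ y / 2 ^ s) :
    x < y ↔ x / 2 ^ s < y / 2 ^ s := by
  have hs : (0 : ℤ) ≤ 2 ^ s := by positivity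
  constructor
  · exact fun hlt => lt_of_le_of_ne (Int.ediv_le_ediv (by positivity) hlt.le) h
  · intro hlt
    by_contra! hc
    have := Int.ediv_le_ediv (c := 2 ^ s) (by positivity) hc
    omega

/-- The largest binary logarithm of a coordinate of the difference of the ancestors of `p` and `q`
at the lowest level at which both exist. -/
def diffLog (p q : Cell D) : ℕ :=
  Finset.univ.sup fun j => Nat.log 2
    ((p.up (max p.lev q.lev)).idx j - (q.up (max p.lev q.lev)).idx j).natAbs

open Classical in
/-- The truth value as an integer. -/
noncomputable def flag (P : Prop) : ℤ := if P then 1 else 0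

/-- Compares the cells at the addresses `a` and `b`. Register 34 receives the larger level, register
35 the split level, register 36 whether the first cell precedes the second one, and register 28 the
logarithm of their distance. -/
def splitCmp (a b : Expr) : Program :=
  .set 30 a ;; .set 31 b ;;
  .set 32 (.mem (.add (.reg 30) (.sub (.reg 1) (.lit 1)))) ;;
  .set 33 (.mem (.add (.reg 31) (.sub (.reg 1) (.lit 1)))) ;;
  .setIf 34 (.reg 32) (.reg 33) (.reg 33) (.reg 32) ;;
  .set 35 (.sub (.reg 34) (.lit 1)) ;;
  .setIf 36 (.reg 33) (.reg 32) (.lit 1) (.lit 0) ;;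
  .set 28 (.lit 0) ;;
  .forUpto 37 (.sub (.reg 1) (.lit 1))
    (.set 38 (.shr (.mem (.add (.reg 30) (.reg 37))) (.sub (.reg 34) (.reg 32))) ;;
    .set 39 (.shr (.mem (.add (.reg 31) (.reg 37))) (.sub (.reg 34) (.reg 33))) ;;
    .set 29 (.log (.sub (.reg 38) (.reg 39))) ;;
    .setIf 28 (.reg 28) (.reg 29) (.reg 29) (.reg 28) ;;
    .set 29 (.xor (.reg 38) (.reg 39)) ;;
    .setIf 27 (.lit 0) (.reg 29) (.add (.reg 34) (.log (.reg 29))) (.sub (.reg 34) (.lit 1)) ;;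
    .setIf 27 (.reg 29) (.lit 0) (.add (.reg 2) (.lit 2)) (.reg 27) ;;
    .setIf 26 (.reg 38) (.reg 39) (.lit 1) (.lit 0) ;;
    .setIf 36 (.reg 35) (.reg 27) (.reg 26) (.reg 36) ;;
    .setIf 35 (.reg 35) (.reg 27) (.reg 27) (.reg 35))

/-- What is known about the level `m` and the flag `b` after the first `i` coordinates. -/
def SplitInv (M : ℤ) (p q : Cell D) (i : ℕ) (m b : ℤ) : Prop :=
  max p.lev q.lev - 1 ≤ m ∧ m ≤ M + 2 ∧
  (∀ j : Fin (D - 1), (j : ℕ) < i → ∀ t, m < t → t ≤ M + 2 → (p.up t).idx j = (q.up t).idx j) ∧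
  (m = max p.lev q.lev - 1 ∧ b = flag (q.lev < p.lev) ∨
    max p.lev q.lev ≤ m ∧ ∃ j : Fin (D - 1), (j : ℕ) < i ∧
      (∀ k < j, (p.up m).idx k = (q.up m).idx k) ∧ (p.up m).idx j ≠ (q.up m).idx j ∧
      b = flag ((p.up m).idx j < (q.up m).idx j))

theorem SplitInv.step {M : ℤ} {p q : Cell D} {i : ℕ} {m b : ℤ} (h : SplitInv M p q i m b)
    (hp : Bdd M 4 p) (hq : Bdd M 4 q) (hi : i < D - 1) :
    SplitInv M p q (i + 1)
      (if m < coordLevel M (max p.lev q.lev) ((p.up (max p.lev q.lev)).idx ⟨i, hi⟩)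
        ((q.up (max p.lev q.lev)).idx ⟨i, hi⟩) then
        coordLevel M (max p.lev q.lev) ((p.up (max p.lev q.lev)).idx ⟨i, hi⟩)
        ((q.up (max p.lev q.lev)).idx ⟨i, hi⟩) else m)
      (if m < coordLevel M (max p.lev q.lev) ((p.up (max p.lev q.lev)).idx ⟨i, hi⟩)
        ((q.up (max p.lev q.lev)).idx ⟨i, hi⟩) then
        flag ((p.up (max p.lev q.lev)).idx ⟨i, hi⟩ < (q.up (max p.lev q.lev)).idx ⟨i, hi⟩)
        else b) := by
  have hp' := hp.root
  have hq' := hq.root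
  have hlp := hp.1
  have hlq := hq.1
  have bp := (hp'.up (i := max p.lev q.lev) (by omega)).2 ⟨i, hi⟩
  have bq := (hq'.up (i := max p.lev q.lev) (by omega)).2 ⟨i, hi⟩
  rw [one_mul, up_lev, max_eq_left (le_max_left _ _)] at bp
  rw [one_mul, up_lev, max_eq_left (le_max_right _ _)] at bq
  obtain ⟨h1, h2, h3, h4⟩ := coordLevel_spec (by omega) bp bq
  set g := coordLevel M (max p.lev q.lev) ((p.up (max p.lev q.lev)).idx ⟨i, hi⟩)
        ((q.up (max p.lev q.lev)).idx ⟨i, hi⟩)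
  obtain ⟨i1, i2, i3, i4⟩ := h
  have h3' : ∀ t, g < t → t ≤ M + 2 → max p.lev q.lev ≤ t →
      (p.up t).idx ⟨i, hi⟩ = (q.up t).idx ⟨i, hi⟩ := by
    intro t ht ht' hL
    rw [up_idx_of_le (le_max_left p.lev q.lev) hL, up_idx_of_le (le_max_right p.lev q.lev) hL]
    exact h3 t hL ht ht'
  by_cases hm : m < g
  · simp only [hm, if_true]
    refine ⟨h1, h2, fun j hj t ht ht' => ?_, Or.inr ⟨by omega, ⟨i, hi⟩, by simp, ?_, ?_, ?_⟩⟩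
    · rcases Nat.lt_succ_iff_lt_or_eq.1 hj with hj | hj
      · exact i3 j hj t (by omega) ht'
      · have : j = ⟨i, hi⟩ := Fin.ext hj
        rw [this]
        exact h3' t ht ht' (by omega)
    · intro k hk
      exact i3 k (by simpa [Fin.lt_def] using hk) g hm h2
    · rw [up_idx_of_le (le_max_left p.lev q.lev) (by omega),
        up_idx_of_le (le_max_right p.lev q.lev) (by omega)]
      exact h4 (by omega)
    · rw [up_idx_of_le (i' := g) (le_max_left p.lev q.lev) (by omega),
        up_idx_of_le (i' := g) (le_max_right p.lev q.lev) (by omega),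
        lt_iff_of_ediv_ne (h4 (by omega))]
  · simp only [hm, if_false]
    refine ⟨i1, i2, fun j hj t ht ht' => ?_, ?_⟩
    · rcases Nat.lt_succ_iff_lt_or_eq.1 hj with hj | hj
      · exact i3 j hj t ht ht'
      · have : j = ⟨i, hi⟩ := Fin.ext hj
        rw [this]
        exact h3' t (by omega) ht' (by omega)
    · rcases i4 with h | ⟨h, j, hj, h'⟩
      · exact Or.inl h
      · exact Or.inr ⟨h, j, by omega, h'⟩

theorem SplitInv.isSplit {M : ℤ} {p q : Cell D} {m b : ℤ} (h : SplitInv M p q (D - 1) m b) :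
    IsSplit (M + 2) p q m := by
  obtain ⟨i1, i2, i3, i4⟩ := h
  refine ⟨by clear i4; omega, by clear i4; omega, i2, fun i hi hi' => ?_, fun h1 h2 he => ?_⟩
  · clear i4
    ext j
    · exact i3 j j.2 i hi hi'
    · rw [up_lev, up_lev]
      omega
  · rcases i4 with h | ⟨h, j, hj, h', h'', -⟩
    · omega
    · exact h'' (by rw [he])

theorem SplitInv.flag_eq {M : ℤ} {p q : Cell D} {m b : ℤ} (h : SplitInv M p q (D - 1) m b)
    (hp : p.lev ≤ M) (hq : q.lev ≤ M) : b = flag (key (M + 2) p < key (M + 2) q) := by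
  have hs := h.isSplit
  obtain ⟨i1, i2, i3, ⟨h1, h2⟩ | ⟨h1, j, hj, h2, h3, h4⟩⟩ := h
  · rw [h2, hs.key_lt_iff' (by omega) (by omega) (by omega)]
  · rw [h4, hs.key_lt_iff (by omega) (by omega)]
    congr 1
    apply propext
    constructor
    · intro hlt
      exact ⟨j, h2, hlt⟩
    · rintro ⟨k, hk, hk'⟩
      rcases lt_trichotomy k j with hkj | rfl | hkj
      · exact absurd (h2 k hkj) hk'.ne
      · exact hk'
      · exact absurd (hk j hkj) h3

theorem wp_splitCmp {ea eb : Expr} {s : State} {t : ℕ} {Q : ℕ → State → Prop} {a b M : ℤ}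
    {p q : Cell D} (hD : 1 ≤ D) (h1 : s.reg 1 = D) (h2 : s.reg 2 = M) (ha : ea.eval s = a)
    (hb : eb.eval (s.setReg 30 a) = b) (hp : At s a p) (hq : At s b q) (hpM : Bdd M 4 p)
    (hqM : Bdd M 4 q)
    (H : ∀ t' s', t' ≤ t + (ea.cost + eb.cost + 120 * D) → Ext 26 s s' →
      s'.reg 50 = s.reg 50 → s'.reg 34 = max p.lev q.lev → s'.reg 35 = split (M + 2) p q →
      IsSplit (M + 2) p q (split (M + 2) p q) →
      s'.reg 36 = flag (key (M + 2) p < key (M + 2) q) → s'.reg 28 = diffLog p q → Q t' s') :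
    WP (splitCmp ea eb) s t Q := by
  obtain ⟨N, rfl⟩ : ∃ N, D = N + 1 := ⟨D - 1, by omega⟩
  obtain ⟨⟨hp1, hp2⟩, hp3⟩ := hp
  obtain ⟨⟨hq1, hq2⟩, hq3⟩ := hq
  simp only [Nat.add_sub_cancel] at hp1 hp2 hq1 hq2 hp3 hq3
  have h1' : s.reg 1 - 1 = N := by rw [h1]; push_cast; ring
  simp only [splitCmp, wp_seq, wp_set, Expr.eval, ha, hb]
  refine wp_setIf fun t1 ht1 => wp_setIf fun t2 ht2 => ?_
  simp only [Expr.eval, Expr.cost, State.setReg_reg, State.setReg_mem] at ht1 ht2 ⊢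
  simp only [h1', hp2, hq2, if_true, if_false, Nat.reduceEqDiff]
  have e1 : (if p.lev < q.lev then q.lev else p.lev) = max p.lev q.lev := by omega
  have e2 : (if q.lev < p.lev then (1 : ℤ) else 0) = flag (q.lev < p.lev) := by
    unfold flag; congr
  rw [e1, e2]
  refine wp_forUpto N (fun i s1 => Ext 26 s s1 ∧ s1.reg 50 = s.reg 50 ∧ s1.reg 30 = a ∧
      s1.reg 31 = b ∧ s1.reg 32 = p.lev ∧ s1.reg 33 = q.lev ∧ s1.reg 34 = max p.lev q.lev ∧
      s1.reg 37 = i ∧ SplitInv M p q i (s1.reg 35) (s1.reg 36) ∧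
      ∃ E : ℕ, s1.reg 28 = E ∧ ∀ c : ℕ, E ≤ c ↔ ∀ j : Fin N, (j : ℕ) < i → Nat.log 2
        ((p.up (max p.lev q.lev)).idx j - (q.up (max p.lev q.lev)).idx j).natAbs ≤ c) 80
      ?_ ?_ ?_ ?_
  · have := hpM.1
    have := hqM.1
    simp
    refine ⟨⟨le_rfl, by omega, by simp, Or.inl ⟨rfl, rfl⟩⟩, 0, rfl, by simp⟩
  · rintro i s1 ⟨f1, f50, f30, f31, f32, f33, f34, f37, -⟩
    refine ⟨f37, ?_⟩
    simp [Expr.eval, f1.reg 1 (by norm_num), h1]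
  · rintro i s1 t3 hi ⟨f1, f50, f30, f31, f32, f33, f34, f37, fs, E, fE, fE'⟩
    have hm : s1.mem (a + i) = p.idx ⟨i, hi⟩ := by
      rw [f1.mem _ (by omega)]
      exact hp1 ⟨i, hi⟩
    have hm' : s1.mem (b + i) = q.idx ⟨i, hi⟩ := by
      rw [f1.mem _ (by omega)]
      exact hq1 ⟨i, hi⟩
    have f2 : s1.reg 2 = M := by rw [f1.reg 2 (by norm_num), h2]
    simp only [wp_seq, wp_set, Expr.eval, f30, f31, f32, f33, f34, f37, hm, hm', State.setReg_reg,
      State.setReg_mem, if_true, if_false, Nat.reduceEqDiff]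
    have u1 : p.idx ⟨i, hi⟩ / 2 ^ (max p.lev q.lev - p.lev).toNat =
      (p.up (max p.lev q.lev)).idx ⟨i, hi⟩ := rfl
    have u2 : q.idx ⟨i, hi⟩ / 2 ^ (max p.lev q.lev - q.lev).toNat =
      (q.up (max p.lev q.lev)).idx ⟨i, hi⟩ := rfl
    rw [u1, u2]
    have hstep := fs.step hpM hqM hi
    set x := (p.up (max p.lev q.lev)).idx ⟨i, hi⟩
    set y := (q.up (max p.lev q.lev)).idx ⟨i, hi⟩
    refine wp_setIf fun t4 ht4 => ?_
    refine wp_setIf fun t5 ht5 => ?_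
    refine wp_setIf fun t6 ht6 => ?_
    refine wp_setIf fun t7 ht7 => ?_
    refine wp_setIf fun t8 ht8 => ?_
    refine wp_setIf fun t9 ht9 => ?_
    simp only [Expr.eval, Expr.cost, State.setReg_reg, f2, f34,
      if_true, if_false, Nat.reduceEqDiff] at ht4 ht5 ht6 ht7 ht8 ht9 ⊢
    have e3 : (if x.xor y < 0 then M + 2 else if 0 < x.xor y then
        max p.lev q.lev + (Nat.log 2 (x.xor y).natAbs : ℤ) else max p.lev q.lev - 1) =
        coordLevel M (max p.lev q.lev) x y := rfl
    have e4 : (if x < y then (1 : ℤ) else 0) = flag (x < y) := by unfold flag; congr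
    simp only [e3, e4]
    refine ⟨f37, ⟨by simpa using f1, by simp [f50], by simp [f30], by simp [f31], by simp [f32],
      by simp [f33], by simp, by simp, hstep, ?_⟩, by omega⟩
    refine ⟨max E (Nat.log 2 (x - y).natAbs), ?_, fun c => ?_⟩
    · simp only [fE]
      push_cast
      omega
    · rw [max_le_iff, fE']
      constructor
      · rintro ⟨g1, g2⟩ j hj
        rcases Nat.lt_succ_iff_lt_or_eq.1 hj with hj | hj
        · exact g1 j hj
        · have : j = ⟨i, hi⟩ := Fin.ext hj
          rw [this]
          exact g2
      · intro g
        exact ⟨fun j hj => g j (by omega), g ⟨i, hi⟩ (by simp)⟩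
  · rintro s1 t3 ⟨f1, f50, f30, f31, f32, f33, f34, f37, fs, E, fE, fE'⟩ ht3
    simp only [Expr.cost] at ht3
    have hs : IsSplit (M + 2) p q (s1.reg 35) := fs.isSplit
    refine H _ _ (by omega) f1 f50 f34 hs.split_eq.symm (by rw [hs.split_eq]; exact hs)
      (fs.flag_eq hpM.1 hqM.1) ?_
    rw [fE, Nat.cast_inj, diffLog]
    apply le_antisymm
    · rw [fE']
      intro j hj
      exact Finset.le_sup (f := fun j => Nat.log 2
        ((p.up (max p.lev q.lev)).idx j - (q.up (max p.lev q.lev)).idx j).natAbs)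
        (Finset.mem_univ j)
    · refine Finset.sup_le fun j _ => ?_
      exact (fE' E).1 le_rfl j j.2

/-! ### Tables of cells and arrays of pointers -/

/-- The loop `for r = b, b + d, b + 2 d, …` below `e`. -/
def Program.forStep (r : ℕ) (b d e : Expr) (p : Program) : Program :=
  .set r b ;; .loop (.reg r) e (p ;; .set r (.add (.reg r) d))

theorem wp_forStep {p : Program} {r : ℕ} {eb ed e : Expr} {s : State} {t : ℕ}
    {Q : ℕ → State → Prop} (N : ℕ) (b d : ℤ) (hd : 0 < d) (J : ℕ → State → Prop) (K : ℕ)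
    (h0 : J 0 (s.setReg r (eb.eval s)))
    (hreg : ∀ i s, J i s → s.reg r = b + i * d ∧ ed.eval s = d ∧ e.eval s = b + N * d)
    (step : ∀ i s t, i < N → J i s →
      WP p s t (fun t' s' => s'.reg r = b + i * d ∧ ed.eval s' = d ∧
        J (i + 1) (s'.setReg r (b + (i + 1 : ℕ) * d)) ∧
        t' + (ed.cost + e.cost + 5) ≤ t + K))
    (done : ∀ s' t', J N s' → t' ≤ t + K * N + (eb.cost + e.cost + 3) → Q t' s') :
    WP (.forStep r eb ed e p) s t Q := by
  rw [Program.forStep, wp_seq, wp_set]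
  refine wp_loop (fun v s => ∃ i, i + v = N ∧ J i s) K N ⟨0, by simp, h0⟩ ?_ ?_
  · rintro v s1 t1 ⟨i, hi, hJ⟩ hc
    obtain ⟨hr, he', he⟩ := hreg i s1 hJ
    simp only [Expr.eval, hr, he] at hc
    have hiN : i < N := by
      have : (i : ℤ) * d < N * d := by omega
      exact_mod_cast lt_of_mul_lt_mul_right this hd.le
    rw [wp_seq]
    refine (step i s1 t1 hiN hJ).mono ?_
    rintro t2 s2 ⟨h1, h1', h2, h3⟩
    rw [wp_set]
    refine ⟨v - 1, by omega, ⟨i + 1, by omega, ?_⟩, ?_⟩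
    · have : b + i * d + d = b + (i + 1 : ℕ) * d := by push_cast; ring
      simpa only [Expr.eval, h1, h1', this] using h2
    obtain ⟨w, rfl⟩ : ∃ w, v = w + 1 := ⟨v - 1, by omega⟩
    simp only [Expr.cost, Nat.add_sub_cancel, mul_add, mul_one]
    omega
  · rintro v s1 t1 hv ⟨i, hi, hJ⟩ hc ht
    obtain ⟨hr, he', he⟩ := hreg i s1 hJ
    simp only [Expr.eval, hr, he] at hc
    obtain rfl : i = N := by
      by_contra hne
      refine hc (add_lt_add_right (mul_lt_mul_of_pos_right ?_ hd) b)
      exact_mod_cast (show i < N by omega)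
    refine done s1 t1 hJ ?_
    simp only [Expr.cost] at ht
    omega

/-- The cells of the list `L` are stored one after the other from the address `b` on. -/
def Tab (s : State) (b : ℤ) (L : List (Cell D)) : Prop :=
  ∀ i (h : i < L.length), At s (b + i * D) L[i]

/-- A table at the end of the used memory. -/
def OpenTab (s : State) (b : ℤ) (L : List (Cell D)) : Prop :=
  Tab s b L ∧ s.reg 50 = b + L.length * D

/-- The addresses of the cells of the list `L` are stored one after the other from the address `b`
on. -/
def Arr (s : State) (b : ℤ) (L : List (Cell D)) : Prop :=
  b + L.length ≤ s.reg 50 ∧ ∀ i (h : i < L.length), At s (s.mem (b + i)) L[i]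

/-- An array of pointers at the end of the used memory. -/
def OpenArr (s : State) (b : ℤ) (L : List (Cell D)) : Prop :=
  Arr s b L ∧ s.reg 50 = b + L.length

theorem Tab.ext {k : ℕ} {s s' : State} {b : ℤ} {L : List (Cell D)} (h : Tab s b L)
    (he : Ext k s s') : Tab s' b L :=
  fun i hi => (h i hi).ext he

theorem Arr.ext {k : ℕ} {s s' : State} {b : ℤ} {L : List (Cell D)} (h : Arr s b L)
    (he : Ext k s s') : Arr s' b L := by
  refine ⟨h.1.trans he.top, fun i hi => ?_⟩
  have := h.1
  rw [he.mem _ (by omega)]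
  exact (h.2 i hi).ext he

theorem OpenTab.ext {k : ℕ} {s s' : State} {b : ℤ} {L : List (Cell D)} (h : OpenTab s b L)
    (he : Ext k s s') (ht : s'.reg 50 = s.reg 50) : OpenTab s' b L :=
  ⟨h.1.ext he, ht.trans h.2⟩

theorem OpenArr.ext {k : ℕ} {s s' : State} {b : ℤ} {L : List (Cell D)} (h : OpenArr s b L)
    (he : Ext k s s') (ht : s'.reg 50 = s.reg 50) : OpenArr s' b L :=
  ⟨h.1.ext he, ht.trans h.2⟩

@[simp] theorem tab_setReg {s : State} {r : ℕ} {v b : ℤ} {L : List (Cell D)} (hr : 50 ≠ r) :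
    Tab (s.setReg r v) b L ↔ Tab s b L := by
  simp [Tab, hr]

@[simp] theorem arr_setReg {s : State} {r : ℕ} {v b : ℤ} {L : List (Cell D)} (hr : 50 ≠ r) :
    Arr (s.setReg r v) b L ↔ Arr s b L := by
  simp [Arr, hr]

@[simp] theorem openTab_setReg {s : State} {r : ℕ} {v b : ℤ} {L : List (Cell D)} (hr : 50 ≠ r) :
    OpenTab (s.setReg r v) b L ↔ OpenTab s b L := by
  simp [OpenTab, hr]

@[simp] theorem openArr_setReg {s : State} {r : ℕ} {v b : ℤ} {L : List (Cell D)} (hr : 50 ≠ r) :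
    OpenArr (s.setReg r v) b L ↔ OpenArr s b L := by
  simp [OpenArr, hr]

theorem openTab_nil {s : State} {b : ℤ} (h : s.reg 50 = b) : OpenTab s b ([] : List (Cell D)) :=
  ⟨fun i hi => absurd hi (by simp), by simp [h]⟩

theorem openArr_nil {s : State} {b : ℤ} (h : s.reg 50 = b) : OpenArr s b ([] : List (Cell D)) :=
  ⟨⟨by simp [h], fun i hi => absurd hi (by simp)⟩, by simp [h]⟩

theorem OpenTab.append {k : ℕ} {s s' : State} {b : ℤ} {L : List (Cell D)} {C : Cell D}
    (h : OpenTab s b L) (hD : 1 ≤ D) (he : Ext k s s') (ht : s'.reg 50 = s.reg 50 + D)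
    (hC : HoldsPoint s' (s.reg 50) C) : OpenTab s' b (L ++ [C]) := by
  refine ⟨fun i hi => ?_, ?_⟩
  · rw [List.length_append, List.length_singleton] at hi
    rcases Nat.lt_succ_iff_lt_or_eq.1 hi with hi | rfl
    · rw [List.getElem_append_left hi]
      exact (h.1 i hi).ext he
    · simp only [le_refl, List.getElem_append_right, tsub_self, List.getElem_cons_zero]
      rw [← h.2]
      exact ⟨hC, by omega⟩
  · rw [ht, h.2, List.length_append, List.length_singleton]
    push_cast
    ring

theorem OpenArr.append {s : State} {b v : ℤ} {L : List (Cell D)} {C : Cell D}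
    (h : OpenArr s b L) (hC : At s v C) : OpenArr (s.pushed v) b (L ++ [C]) := by
  have he : Ext 0 s (s.pushed v) := (Ext.refl 0 s).pushed v (by norm_num)
  refine ⟨⟨?_, fun i hi => ?_⟩, ?_⟩
  · simp [h.2, add_assoc]
  · rw [List.length_append, List.length_singleton] at hi
    rcases Nat.lt_succ_iff_lt_or_eq.1 hi with hi | rfl
    · rw [List.getElem_append_left hi, State.pushed_mem, if_neg (by rw [h.2]; omega)]
      exact (h.1.2 i hi).ext he
    · simp only [le_refl, List.getElem_append_right, tsub_self, List.getElem_cons_zero]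
      rw [State.pushed_mem, if_pos h.2.symm]
      exact hC.ext he
  · simp [h.2, add_assoc]

/-- Registers 1 and 2 hold the dimension and the bound for the levels. -/
def Env (D : ℕ) (M : ℤ) (s : State) : Prop := s.reg 1 = D ∧ s.reg 2 = M

theorem Env.ext {M : ℤ} {k : ℕ} {s s' : State} (h : Env D M s) (he : Ext k s s') (hk : 2 < k) :
    Env D M s' :=
  ⟨(he.reg 1 (by omega)).trans h.1, (he.reg 2 (by omega)).trans h.2⟩

@[simp] theorem env_setReg {M : ℤ} {s : State} {r : ℕ} {v : ℤ} (hr : 2 < r) :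
    Env D M (s.setReg r v) ↔ Env D M s := by
  simp [Env, show 1 ≠ r by omega, show 2 ≠ r by omega]

/-- Appends an array of pointers to the cells of the table between the addresses `b` and `e`. -/
def mkPtr (b e : Expr) : Program := .forStep 15 b (.reg 1) e (push (.reg 15))

theorem wp_mkPtr {eb ee : Expr} {s : State} {t : ℕ} {Q : ℕ → State → Prop} {b M : ℤ}
    {L : List (Cell D)} (hD : 1 ≤ D) (hs : Env D M s) (hb : eb.eval s = b)
    (he : ∀ s', Ext 15 s s' → ee.eval s' = b + L.length * D) (hL : Tab s b L)
    (H : ∀ t' s', t' ≤ t + (eb.cost + (ee.cost + 20) * (L.length + 1)) → Ext 15 s s' →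
      OpenArr s' (s.reg 50) L → Q t' s') :
    WP (mkPtr eb ee) s t Q := by
  rw [mkPtr]
  refine wp_forStep L.length b D (by omega) (fun i s1 => Ext 15 s s1 ∧ s1.reg 15 = b + i * D ∧
    OpenArr s1 (s.reg 50) (L.take i)) (ee.cost + 20) ?_ ?_ ?_ ?_
  · simp [hb, openArr_nil]
  · rintro i s1 ⟨h1, h2, h3⟩
    exact ⟨h2, (hs.ext h1 (by norm_num)).1, he _ h1⟩
  · rintro i s1 t1 hi ⟨h1, h2, h3⟩
    simp only [wp_push, Expr.eval, Expr.cost, h2]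
    refine ⟨by simp [h2], ?_, ⟨?_, by simp, ?_⟩, by omega⟩
    · simpa using (hs.ext h1 (by norm_num)).1
    · simpa using h1.pushed _ (by norm_num)
    · rw [openArr_setReg (by norm_num), List.take_succ_eq_append_getElem hi]
      exact h3.append ((hL i hi).ext h1)
  · rintro s1 t1 ⟨h1, h2, h3⟩ ht1
    refine H _ _ (by rw [mul_add]; omega) h1 ?_
    simpa using h3

/-- The binary search in the sorted array of `n` pointers at the address `b`. Register 15 receives
the number of cells that precede the cell at the address `a`. -/
def bsearch (b n a : Expr) : Program :=
  .set 15 (.lit 0) ;; .set 16 n ;; .set 18 a ;; .set 19 b ;;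
  .loop (.reg 15) (.reg 16)
    (.set 17 (.shr (.add (.reg 15) (.reg 16)) (.lit 1)) ;;
    splitCmp (.mem (.add (.reg 19) (.reg 17))) (.reg 18) ;;
    .ite (.lit 0) (.reg 36) (.set 15 (.add (.reg 17) (.lit 1))) (.set 16 (.reg 17)))

/-- The list is sorted by the keys of its cells. -/
def SortedCells (M : ℤ) (L : List (Cell D)) : Prop :=
  L.Pairwise fun p q => key (M + 2) p ≤ key (M + 2) q

/-- The number of cells of `L` before the cell `x`. -/
structure IsLowerBound (M : ℤ) (L : List (Cell D)) (x : Cell D) (r : ℕ) : Prop where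
  le : r ≤ L.length
  lt : ∀ i (h : i < L.length), i < r → key (M + 2) L[i] < key (M + 2) x
  ge : ∀ i (h : i < L.length), r ≤ i → key (M + 2) x ≤ key (M + 2) L[i]

theorem SortedCells.key_le {M : ℤ} {L : List (Cell D)} (h : SortedCells M L) {i j : ℕ}
    (hij : i ≤ j) (hj : j < L.length) : key (M + 2) L[i] ≤ key (M + 2) L[j] := by
  rcases hij.eq_or_lt with rfl | hij
  · exact le_rfl
  · exact List.pairwise_iff_getElem.1 h i j (by omega) hj hij

theorem wp_bsearch {eb en ea : Expr} {s : State} {t : ℕ} {Q : ℕ → State → Prop} {b a M : ℤ}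
    {L : List (Cell D)} {x : Cell D} (hD : 1 ≤ D) (hs : Env D M s)
    (hb : ∀ s', Ext 15 s s' → eb.eval s' = b)
    (hn : ∀ s', Ext 15 s s' → en.eval s' = L.length)
    (ha : ∀ s', Ext 15 s s' → ea.eval s' = a)
    (hL : Arr s b L) (hx : At s a x) (hLs : SortedCells M L) (hLM : ∀ p ∈ L, Bdd M 4 p)
    (hxM : Bdd M 4 x)
    (H : ∀ t' s' r, t' ≤ t + (eb.cost + en.cost + ea.cost + 200 * D * (Nat.log 2 L.length + 2)) →
      Ext 15 s s' → s'.reg 50 = s.reg 50 → s'.reg 15 = (r : ℕ) → IsLowerBound M L x r → Q t' s') :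
    WP (bsearch eb en ea) s t Q := by
  have hd : ∀ n, 200 * D * n = 200 * (D * n) := fun n => mul_assoc _ _ _
  simp only [bsearch, wp_seq, wp_set]
  rw [hb _ (by simp), hn _ (by simp), ha _ (by simp)]
  refine wp_loop (fun v s1 => ∃ lo hi : ℕ, Ext 15 s s1 ∧ s1.reg 50 = s.reg 50 ∧ s1.reg 15 = lo ∧
    s1.reg 16 = hi ∧ s1.reg 18 = a ∧ s1.reg 19 = b ∧ lo ≤ hi ∧ hi ≤ L.length ∧ hi - lo < 2 ^ v ∧
    (∀ i (h : i < L.length), i < lo → key (M + 2) L[i] < key (M + 2) x) ∧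
    (∀ i (h : i < L.length), hi ≤ i → key (M + 2) x ≤ key (M + 2) L[i])) (200 * D)
    (Nat.log 2 L.length + 1)
    ⟨0, L.length, by simp, by simp [Expr.eval], by simp [Expr.eval], by simp, by simp, by simp,
      by simp, by simp, by simpa using Nat.lt_pow_succ_log_self one_lt_two _, by simp,
      fun i h h' => by omega⟩ ?_ ?_
  · rintro v s1 t1 ⟨lo, hi, h1, h50, h15, h16, h18, h19, hle, hlen, hv, hlo, hhi⟩ hc
    simp only [Expr.eval, h15, h16, Nat.cast_lt] at hc
    have hmid : (lo + hi) / 2 < L.length := by omega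
    have hev : ((lo : ℤ) + hi) / 2 ^ (Int.toNat 1) = ((lo + hi) / 2 : ℕ) := by simp
    have hs1 := hs.ext h1 (by norm_num)
    simp only [wp_seq, wp_set, Expr.eval, h15, h16, hev]
    refine wp_splitCmp (p := L[(lo + hi) / 2]) (q := x) hD (by simp [hs1.1]) (by simp [hs1.2]) rfl
      rfl ?_ ?_ (hLM _ (List.getElem_mem _)) hxM ?_
    · simpa [Expr.eval, h19] using (hL.ext h1).2 _ hmid
    · simpa [Expr.eval, h18] using hx.ext h1
    · intro t2 s2 ht2 he2 h50' h34 h35 hsplit h36 h28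
      simp only [Expr.cost] at ht2
      have he2' : Ext 15 s s2 := h1.trans (by
        refine Ext.trans ?_ (he2.mono (k' := 15) (by norm_num))
        simp)
      have g15 : s2.reg 15 = lo := by simpa [h15] using he2.reg 15 (by norm_num)
      have g16 : s2.reg 16 = hi := by simpa [h16] using he2.reg 16 (by norm_num)
      have g17 : s2.reg 17 = ((lo + hi) / 2 : ℕ) := by simpa using he2.reg 17 (by norm_num)
      have g18 : s2.reg 18 = a := by simpa [h18] using he2.reg 18 (by norm_num)
      have g19 : s2.reg 19 = b := by simpa [h19] using he2.reg 19 (by norm_num)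
      have g50 : s2.reg 50 = s.reg 50 := by simpa [h50] using h50'
      obtain ⟨w, rfl⟩ : ∃ w, v = w + 1 := by
        refine ⟨v - 1, ?_⟩
        rcases v with _ | v
        · simp at hv
          omega
        · rfl
      have hw : 200 * D * (w + 1) = 200 * D * w + 200 * D := by ring
      rw [pow_succ] at hv
      simp only [wp_ite, wp_set, Expr.eval, h36, flag]
      split_ifs with hlt
      · refine ⟨fun _ => ?_, fun h => absurd h (by norm_num)⟩
        refine ⟨w, by omega, ⟨(lo + hi) / 2 + 1, hi, by simpa using he2', by simp [g50],
          by simp [g17], by simp [g16], by simp [g18], by simp [g19], by omega, by omega,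
          by omega, ?_, hhi⟩, ?_⟩
        · intro i h hi'
          exact (hLs.key_le (by omega) hmid).trans_lt hlt
        · simp only [Expr.cost]
          omega
      · refine ⟨fun h => absurd h (by norm_num), fun _ => ?_⟩
        refine ⟨w, by omega, ⟨lo, (lo + hi) / 2, by simpa using he2', by simp [g50],
          by simp [g15], by simp [g17], by simp [g18], by simp [g19], by omega, by omega,
          by omega, hlo, ?_⟩, ?_⟩
        · intro i h hi'
          exact (not_lt.1 hlt).trans (hLs.key_le hi' h)
        · simp only [Expr.cost]
          omega
  · rintro v s1 t1 hv ⟨lo, hi, h1, h50, h15, h16, h18, h19, hle, hlen, -, hlo, hhi⟩ hc ht1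
    simp only [Expr.eval, h15, h16, Nat.cast_lt] at hc
    obtain rfl : lo = hi := by omega
    refine H t1 s1 lo ?_ h1 h50 h15 ⟨hlen, hlo, hhi⟩
    simp only [Expr.cost] at ht1
    rw [mul_add, mul_one] at ht1
    rw [mul_add]
    omega

/-! ### Merge sort -/

open Classical in
/-- The order of the keys as a Boolean comparison. -/
noncomputable def keyLe (M : ℤ) (p q : Cell D) : Bool := decide (key (M + 2) p ≤ key (M + 2) q)

theorem sortedCells_merge {M : ℤ} {l r : List (Cell D)} (hl : SortedCells M l)
    (hr : SortedCells M r) : SortedCells M (l.merge r (keyLe M)) := by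
  have h := List.pairwise_merge (le := keyLe M) (l₁ := l) (l₂ := r)
    (by simp only [keyLe, decide_eq_true_eq]; exact fun a b c h h' => h.trans h')
    (by simp only [keyLe, Bool.or_eq_true, decide_eq_true_eq]; exact fun a b => le_total _ _)
    (by simpa [keyLe, SortedCells] using hl) (by simpa [keyLe, SortedCells] using hr)
  simpa [keyLe, SortedCells] using h

/-- The list is a concatenation of sorted runs of length `w`, the last of which may be shorter. -/
inductive Runs (M : ℤ) (w : ℕ) : List (Cell D) → Prop
  | nil : Runs M w []
  | step {L : List (Cell D)} : L ≠ [] → SortedCells M (L.take w) → Runs M w (L.drop w) → Runs M w L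

theorem Runs.take {M : ℤ} {w : ℕ} {L : List (Cell D)} (h : Runs M w L) :
    SortedCells M (L.take w) := by
  cases h with
  | nil => simp [SortedCells]
  | step _ h _ => exact h

theorem Runs.drop {M : ℤ} {w : ℕ} {L : List (Cell D)} (h : Runs M w L) :
    Runs M w (L.drop w) := by
  cases h with
  | nil => simpa using Runs.nil
  | step _ _ h => exact h

theorem runs_one {M : ℤ} (L : List (Cell D)) : Runs M 1 L := by
  induction L with
  | nil => exact .nil
  | cons a L ih => exact .step (by simp) (by simp [SortedCells]) (by simpa using ih)

theorem Runs.cons {M : ℤ} {w : ℕ} {m L : List (Cell D)} (hm : SortedCells M m) (hne : m ≠ [])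
    (hw : m.length = w ∨ m.length ≤ w ∧ L = []) (h : Runs M w L) : Runs M w (m ++ L) := by
  refine .step (by simp [hne]) ?_ ?_
  · rcases hw with rfl | ⟨hw, rfl⟩
    · simpa using hm
    · simpa [List.take_of_length_le hw] using hm
  · rcases hw with rfl | ⟨hw, rfl⟩
    · simpa using h
    · simpa [List.drop_of_length_le hw] using h

/-- Merges the runs between the positions in the registers 22, 19 and 23, 20 of the array at the
address in register 15. -/
def mergeRuns : Program :=
  .loop (.reg 21) (.reg 20)
    (.set 24 (.lit 0) ;;
    .ite (.reg 23) (.reg 20)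
      (.ite (.reg 22) (.reg 19)
        (splitCmp (.mem (.add (.reg 15) (.reg 23))) (.mem (.add (.reg 15) (.reg 22))) ;;
          .set 24 (.reg 36))
        (.set 24 (.lit 1)))
      .skip ;;
    .ite (.lit 0) (.reg 24)
      (push (.mem (.add (.reg 15) (.reg 23))) ;; .set 23 (.add (.reg 23) (.lit 1)))
      (push (.mem (.add (.reg 15) (.reg 22))) ;; .set 22 (.add (.reg 22) (.lit 1))) ;;
    .set 21 (.add (.reg 21) (.lit 1)))

theorem wp_mergeRuns {s : State} {t : ℕ} {Q : ℕ → State → Prop} {b ob M : ℤ}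
    {L O : List (Cell D)} {i mid hi : ℕ} (hD : 1 ≤ D) (hs : Env D M s) (h15 : s.reg 15 = b)
    (h19 : s.reg 19 = mid) (h20 : s.reg 20 = hi) (h21 : s.reg 21 = i) (h22 : s.reg 22 = i)
    (h23 : s.reg 23 = mid) (hi1 : i ≤ mid) (hi2 : mid ≤ hi) (hi3 : hi ≤ L.length)
    (hL : Arr s b L) (hO : OpenArr s ob O) (hLM : ∀ p ∈ L, Bdd M 4 p)
    (H : ∀ t' s', t' ≤ t + (200 * D * (hi - i) + 3) → Ext 21 s s' → s'.reg 21 = hi →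
      OpenArr s' ob (O ++ ((L.take mid).drop i).merge ((L.take hi).drop mid) (keyLe M)) →
      Q t' s') :
    WP mergeRuns s t Q := by
  rw [mergeRuns]
  refine wp_loop (fun v s1 => ∃ (a c : ℕ) (X : List (Cell D)), v + (a + c) = hi + mid ∧ a ≤ mid ∧
    mid ≤ c ∧ c ≤ hi ∧ Ext 21 s s1 ∧ s1.reg 21 = a + c - mid ∧ s1.reg 22 = a ∧ s1.reg 23 = c ∧
    OpenArr s1 ob (O ++ X) ∧
    X ++ ((L.take mid).drop a).merge ((L.take hi).drop c) (keyLe M) =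
      ((L.take mid).drop i).merge ((L.take hi).drop mid) (keyLe M)) (200 * D) (hi - i)
    ⟨i, mid, [], by omega, hi1, le_rfl, hi2, by simp, by omega, h22, h23, by simpa using hO,
      rfl⟩ ?_ ?_
  · rintro v s1 t1 ⟨a, c, X, hv, ha, hc, hc', he, g21, g22, g23, hX, hmerge⟩ hlt
    have g15 : s1.reg 15 = b := (he.reg 15 (by norm_num)).trans h15
    have g19 : s1.reg 19 = mid := (he.reg 19 (by norm_num)).trans h19
    have g20 : s1.reg 20 = hi := (he.reg 20 (by norm_num)).trans h20
    have hs1 := hs.ext he (by norm_num)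
    have hL1 := hL.ext he
    simp only [Expr.eval, g21, g20] at hlt
    have hKw : ∀ w, 200 * D * (w + 1) = 200 * D * w + 200 * D := fun w => by ring
    -- the two ways to continue
    have contR : ∀ (s2 : State) (t2 : ℕ) (hc2 : c < hi), Ext 21 s s2 → s2.reg 50 = s1.reg 50 →
        Ext 21 s1 s2 → s2.reg 22 = a → s2.reg 23 = c → s2.reg 21 = a + c - mid →
        s2.reg 24 = 1 → t2 ≤ t1 + (140 * D + 12) →
        (∀ h : a < mid, ¬ key (M + 2) L[a] ≤ key (M + 2) L[c]) →
        WP (.ite (.lit 0) (.reg 24)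
          (push (.mem (.add (.reg 15) (.reg 23))) ;; .set 23 (.add (.reg 23) (.lit 1)))
          (push (.mem (.add (.reg 15) (.reg 22))) ;; .set 22 (.add (.reg 22) (.lit 1))) ;;
          .set 21 (.add (.reg 21) (.lit 1))) s2 t2 (fun t' s' => ∃ v' < v,
          (∃ (a c : ℕ) (X : List (Cell D)), v' + (a + c) = hi + mid ∧ a ≤ mid ∧
            mid ≤ c ∧ c ≤ hi ∧ Ext 21 s s' ∧ s'.reg 21 = a + c - mid ∧ s'.reg 22 = a ∧
            s'.reg 23 = c ∧ OpenArr s' ob (O ++ X) ∧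
            X ++ ((L.take mid).drop a).merge ((L.take hi).drop c) (keyLe M) =
              ((L.take mid).drop i).merge ((L.take hi).drop mid) (keyLe M)) ∧
          t' + ((Expr.reg 21).cost + (Expr.reg 20).cost + 1) + 200 * D * v' ≤
            t1 + 200 * D * v) := by
      intro s2 t2 hc2 he2 f50 he12 f22 f23 f21 f24 ht2 hkey
      have f15 : s2.reg 15 = b := (he2.reg 15 (by norm_num)).trans h15
      simp only [wp_seq, wp_ite, wp_set, wp_push, Expr.eval, f24, f15, f23, Expr.cost]
      refine ⟨fun _ => ?_, fun h => absurd h (by norm_num)⟩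
      obtain ⟨w, rfl⟩ : ∃ w, v = w + 1 := ⟨v - 1, by omega⟩
      refine ⟨w, by omega, ⟨a, c + 1, X ++ [L[c]], by omega, ha, by omega, by omega, ?_, ?_, ?_, ?_,
        ?_, ?_⟩, ?_⟩
      · simpa using he2.pushed _ (by norm_num)
      · simp [f21]; omega
      · simp [f22]
      · simp [f23]
      · rw [openArr_setReg (by norm_num), openArr_setReg (by norm_num), ← List.append_assoc]
        exact (hX.ext he12 f50).append ((hL.ext he2).2 c (by omega))
      · rw [← hmerge, List.append_assoc]
        congr 1
        have e : (L.take hi).drop c = L[c] :: (L.take hi).drop (c + 1) := by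
          rw [List.drop_eq_getElem_cons (by simp; omega)]
          simp
        rw [e]
        by_cases h : a < mid
        · have e' : (L.take mid).drop a = L[a] :: (L.take mid).drop (a + 1) := by
            rw [List.drop_eq_getElem_cons (by simp; omega)]
            simp
          rw [e', List.cons_merge_cons, if_neg (by simpa [keyLe] using hkey h)]
          rfl
        · have e' : (L.take mid).drop a = [] := List.drop_of_length_le (by simp; omega)
          rw [e', List.nil_merge, List.nil_merge]
          rfl
      · rw [hKw]
        omega
    have contL : ∀ (s2 : State) (t2 : ℕ) (ha2 : a < mid), Ext 21 s s2 → s2.reg 50 = s1.reg 50 →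
        Ext 21 s1 s2 → s2.reg 22 = a → s2.reg 23 = c → s2.reg 21 = a + c - mid →
        s2.reg 24 = 0 → t2 ≤ t1 + (140 * D + 12) →
        (∀ h : c < hi, key (M + 2) L[a] ≤ key (M + 2) L[c]) →
        WP (.ite (.lit 0) (.reg 24)
          (push (.mem (.add (.reg 15) (.reg 23))) ;; .set 23 (.add (.reg 23) (.lit 1)))
          (push (.mem (.add (.reg 15) (.reg 22))) ;; .set 22 (.add (.reg 22) (.lit 1))) ;;
          .set 21 (.add (.reg 21) (.lit 1))) s2 t2 (fun t' s' => ∃ v' < v,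
          (∃ (a c : ℕ) (X : List (Cell D)), v' + (a + c) = hi + mid ∧ a ≤ mid ∧
            mid ≤ c ∧ c ≤ hi ∧ Ext 21 s s' ∧ s'.reg 21 = a + c - mid ∧ s'.reg 22 = a ∧
            s'.reg 23 = c ∧ OpenArr s' ob (O ++ X) ∧
            X ++ ((L.take mid).drop a).merge ((L.take hi).drop c) (keyLe M) =
              ((L.take mid).drop i).merge ((L.take hi).drop mid) (keyLe M)) ∧
          t' + ((Expr.reg 21).cost + (Expr.reg 20).cost + 1) + 200 * D * v' ≤
            t1 + 200 * D * v) := by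
      intro s2 t2 ha2 he2 f50 he12 f22 f23 f21 f24 ht2 hkey
      have f15 : s2.reg 15 = b := (he2.reg 15 (by norm_num)).trans h15
      simp only [wp_seq, wp_ite, wp_set, wp_push, Expr.eval, f24, f15, f22, Expr.cost]
      refine ⟨fun h => absurd h (by norm_num), fun _ => ?_⟩
      obtain ⟨w, rfl⟩ : ∃ w, v = w + 1 := ⟨v - 1, by omega⟩
      refine ⟨w, by omega, ⟨a + 1, c, X ++ [L[a]], by omega, by omega, hc, by omega, ?_, ?_, ?_, ?_,
        ?_, ?_⟩, ?_⟩
      · simpa using he2.pushed _ (by norm_num)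
      · simp [f21]; omega
      · simp [f22]
      · simp [f23]
      · rw [openArr_setReg (by norm_num), openArr_setReg (by norm_num), ← List.append_assoc]
        exact (hX.ext he12 f50).append ((hL.ext he2).2 a (by omega))
      · rw [← hmerge, List.append_assoc]
        congr 1
        have e : (L.take mid).drop a = L[a] :: (L.take mid).drop (a + 1) := by
          rw [List.drop_eq_getElem_cons (by simp; omega)]
          simp
        rw [e]
        by_cases h : c < hi
        · have e' : (L.take hi).drop c = L[c] :: (L.take hi).drop (c + 1) := by
            rw [List.drop_eq_getElem_cons (by simp; omega)]
            simp
          rw [e', List.cons_merge_cons, if_pos (by simpa [keyLe] using hkey h)]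
          rfl
        · have e' : (L.take hi).drop c = [] := List.drop_of_length_le (by simp; omega)
          rw [e', List.merge_right, List.merge_right]
          rfl
      · rw [hKw]
        omega
    rw [wp_seq, wp_set, wp_seq, wp_ite]
    simp only [Expr.eval, Expr.cost, State.setReg_reg, g20, g23, Nat.reduceEqDiff,
      if_false, Nat.cast_lt]
    constructor
    · intro hc2
      rw [wp_ite]
      simp only [Expr.eval, Expr.cost, State.setReg_reg, g19, g22, Nat.reduceEqDiff, if_false,
        Nat.cast_lt]
      constructor
      · intro ha2
        rw [wp_seq]
        refine wp_splitCmp (p := L[c]) (q := L[a]) hD (by simp [hs1.1]) (by simp [hs1.2]) rfl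
          rfl ?_ ?_ (hLM _ (List.getElem_mem _)) (hLM _ (List.getElem_mem _)) ?_
        · simpa [Expr.eval, g15, g23] using hL1.2 c (by omega)
        · simpa [Expr.eval, g15, g22] using hL1.2 a (by omega)
        · intro t2 s2 ht2 he2 h50' h34 h35 hsplit h36 h28
          simp only [Expr.cost] at ht2
          have he12 : Ext 21 s1 s2 := by
            refine Ext.trans ?_ (he2.mono (k' := 21) (by norm_num))
            simp
          have f22 : s2.reg 22 = a := by simpa [g22] using he2.reg 22 (by norm_num)
          have f23 : s2.reg 23 = c := by simpa [g23] using he2.reg 23 (by norm_num)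
          have f21 : s2.reg 21 = a + c - mid := by simpa [g21] using he2.reg 21 (by norm_num)
          have f50 : s2.reg 50 = s1.reg 50 := by simpa using h50'
          rw [wp_set]
          simp only [Expr.eval, h36, flag]
          split_ifs with hlt
          · refine contR _ _ hc2 ?_ (by simp [f50]) ?_ (by simp [f22]) (by simp [f23])
              (by simp [f21]) (by simp) (by simp only [Expr.cost]; omega) fun _ => not_le.2 hlt
            · simpa using he.trans he12
            · simpa using he12
          · refine contL _ _ ha2 ?_ (by simp [f50]) ?_ (by simp [f22]) (by simp [f23])
              (by simp [f21]) (by simp) (by simp only [Expr.cost]; omega) fun _ => not_lt.1 hlt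
            · simpa using he.trans he12
            · simpa using he12
      · intro ha2
        rw [wp_set]
        exact contR _ _ hc2 (by simpa using he) (by simp) (by simp) (by simp [g22]) (by simp [g23])
          (by simp [g21]) (by simp [Expr.eval]) (by simp only [Expr.cost]; omega)
          fun h => absurd h ha2
    · intro hc2
      rw [wp_skip]
      exact contL _ _ (by omega) (by simpa using he) (by simp) (by simp) (by simp [g22])
        (by simp [g23]) (by simp [g21]) (by simp) (by omega) fun h => absurd h hc2
  · rintro v s1 t1 hv ⟨a, c, X, hv', ha, hc, hc', he, g21, g22, g23, hX, hmerge⟩ hlt ht1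
    have g20 : s1.reg 20 = hi := (he.reg 20 (by norm_num)).trans h20
    simp only [Expr.eval, g21, g20] at hlt
    obtain rfl : a = mid := by omega
    obtain rfl : c = hi := by omega
    refine H _ _ (by simp only [Expr.cost] at ht1; omega) he (by rw [g21]; omega) ?_
    rw [← hmerge]
    have e : (L.take a).drop a = [] := List.drop_of_length_le (by simp)
    have e' : (L.take c).drop c = [] := List.drop_of_length_le (by simp)
    simpa [e, e'] using hX

/-- Merges the runs, of the length in register 17, of the array of the length in register 16 at the
address in register 15 in pairs, and appends the result to the memory. -/
def mergePass : Program :=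
  .set 21 (.lit 0) ;;
  .loop (.reg 21) (.reg 16)
    (.set 22 (.reg 21) ;;
    .set 23 (.add (.reg 21) (.reg 17)) ;;
    .set 20 (.add (.reg 23) (.reg 17)) ;;
    .setIf 23 (.reg 16) (.reg 23) (.reg 16) (.reg 23) ;;
    .setIf 20 (.reg 16) (.reg 20) (.reg 16) (.reg 20) ;;
    .set 19 (.reg 23) ;;
    mergeRuns)

theorem wp_mergePass {s : State} {t : ℕ} {Q : ℕ → State → Prop} {b M : ℤ}
    {L : List (Cell D)} {w : ℕ} (hD : 1 ≤ D) (hs : Env D M s) (h15 : s.reg 15 = b)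
    (h16 : s.reg 16 = L.length) (h17 : s.reg 17 = w) (hw : 1 ≤ w) (hR : Runs M w L)
    (hL : Arr s b L) (hLM : ∀ p ∈ L, Bdd M 4 p)
    (H : ∀ t' s' L', t' ≤ t + (300 * D * L.length + 5) → Ext 19 s s' →
      OpenArr s' (s.reg 50) L' → L'.Perm L → Runs M (2 * w) L' → Q t' s') :
    WP mergePass s t Q := by
  simp only [mergePass, wp_seq, wp_set, Expr.eval]
  refine wp_loop (fun v s1 => ∃ (i : ℕ) (O : List (Cell D)), v + i = L.length ∧ Ext 19 s s1 ∧
    s1.reg 21 = i ∧ OpenArr s1 (s.reg 50) O ∧ O.Perm (L.take i) ∧ Runs M w (L.drop i) ∧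
    ∀ R, (i < L.length ∨ R = []) → Runs M (2 * w) R → Runs M (2 * w) (O ++ R)) (300 * D) L.length
    ⟨0, [], by simp, by simp, by simp, by simp [openArr_nil], by simp, by simpa using hR,
      fun R _ h => by simpa using h⟩ ?_ ?_
  · rintro v s1 t1 ⟨i, O, hv, he, g21, hO, hperm, hRd, hRO⟩ hlt
    have g15 : s1.reg 15 = b := (he.reg 15 (by norm_num)).trans h15
    have g16 : s1.reg 16 = L.length := (he.reg 16 (by norm_num)).trans h16
    have g17 : s1.reg 17 = w := (he.reg 17 (by norm_num)).trans h17
    simp only [Expr.eval, g21, g16, Nat.cast_lt] at hlt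
    simp only [wp_seq, wp_set, Expr.eval, g21, g17, State.setReg_reg, if_true, if_false,
      Nat.reduceEqDiff]
    refine wp_setIf fun t2 ht2 => wp_setIf fun t3 ht3 => ?_
    simp only [Expr.eval, Expr.cost, g16, State.setReg_reg, if_true, if_false,
      Nat.reduceEqDiff] at ht2 ht3 ⊢
    have e1 : (if (L.length : ℤ) < i + w then (L.length : ℤ) else i + w) =
      (min (i + w) L.length : ℕ) := by push_cast; omega
    have e2 : (if (L.length : ℤ) < i + w + w then (L.length : ℤ) else i + w + w) =
      (min (i + w + w) L.length : ℕ) := by push_cast; omega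
    rw [e1, e2]
    refine wp_mergeRuns (L := L) (b := b) (i := i) (mid := min (i + w) L.length)
      (hi := min (i + w + w) L.length) (ob := s.reg 50) (O := O) hD
      (by simpa using hs.ext he (by norm_num)) (by simp [g15]) (by simp) (by simp) (by simp [g21])
      (by simp) (by simp) (by omega) (by omega) (by omega) (by simpa using hL.ext he)
      (by simpa using hO) hLM ?_
    intro t4 s2 ht4 he2 f21 hO2
    set l := (L.take (min (i + w) L.length)).drop i with hl
    set r := (L.take (min (i + w + w) L.length)).drop (min (i + w) L.length) with hr
    have hl' : l = (L.drop i).take w := by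
      rw [hl, ← List.take_take, List.take_length, List.drop_take]
      congr 1
      omega
    have hr' : r = ((L.drop i).drop w).take w := by
      rw [hr, ← List.take_take, List.take_length, List.drop_drop]
      by_cases hiw : i + w ≤ L.length
      · rw [min_eq_left hiw, List.drop_take]
        congr 1
        omega
      · rw [List.drop_of_length_le (by simp; omega), List.drop_of_length_le (by omega)]
        simp
    have hlen : (l.merge r (keyLe M)).length = min (i + w + w) L.length - i := by
      rw [List.length_merge, hl', hr']
      simp
      omega
    refine ⟨L.length - min (i + w + w) L.length, by omega, ⟨min (i + w + w) L.length,
      O ++ l.merge r (keyLe M), by omega, ?_, by rw [f21], hO2, ?_, ?_, ?_⟩, ?_⟩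
    · refine he.trans (Ext.trans ?_ (he2.mono (k' := 19) (by norm_num)))
      simp
    · have e3 : L.take (min (i + w + w) L.length) = L.take i ++ (l ++ r) := by
        rw [hl', hr', ← List.take_take, List.take_length, ← List.take_add, ← List.take_add,
          add_assoc]
      rw [e3]
      exact hperm.append (List.merge_perm_append _)
    · have := hRd.drop.drop
      rw [List.drop_drop, List.drop_drop, ← add_assoc] at this
      by_cases hiw : i + w + w ≤ L.length
      · rw [min_eq_left hiw]
        exact this
      · rw [List.drop_of_length_le (by omega)]
        exact .nil
    · intro R hR' hRR
      rw [List.append_assoc]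
      refine hRO _ (Or.inl hlt) (Runs.cons ?_ ?_ ?_ hRR)
      · exact sortedCells_merge (hl' ▸ hRd.take) (hr' ▸ hRd.drop.take)
      · rw [← List.length_pos_iff_ne_nil, hlen]
        omega
      · rw [hlen]
        rcases hR' with h | h
        · left
          omega
        · right
          exact ⟨by omega, h⟩
    · obtain ⟨d, hd⟩ : ∃ d, min (i + w + w) L.length = i + d + 1 :=
        ⟨min (i + w + w) L.length - i - 1, by omega⟩
      rw [hd] at ht4 ⊢
      have e3 : v = (L.length - (i + d + 1)) + (d + 1) := by omega
      have e4 : i + d + 1 - i = d + 1 := by omega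
      rw [e4] at ht4
      rw [e3, mul_add (300 * D)]
      have e5 : 300 * D * (d + 1) = 200 * D * (d + 1) + 100 * D * d + 100 * D := by ring
      generalize 300 * D * (L.length - (i + d + 1)) = y at *
      omega
  · rintro v s1 t1 hv ⟨i, O, hv', he, g21, hO, hperm, hRd, hRO⟩ hlt ht1
    have g16 : s1.reg 16 = L.length := (he.reg 16 (by norm_num)).trans h16
    simp only [Expr.eval, g21, g16, Nat.cast_lt] at hlt
    obtain rfl : i = L.length := by omega
    simp only [Expr.cost] at ht1
    refine H _ _ O (by omega) he hO (by simpa using hperm) ?_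
    simpa using hRO [] (Or.inr rfl) .nil

/-- Sorts the array of `n` pointers at the address `b`. Register 15 receives the address of the
result. -/
def mergeSort (b n : Expr) : Program :=
  .set 15 b ;; .set 16 n ;; .set 17 (.lit 1) ;;
  .loop (.reg 17) (.reg 16)
    (.set 18 (.reg 50) ;; mergePass ;; .set 15 (.reg 18) ;; .set 17 (.add (.reg 17) (.reg 17)))

theorem wp_mergeSort {eb en : Expr} {s : State} {t : ℕ} {Q : ℕ → State → Prop} {b M : ℤ}
    {L : List (Cell D)} (hD : 1 ≤ D) (hs : Env D M s) (hb : eb.eval s = b)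
    (hn : ∀ s', Ext 15 s s' → en.eval s' = L.length)
    (hL : Arr s b L) (hLM : ∀ p ∈ L, Bdd M 4 p)
    (H : ∀ t' s' L',
      t' ≤ t + (eb.cost + en.cost + 400 * D * (L.length + 1) * (Nat.log 2 L.length + 2)) →
      Ext 15 s s' → Arr s' (s'.reg 15) L' → L'.Perm L → SortedCells M L' → Q t' s') :
    WP (mergeSort eb en) s t Q := by
  simp only [mergeSort, wp_seq, wp_set]
  rw [hb, hn _ (by simp)]
  refine wp_loop (fun v s1 => ∃ (w : ℕ) (L' : List (Cell D)), Ext 15 s s1 ∧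
    s1.reg 16 = L.length ∧ s1.reg 17 = w ∧ 1 ≤ w ∧ L.length ≤ w * 2 ^ v ∧
    Arr s1 (s1.reg 15) L' ∧ L'.Perm L ∧ Runs M w L') (300 * D * (L.length + 1))
    (Nat.log 2 L.length + 1)
    ⟨1, L, by simp, by simp, by simp [Expr.eval], le_rfl,
      by rw [one_mul]; exact (Nat.lt_pow_succ_log_self one_lt_two _).le, by simpa using hL,
      List.Perm.refl _, runs_one L⟩ ?_ ?_
  · rintro v s1 t1 ⟨w, L', he, g16, g17, hw, hv, hL', hperm, hR⟩ hlt
    simp only [Expr.eval, g16, g17, Nat.cast_lt] at hlt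
    rw [wp_seq, wp_set, wp_seq]
    refine wp_mergePass (L := L') (b := s1.reg 15) (w := w) hD (by simpa using hs.ext he (by norm_num))
      (by simp) (by simp [g16, hperm.length_eq]) (by simp [g17]) hw hR (by simpa using hL')
      (fun p hp => hLM p (hperm.mem_iff.1 hp)) ?_
    intro t2 s2 L2 ht2 he2 hO hperm2 hR2
    have f16 : s2.reg 16 = L.length := by simpa [g16] using he2.reg 16 (by norm_num)
    have f17 : s2.reg 17 = w := by simpa [g17] using he2.reg 17 (by norm_num)
    have f18 : s2.reg 18 = s1.reg 50 := by
      simpa [Expr.eval] using he2.reg 18 (by norm_num)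
    have he3 : Ext 15 s s2 := by
      refine he.trans (Ext.trans ?_ (he2.mono (k' := 15) (by norm_num)))
      simp
    obtain ⟨u, rfl⟩ : ∃ u, v = u + 1 := by
      refine ⟨v - 1, ?_⟩
      rcases v with _ | v
      · simp at hv
        omega
      · rfl
    rw [wp_seq, wp_set, wp_set]
    refine ⟨u, by omega, ⟨2 * w, L2, ?_, ?_, ?_, by omega, ?_, ?_, hperm2.trans hperm, hR2⟩, ?_⟩
    · simpa using he3
    · simp [f16]
    · simp [Expr.eval, f17]; ring
    · rw [pow_succ] at hv
      nlinarith
    · simp only [Expr.eval, State.setReg_reg, f18, f17]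
      simpa using hO.1
    · simp only [Expr.cost, hperm.length_eq] at *
      have : 300 * D * (L.length + 1) * (u + 1) =
        300 * D * (L.length + 1) * u + (300 * D * L.length + 300 * D) := by ring
      rw [this]
      omega
  · rintro v s1 t1 hv ⟨w, L', he, g16, g17, hw, -, hL', hperm, hR⟩ hlt ht1
    simp only [Expr.eval, g16, g17, Nat.cast_lt] at hlt
    refine H _ _ L' ?_ he hL' hperm ?_
    · simp only [Expr.cost] at ht1
      have : 400 * D * (L.length + 1) * (Nat.log 2 L.length + 2) =
        300 * D * (L.length + 1) * (Nat.log 2 L.length + 1) +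
        (100 * (D * L.length * Nat.log 2 L.length) + 100 * (D * Nat.log 2 L.length) +
          500 * (D * L.length) + 500 * D) := by ring
      rw [this]
      omega
    · have := hR.take
      rwa [List.take_of_length_le (by rw [hperm.length_eq]; omega)] at this

/-! ### Programs that produce tables -/

/-- The level of the cell at the address `a`. -/
def levExpr (a : Expr) : Expr := .mem (.add a (.sub (.reg 1) (.lit 1)))

theorem levExpr_eval {s : State} {a : Expr} {p : Cell D} (hD : 1 ≤ D) (h1 : s.reg 1 = D)
    (hp : At s (a.eval s) p) : (levExpr a).eval s = p.lev := by
  simp only [levExpr, Expr.eval, h1]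
  rw [← hp.1.2]
  congr 1
  push_cast [hD]
  ring

theorem levExpr_cost (a : Expr) : (levExpr a).cost = a.cost + 5 := by
  simp [levExpr, Expr.cost]

theorem wp_pushAnc_openTab {r : ℕ} {el : Expr} {s : State} {t : ℕ} {Q : ℕ → State → Prop}
    {a l b M : ℤ} {p : Cell D} {L : List (Cell D)} (hD : 1 ≤ D) (hs : Env D M s) (ha : s.reg r = a)
    (hl : ∀ v, el.eval (s.setReg 40 v) = l) (hp : At s a p) (hL : OpenTab s b L)
    (H : ∀ t' s', t' ≤ t + (1 + el.cost + 50 * D) → Ext 40 s s' →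
      OpenTab s' b (L ++ [p.up (min l M)]) → Q t' s') :
    WP (pushAnc (.reg r) el) s t Q := by
  refine wp_pushAnc hD hs.1 hs.2 (show (Expr.reg r).eval s = a from ha) (hl a) hp ?_
  intro t' s' ht he h50 hh
  exact H t' s' (by simpa [Expr.cost] using ht) he (hL.append hD he h50 hh)

/-- The cells of `L`, each with its predecessor; the first one with itself. -/
def prevPairs (L : List (Cell D)) : List (Cell D × Cell D) :=
  List.ofFn fun i : Fin L.length => (L[(i : ℕ) - 1], L[i])

@[simp] theorem length_prevPairs (L : List (Cell D)) : (prevPairs L).length = L.length := by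
  simp [prevPairs]

/-- The second of two consecutive cells, the lowest cell above both of them, and its children above
them. -/
noncomputable def closeBlock (M : ℤ) (pq : Cell D × Cell D) : List (Cell D) :=
  [pq.2, pq.2.up (min (split (M + 2) pq.1 pq.2 + 1) M), pq.1.up (min (split (M + 2) pq.1 pq.2) M),
    pq.2.up (min (split (M + 2) pq.1 pq.2) M)]

/-- The cells of a sorted list, the branching cells of the tree of their ancestors, and the children
of these. -/
noncomputable def closeList (M : ℤ) (L : List (Cell D)) : List (Cell D) :=
  (prevPairs L).flatMap (closeBlock M)

theorem length_closeList (M : ℤ) (L : List (Cell D)) :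
    (closeList M L).length = 4 * L.length := by
  simp [closeList, closeBlock, List.length_flatMap, mul_comm]

/-- Appends the table of `closeList` for the array of `n` pointers at the address `b`. -/
def closeProg (b n : Expr) : Program :=
  .set 16 b ;; .set 17 n ;; .set 18 (.mem (.reg 16)) ;;
  .forUpto 15 (.reg 17)
    (.set 19 (.mem (.add (.reg 16) (.reg 15))) ;;
    splitCmp (.reg 18) (.reg 19) ;;
    pushAnc (.reg 19) (levExpr (.reg 19)) ;;
    pushAnc (.reg 19) (.add (.reg 35) (.lit 1)) ;;
    pushAnc (.reg 18) (.reg 35) ;;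
    pushAnc (.reg 19) (.reg 35) ;;
    .set 18 (.reg 19))

theorem up_min_lev {M : ℤ} {p : Cell D} : p.up (min p.lev M) = p := up_of_le (by omega)

theorem wp_closeProg {eb en : Expr} {s : State} {t : ℕ} {Q : ℕ → State → Prop} {b M : ℤ}
    {L : List (Cell D)} (hD : 1 ≤ D) (hs : Env D M s) (hb : eb.eval s = b)
    (hn : en.eval (s.setReg 16 b) = L.length) (hL : Arr s b L) (hLM : ∀ p ∈ L, Bdd M 4 p)
    (H : ∀ t' s', t' ≤ t + (eb.cost + en.cost + 500 * D * (L.length + 1)) →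
      Ext 15 s s' → OpenTab s' (s.reg 50) (closeList M L) → Q t' s') :
    WP (closeProg eb en) s t Q := by
  simp only [closeProg, wp_seq, wp_set]
  rw [hb, hn]
  refine wp_forUpto L.length (fun i s1 => Ext 15 s s1 ∧ s1.reg 15 = i ∧ s1.reg 16 = b ∧
    s1.reg 17 = L.length ∧ (∀ h : i - 1 < L.length, s1.reg 18 = s1.mem (b + (i - 1 : ℕ))) ∧
    OpenTab s1 (s.reg 50) (((prevPairs L).take i).flatMap (closeBlock M))) (500 * D)
    ?_ ?_ ?_ ?_
  · simp [Expr.eval, openTab_nil]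
  · rintro i s1 ⟨h1, h15, h16, h17, h18, hO⟩
    exact ⟨h15, h17⟩
  · rintro i s1 t1 hi ⟨h1, h15, h16, h17, h18, hO⟩
    have hs1 := hs.ext h1 (by norm_num)
    have hL1 := hL.ext h1
    have hpre := h18 (by omega)
    have hAp := hL1.2 (i - 1) (by omega)
    have hAq := hL1.2 i (by omega)
    simp only [wp_seq, wp_set, Expr.eval, h15, h16]
    set p := L[i - 1]
    set q := L[i]
    refine wp_splitCmp (p := p) (q := q) (a := s1.mem (b + (i - 1 : ℕ))) (b := s1.mem (b + i)) hD
      (by simp [hs1.1]) (by simp [hs1.2]) (by simp [Expr.eval, hpre]) (by simp [Expr.eval])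
      (by simpa using hAp) (by simpa using hAq) (hLM _ (List.getElem_mem _))
      (hLM _ (List.getElem_mem _)) ?_
    intro t2 s2 ht2 he2 h50 h34 h35 hsplit h36 h28
    simp only [Expr.cost] at ht2
    have g1 : Ext 15 s1 s2 := by
      refine Ext.trans ?_ (he2.mono (k' := 15) (by norm_num))
      simp
    have g15 : s2.reg 15 = i := by simpa [h15] using he2.reg 15 (by norm_num)
    have g16 : s2.reg 16 = b := by simpa [h16] using he2.reg 16 (by norm_num)
    have g17 : s2.reg 17 = L.length := by simpa [h17] using he2.reg 17 (by norm_num)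
    have g18 : s2.reg 18 = s1.mem (b + (i - 1 : ℕ)) := by
      simpa [hpre] using he2.reg 18 (by norm_num)
    have g19 : s2.reg 19 = s1.mem (b + i) := by simpa using he2.reg 19 (by norm_num)
    have hO2 := hO.ext g1 (by simpa using h50)
    have hAp2 := hAp.ext g1
    have hAq2 := hAq.ext g1
    have hs2 := hs1.ext g1 (by norm_num)
    refine wp_pushAnc_openTab (l := q.lev) hD hs2 g19 (fun v => ?_) hAq2 hO2 ?_
    · exact levExpr_eval hD (by simp [hs2.1]) (by simpa [Expr.eval, g19] using hAq2)
    intro t3 s3 ht3 he3 hO3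
    simp only [levExpr_cost, Expr.cost] at ht3
    refine wp_pushAnc_openTab (l := split (M + 2) p q + 1) hD (hs2.ext he3 (by norm_num))
      ((he3.reg 19 (by norm_num)).trans g19) (fun v => by
        simp [Expr.eval, he3.reg 35 (by norm_num), h35]) (hAq2.ext he3) hO3 ?_
    intro t4 s4 ht4 he4 hO4
    simp only [Expr.cost] at ht4
    have he34 := he3.trans he4
    refine wp_pushAnc_openTab (l := split (M + 2) p q) hD (hs2.ext he34 (by norm_num))
      ((he34.reg 18 (by norm_num)).trans g18) (fun v => by
        simp [Expr.eval, he34.reg 35 (by norm_num), h35]) (hAp2.ext he34) hO4 ?_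
    intro t5 s5 ht5 he5 hO5
    simp only [Expr.cost] at ht5
    have he35 := he34.trans he5
    refine wp_pushAnc_openTab (l := split (M + 2) p q) hD (hs2.ext he35 (by norm_num))
      ((he35.reg 19 (by norm_num)).trans g19) (fun v => by
        simp [Expr.eval, he35.reg 35 (by norm_num), h35]) (hAq2.ext he35) hO5 ?_
    intro t6 s6 ht6 he6 hO6
    simp only [Expr.cost] at ht6
    have he36 := he35.trans he6
    have f15 := (he36.reg 15 (by norm_num)).trans g15
    have f16 := (he36.reg 16 (by norm_num)).trans g16
    have f17 := (he36.reg 17 (by norm_num)).trans g17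
    have f19 := (he36.reg 19 (by norm_num)).trans g19
    have hall : Ext 15 s1 s6 := g1.trans (he36.mono (by norm_num))
    refine ⟨by simp [f15], ⟨?_, by simp, by simp [f16], by simp [f17], fun _ => ?_, ?_⟩, ?_⟩
    · simpa using h1.trans hall
    · have := hL1.1
      simp [f19, hall.mem (b + i) (by omega)]
    · have e : (prevPairs L).take (i + 1) = (prevPairs L).take i ++ [(p, q)] := by
        rw [List.take_succ_eq_append_getElem (by simpa using hi)]
        simp [prevPairs, p, q]
      rw [e, List.flatMap_append]
      rw [openTab_setReg (by norm_num), openTab_setReg (by norm_num)]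
      rw [up_min_lev] at hO6
      simpa [closeBlock] using hO6
    · simp only [Expr.cost]
      omega
  · rintro s1 t1 ⟨h1, h15, h16, h17, h18, hO⟩ ht1
    simp only [Expr.cost] at ht1
    refine H _ _ (by rw [mul_add (500 * D)]; omega) h1 ?_
    rw [List.take_of_length_le (by simp)] at hO
    exact hO

/-! ### Neighborhoods -/

/-- The cell with the index `j` changed by `d`. -/
def Cell.shift (j : Fin (D - 1)) (d : ℤ) (p : Cell D) : Cell D :=
  ⟨Function.update p.idx j (p.idx j + d), p.lev⟩

@[simp] theorem Cell.shift_zero (j : Fin (D - 1)) (p : Cell D) : p.shift j 0 = p := by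
  simp [Cell.shift]

/-- Each cell together with its two translates along a coordinate. -/
def expandStep (d : ℤ) (j : Fin (D - 1)) (L : List (Cell D)) : List (Cell D) :=
  L.flatMap fun c => [c.shift j (-d), c.shift j 0, c.shift j d]

/-- Each cell together with its translates by `-d`, `0` and `d` along the first `k` coordinates. -/
def expandTo (d : ℤ) (L : List (Cell D)) : ℕ → List (Cell D)
  | 0 => L
  | k + 1 => if h : k < D - 1 then expandStep d ⟨k, h⟩ (expandTo d L k) else expandTo d L k

/-- Each cell together with its translates by `-d`, `0` and `d` along the coordinates. -/
def expand (d : ℤ) (L : List (Cell D)) : List (Cell D) := expandTo d L (D - 1)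

theorem length_expandTo (d : ℤ) (L : List (Cell D)) {k : ℕ} (hk : k ≤ D - 1) :
    (expandTo d L k).length = 3 ^ k * L.length := by
  induction k with
  | zero => simp [expandTo]
  | succ k ih =>
    rw [expandTo, dif_pos (by omega), expandStep]
    simp only [List.length_flatMap, List.length_cons, List.length_nil, List.map_const',
      List.sum_replicate, smul_eq_mul]
    rw [ih (by omega), pow_succ]
    ring

theorem length_expand (d : ℤ) (L : List (Cell D)) :
    (expand d L).length = 3 ^ (D - 1) * L.length := length_expandTo d L le_rfl

/-- Appends the cell at the address in register 19, with the index whose number is in register 15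
changed by `d`. -/
def pushShift (d : ℤ) : Program :=
  pushAnc (.reg 19) (levExpr (.reg 19)) ;;
  .store (.add (.sub (.reg 50) (.reg 1)) (.reg 15))
    (.add (.mem (.add (.sub (.reg 50) (.reg 1)) (.reg 15))) (.lit d))

theorem wp_pushShift {d : ℤ} {s : State} {t : ℕ} {Q : ℕ → State → Prop} {b M : ℤ}
    {L : List (Cell D)} {p : Cell D} {j : Fin (D - 1)} (hD : 1 ≤ D) (hs : Env D M s)
    (h15 : s.reg 15 = (j : ℕ)) (hp : At s (s.reg 19) p) (hL : OpenTab s b L)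
    (H : ∀ t' s', t' ≤ t + 80 * D → Ext 40 s s' → OpenTab s' b (L ++ [p.shift j d]) → Q t' s') :
    WP (pushShift d) s t Q := by
  have hj := j.2
  simp only [pushShift, wp_seq]
  refine wp_pushAnc (l := p.lev) hD hs.1 hs.2 rfl
    (levExpr_eval hD (by simp [hs.1]) (by simpa [Expr.eval] using hp)) hp ?_
  intro t1 s1 ht1 he h50 hh
  rw [up_min_lev] at hh
  simp only [levExpr_cost, Expr.cost] at ht1
  have e : s1.reg 50 - s1.reg 1 + s1.reg 15 = s.reg 50 + (j : ℕ) := by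
    rw [h50, he.reg 1 (by norm_num), he.reg 15 (by norm_num), hs.1, h15]
    ring
  simp only [wp_store, Expr.eval, Expr.cost, e]
  refine H _ _ (by omega) ?_ (hL.append hD (k := 40) ?_ (by simp [h50]) ?_)
  · refine ⟨fun r hr => by simpa using he.reg r hr, fun x hx => ?_, by simpa using he.top⟩
    rw [State.setMem_mem, if_neg (by omega), he.mem x hx]
  · refine ⟨fun r hr => by simpa using he.reg r hr, fun x hx => ?_, by simpa using he.top⟩
    rw [State.setMem_mem, if_neg (by omega), he.mem x hx]
  · refine ⟨fun l => ?_, ?_⟩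
    · rw [State.setMem_mem]
      by_cases hl : l = j
      · rw [hl, if_pos rfl, hh.1 j]
        simp [Cell.shift]
      · have hl' : (l : ℕ) ≠ j := fun h => hl (Fin.ext h)
        rw [if_neg (by omega), hh.1 l]
        simp [Cell.shift, hl]
    · rw [State.setMem_mem, if_neg (by omega), hh.2]
      rfl

/-- Appends the table of `expand d` for the table between the addresses `b` and `e`. Registers 16
and 17 receive the addresses between which the result is stored. -/
def expandProg (d : ℤ) (b e : Expr) : Program :=
  .set 16 b ;; .set 17 e ;;
  .forUpto 15 (.sub (.reg 1) (.lit 1))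
    (.set 18 (.reg 50) ;;
    .forStep 19 (.reg 16) (.reg 1) (.reg 17) (pushShift (-d) ;; pushShift 0 ;; pushShift d) ;;
    .set 16 (.reg 18) ;; .set 17 (.reg 50))

theorem wp_expandProg {d : ℤ} {eb ee : Expr} {s : State} {t : ℕ} {Q : ℕ → State → Prop} {b M : ℤ}
    {L : List (Cell D)} (hD : 1 ≤ D) (hs : Env D M s) (hb : eb.eval s = b)
    (he : ee.eval (s.setReg 16 b) = b + L.length * D) (hL : Tab s b L)
    (H : ∀ t' s', t' ≤ t + (eb.cost + ee.cost + 400 * D * D * (3 ^ (D - 1) * L.length + 1)) →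
      Ext 15 s s' → Tab s' (s'.reg 16) (expand d L) →
      s'.reg 17 = s'.reg 16 + (expand d L).length * D → Q t' s') :
    WP (expandProg d eb ee) s t Q := by
  obtain ⟨N, hN⟩ : ∃ N, D = N + 1 := ⟨D - 1, by omega⟩
  have hN' : D - 1 = N := by omega
  have h1' : s.reg 1 - 1 = N := by rw [hs.1, hN]; push_cast; ring
  simp only [expandProg, wp_seq, wp_set]
  rw [hb, he]
  refine wp_forUpto N (fun i s1 => Ext 15 s s1 ∧ s1.reg 15 = i ∧
    Tab s1 (s1.reg 16) (expandTo d L i) ∧ s1.reg 17 = s1.reg 16 + (expandTo d L i).length * D)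
    (400 * D * (3 ^ (D - 1) * L.length + 1)) ?_ ?_ ?_ ?_
  · simp [expandTo, hL]
  · rintro i s1 ⟨h1, h15, hT, h17⟩
    refine ⟨h15, ?_⟩
    simp [Expr.eval, h1.reg 1 (by norm_num), h1']
  · rintro i s1 t1 hi ⟨h1, h15, hT, h17⟩
    have hs1 := hs.ext h1 (by norm_num)
    rw [wp_seq, wp_set, wp_seq]
    set T := expandTo d L i with hTdef
    refine wp_forStep T.length (s1.reg 16) D (by omega) (fun k s2 => Ext 15 s1 s2 ∧
      s2.reg 15 = i ∧ s2.reg 16 = s1.reg 16 ∧ s2.reg 17 = s1.reg 17 ∧ s2.reg 18 = s1.reg 50 ∧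
      s2.reg 19 = s1.reg 16 + k * D ∧
      OpenTab s2 (s1.reg 50) (expandStep d ⟨i, by omega⟩ (T.take k))) (300 * D) ?_ ?_ ?_ ?_
    · simp [Expr.eval, h15, openTab_nil, expandStep]
    · rintro k s2 ⟨g1, g15, g16, g17, g18, g19, gO⟩
      exact ⟨g19, (hs1.ext g1 (by norm_num)).1, g17.trans h17⟩
    · rintro k s2 t2 hk ⟨g1, g15, g16, g17, g18, g19, gO⟩
      have hs2 := hs1.ext g1 (by norm_num)
      have hA : At s2 (s2.reg 19) T[k] := by rw [g19]; exact (hT k hk).ext g1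
      simp only [wp_seq]
      refine wp_pushShift (j := ⟨i, by omega⟩) hD hs2 g15 hA gO ?_
      intro t3 s3 ht3 he3 hO3
      refine wp_pushShift (j := ⟨i, by omega⟩) hD (hs2.ext he3 (by norm_num))
        ((he3.reg 15 (by norm_num)).trans g15)
        (by rw [he3.reg 19 (by norm_num)]; exact hA.ext he3) hO3 ?_
      intro t4 s4 ht4 he4 hO4
      have he34 := he3.trans he4
      refine wp_pushShift (j := ⟨i, by omega⟩) hD (hs2.ext he34 (by norm_num))
        ((he34.reg 15 (by norm_num)).trans g15)
        (by rw [he34.reg 19 (by norm_num)]; exact hA.ext he34) hO4 ?_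
      intro t5 s5 ht5 he5 hO5
      have he35 := he34.trans he5
      have f15 := (he35.reg 15 (by norm_num)).trans g15
      have f16 := (he35.reg 16 (by norm_num)).trans g16
      have f17 := (he35.reg 17 (by norm_num)).trans g17
      have f18 := (he35.reg 18 (by norm_num)).trans g18
      have f19 := (he35.reg 19 (by norm_num)).trans g19
      refine ⟨f19, ?_, ⟨?_, by simp [f15], by simp [f16], by simp [f17], by simp [f18], by simp,
        ?_⟩, ?_⟩
      · exact (hs2.ext he35 (by norm_num)).1
      · simpa using g1.trans (he35.mono (by norm_num))
      · rw [openTab_setReg (by norm_num), List.take_succ_eq_append_getElem hk, expandStep,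
          List.flatMap_append]
        simpa [expandStep] using hO5
      · simp only [Expr.cost]
        omega
    · rintro s2 t2 ⟨g1, g15, g16, g17, g18, g19, gO⟩ ht2
      have hstep : expandStep d ⟨i, by omega⟩ T = expandTo d L (i + 1) := by
        rw [expandTo, dif_pos (by omega)]
      rw [List.take_length, hstep] at gO
      rw [wp_seq, wp_set, wp_set]
      refine ⟨by simp [g15], ⟨?_, by simp, ?_, ?_⟩, ?_⟩
      · simpa using h1.trans g1
      · simpa [Expr.eval, g18] using gO.1
      · simpa [Expr.eval, g18] using gO.2
      · simp only [Expr.cost] at ht2 ⊢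
        have hlen : T.length ≤ 3 ^ (D - 1) * L.length := by
          rw [hTdef, length_expandTo d L (by omega)]
          exact Nat.mul_le_mul_right _ (Nat.pow_le_pow_right (by norm_num) (by omega))
        have := Nat.mul_le_mul_left (300 * D) hlen
        have e : 400 * D * (3 ^ (D - 1) * L.length + 1) = 300 * D * (3 ^ (D - 1) * L.length) +
          100 * (D * (3 ^ (D - 1) * L.length)) + 400 * D := by ring
        rw [e]
        omega
  · rintro s1 t1 ⟨h1, h15, hT, h17⟩ ht1
    simp only [Expr.cost] at ht1
    refine H _ _ ?_ h1 (by rw [expand, hN']; exact hT) (by rw [expand, hN']; exact h17)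
    have e : 400 * D * D * (3 ^ (D - 1) * L.length + 1) =
      400 * D * (3 ^ (D - 1) * L.length + 1) * N + (400 * (D * (3 ^ (D - 1) * L.length)) +
        400 * D) := by
      have : 400 * D * D * (3 ^ (D - 1) * L.length + 1) =
        400 * D * (3 ^ (D - 1) * L.length + 1) * D := by ring
      rw [this]
      generalize hX : 3 ^ (D - 1) * L.length = X
      rw [hN]
      ring
    rw [e]
    omega

/-! ### Removing duplicates -/

/-- Appends the table of the different cells of the sorted array of `n` pointers at the address
`b`. -/
def dedupProg (b n : Expr) : Program :=
  .set 16 b ;; .set 17 n ;; .set 18 (.mem (.reg 16)) ;;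
  .forUpto 15 (.reg 17)
    (.set 19 (.mem (.add (.reg 16) (.reg 15))) ;;
    splitCmp (.reg 18) (.reg 19) ;;
    .setIf 20 (.reg 15) (.lit 1) (.lit 1) (.reg 36) ;;
    .ite (.lit 0) (.reg 20) (pushAnc (.reg 19) (levExpr (.reg 19))) .skip ;;
    .set 18 (.reg 19))

theorem wp_dedupProg {eb en : Expr} {s : State} {t : ℕ} {Q : ℕ → State → Prop} {b M : ℤ}
    {L : List (Cell D)} (hD : 1 ≤ D) (hs : Env D M s) (hb : eb.eval s = b)
    (hn : en.eval (s.setReg 16 b) = L.length) (hL : Arr s b L) (hLs : SortedCells M L)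
    (hLM : ∀ p ∈ L, Bdd M 4 p)
    (H : ∀ t' s' O, t' ≤ t + (eb.cost + en.cost + 300 * D * (L.length + 1)) →
      Ext 15 s s' → OpenTab s' (s.reg 50) O →
      O.Pairwise (fun p q => key (M + 2) p < key (M + 2) q) → (∀ x, x ∈ O ↔ x ∈ L) → Q t' s') :
    WP (dedupProg eb en) s t Q := by
  simp only [dedupProg, wp_seq, wp_set]
  rw [hb, hn]
  refine wp_forUpto L.length (fun i s1 => Ext 15 s s1 ∧ s1.reg 15 = i ∧ s1.reg 16 = b ∧
    s1.reg 17 = L.length ∧ (∀ h : i - 1 < L.length, s1.reg 18 = s1.mem (b + (i - 1 : ℕ))) ∧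
    ∃ O, OpenTab s1 (s.reg 50) O ∧ O.Pairwise (fun p q => key (M + 2) p < key (M + 2) q) ∧
      ∀ x, x ∈ O ↔ x ∈ L.take i) (300 * D)
    ?_ ?_ ?_ ?_
  · simp only [State.setReg_reg, State.setReg_mem]
    simp [Expr.eval]
    exact ⟨[], by simp [openTab_nil]⟩
  · rintro i s1 ⟨h1, h15, h16, h17, h18, hO⟩
    exact ⟨h15, h17⟩
  · rintro i s1 t1 hi ⟨h1, h15, h16, h17, h18, O, hO, hOs, hOm⟩
    have hs1 := hs.ext h1 (by norm_num)
    have hL1 := hL.ext h1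
    have hpre := h18 (by omega)
    have hAp := hL1.2 (i - 1) (by omega)
    have hAq := hL1.2 i (by omega)
    simp only [wp_seq, wp_set, Expr.eval, h15, h16]
    set p := L[i - 1] with hp
    set q := L[i] with hq
    refine wp_splitCmp (p := p) (q := q) (a := s1.mem (b + (i - 1 : ℕ))) (b := s1.mem (b + i)) hD
      (by simp [hs1.1]) (by simp [hs1.2]) (by simp [Expr.eval, hpre]) (by simp [Expr.eval])
      (by simpa using hAp) (by simpa using hAq) (hLM _ (List.getElem_mem _))
      (hLM _ (List.getElem_mem _)) ?_
    intro t2 s2 ht2 he2 h50 h34 h35 hsplit h36 h28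
    simp only [Expr.cost] at ht2
    have g1 : Ext 15 s1 s2 := by
      refine Ext.trans ?_ (he2.mono (k' := 15) (by norm_num))
      simp
    have g15 : s2.reg 15 = i := by simpa [h15] using he2.reg 15 (by norm_num)
    have g16 : s2.reg 16 = b := by simpa [h16] using he2.reg 16 (by norm_num)
    have g17 : s2.reg 17 = L.length := by simpa [h17] using he2.reg 17 (by norm_num)
    have g19 : s2.reg 19 = s1.mem (b + i) := by simpa using he2.reg 19 (by norm_num)
    have hO2 := hO.ext g1 (by simpa using h50)
    have hAq2 := hAq.ext g1
    have hs2 := hs1.ext g1 (by norm_num)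
    refine wp_setIf fun t3 ht3 => ?_
    simp only [Expr.eval, Expr.cost, g15, h36] at ht3 ⊢
    -- the cells found so far do not exceed the previous cell of the input
    have hle : ∀ x ∈ O, 0 < i ∧ key (M + 2) x ≤ key (M + 2) p := by
      intro x hx
      obtain ⟨k, hk, rfl⟩ := List.mem_iff_getElem.1 ((hOm x).1 hx)
      simp only [List.length_take] at hk
      rw [List.getElem_take]
      exact ⟨by omega, hLs.key_le (by omega) (by omega)⟩
    have htake : L.take (i + 1) = L.take i ++ [q] := List.take_succ_eq_append_getElem hi
    rw [wp_ite]
    simp only [Expr.eval, Expr.cost, State.setReg_reg, if_true]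
    constructor
    · intro hnew
      have hnew' : i = 0 ∨ key (M + 2) p < key (M + 2) q := by
        by_contra! hc
        rw [if_neg (by omega : ¬ (i : ℤ) < 1), flag, if_neg hc.2] at hnew
        exact absurd hnew (by norm_num)
      refine wp_pushAnc_openTab (l := q.lev) (a := s1.mem (b + i)) hD (by simpa using hs2)
        (by simp [g19])
        (fun v => ?_) (by simpa using hAq2) (by simpa using hO2) ?_
      · exact levExpr_eval hD (by simp [hs2.1]) (by simpa [Expr.eval, g19] using hAq2)
      intro t4 s4 ht4 he4 hO4
      simp only [levExpr_cost, Expr.cost] at ht4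
      rw [up_min_lev] at hO4
      have f15 : s4.reg 15 = i := by simpa [g15] using he4.reg 15 (by norm_num)
      have f16 : s4.reg 16 = b := by simpa [g16] using he4.reg 16 (by norm_num)
      have f17 : s4.reg 17 = L.length := by simpa [g17] using he4.reg 17 (by norm_num)
      have f19 : s4.reg 19 = s1.mem (b + i) := by simpa [g19] using he4.reg 19 (by norm_num)
      have hall : Ext 15 s1 s4 := by
        refine g1.trans (Ext.trans ?_ (he4.mono (k' := 15) (by norm_num)))
        simp
      refine ⟨by simp [f15], ⟨?_, by simp, by simp [f16], by simp [f17], fun _ => ?_,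
        O ++ [q], ?_, ?_, ?_⟩, ?_⟩
      · simpa using h1.trans hall
      · have := hL1.1
        simp [f19, hall.mem (b + i) (by omega)]
      · simpa using hO4
      · rw [List.pairwise_append]
        refine ⟨hOs, List.pairwise_singleton _ _, fun x hx y hy => ?_⟩
        rw [List.mem_singleton] at hy
        rw [hy]
        have := hle x hx
        exact this.2.trans_lt (hnew'.resolve_left (by omega))
      · intro x
        rw [htake]
        simp [hOm]
      · omega
    · intro hold
      rw [wp_skip]
      have hold' : 0 < i ∧ key (M + 2) q ≤ key (M + 2) p := by
        by_contra hc
        apply hold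
        by_cases hi0 : i = 0
        · rw [if_pos (by omega)]
          norm_num
        · rw [if_neg (by omega), flag, if_pos (by
            by_contra hlt
            exact hc ⟨by omega, not_lt.1 hlt⟩)]
          norm_num
      have hpq : p = q := by
        refine key_injective (R := M + 2) ?_ ?_ (le_antisymm (hLs.key_le (by omega) hi) hold'.2)
        · have := (hLM p (List.getElem_mem _)).1
          omega
        · have := (hLM q (List.getElem_mem _)).1
          omega
      refine ⟨by simp [g15], ⟨?_, by simp, by simp [g16], by simp [g17], fun _ => ?_,
        O, ?_, hOs, ?_⟩, ?_⟩
      · simpa using h1.trans g1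
      · have := hL1.1
        simp [g19, g1.mem (b + i) (by omega)]
      · simpa using hO2
      · intro x
        rw [htake, List.mem_append, hOm, List.mem_singleton, ← hpq, or_iff_left_of_imp]
        rintro rfl
        rw [List.mem_take_iff_getElem]
        exact ⟨i - 1, by omega, rfl⟩
      · omega
  · rintro s1 t1 ⟨h1, h15, h16, h17, h18, O, hO, hOs, hOm⟩ ht1
    simp only [Expr.cost] at ht1
    refine H _ _ O (by rw [mul_add (300 * D)]; omega) h1 hO hOs fun x => ?_
    rw [hOm, List.take_length]

/-! ### Programs that work through pairs of cells -/

/-- The first components of the pairs in `Z` are stored from the address `x` on, the second ones from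
the address `y` on, at distances `d`. -/
def PairTab (s : State) (x y d : ℤ) (Z : List (Cell D × Cell D)) : Prop :=
  ∀ i (h : i < Z.length), At s (x + i * d) Z[i].1 ∧ At s (y + i * d) Z[i].2

theorem IsLowerBound.unique {M : ℤ} {L : List (Cell D)} {x : Cell D} {r r' : ℕ}
    (h : IsLowerBound M L x r) (h' : IsLowerBound M L x r') : r = r' := by
  have aux : ∀ {r r' : ℕ}, IsLowerBound M L x r → IsLowerBound M L x r' → ¬ r < r' := by
    intro r r' h h' hlt
    have hr : r < L.length := hlt.trans_le h'.le
    exact absurd (h.ge r hr le_rfl) (not_le.2 (h'.lt r hr hlt))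
  have := aux h h'
  have := aux h' h
  omega

/-- The ancestors of `p` at the two levels at which the path from `p` to `q` can be horizontal. -/
def candCells (M : ℤ) (p q : Cell D) : List (Cell D) :=
  [p.up (min (max p.lev q.lev + diffLog p q) M), p.up (min (max p.lev q.lev + diffLog p q + 1) M)]

/-- Searches the two cells at the addresses in the registers 10 and 11 in the array of pointers
described by the registers 8 and 9. If there are cells `p` and `q` that do not precede them, appends
the first of the two cells and `candCells` for the first such `p` and `q`. -/
def candBody : Program :=
  bsearch (.reg 8) (.reg 9) (.reg 10) ;; .set 13 (.reg 15) ;;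
  bsearch (.reg 8) (.reg 9) (.reg 11) ;; .set 14 (.reg 15) ;;
  .ite (.reg 13) (.reg 9)
    (.ite (.reg 14) (.reg 9)
      (.set 13 (.mem (.add (.reg 8) (.reg 13))) ;; .set 14 (.mem (.add (.reg 8) (.reg 14))) ;;
      splitCmp (.reg 13) (.reg 14) ;;
      pushAnc (.reg 10) (levExpr (.reg 10)) ;;
      pushAnc (.reg 13) (.add (.reg 34) (.reg 28)) ;;
      pushAnc (.reg 13) (.add (.add (.reg 34) (.reg 28)) (.lit 1)))
      .skip)
    .skip

theorem wp_candBody {s : State} {t : ℕ} {Q : ℕ → State → Prop} {b M wb : ℤ}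
    {A W : List (Cell D)} {u v : Cell D} (hD : 1 ≤ D) (hs : Env D M s) (h8 : s.reg 8 = b)
    (h9 : s.reg 9 = A.length) (hA : Arr s b A) (hAs : SortedCells M A) (hAM : ∀ p ∈ A, Bdd M 4 p)
    (hu : At s (s.reg 10) u) (hv : At s (s.reg 11) v) (huM : Bdd M 4 u) (hvM : Bdd M 4 v)
    (hW : OpenTab s wb W)
    (H : ∀ t' s' W', t' ≤ t + 1000 * D * (Nat.log 2 A.length + 2) → Ext 13 s s' →
      OpenTab s' wb (W ++ W') → W'.length ≤ 3 →
      (∀ r r' (h : r < A.length) (h' : r' < A.length), IsLowerBound M A u r →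
        IsLowerBound M A v r' → W' = u :: candCells M A[r] A[r']) →
      (W' = [] ∨ ∃ p ∈ A, ∃ q ∈ A, W' = u :: candCells M p q) → Q t' s') :
    WP candBody s t Q := by
  have hd : 1000 * D * (Nat.log 2 A.length + 2) =
    2 * (200 * D * (Nat.log 2 A.length + 2)) + 600 * (D * Nat.log 2 A.length) + 1200 * D := by ring
  rw [candBody, wp_seq]
  refine wp_bsearch (b := b) (a := s.reg 10) hD hs
    (fun s' he => (he.reg 8 (by norm_num)).trans h8)
    (fun s' he => (he.reg 9 (by norm_num)).trans h9) (fun s' he => he.reg 10 (by norm_num))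
    hA hu hAs hAM huM ?_
  intro t1 s1 r ht1 he1 g50 g15 hr
  have hs1 := hs.ext he1 (by norm_num)
  rw [wp_seq, wp_set, wp_seq]
  have k1 : Ext 13 s (s1.setReg 13 (s1.reg 15)) := by simpa using he1.mono (by norm_num)
  refine wp_bsearch (b := b) (a := s.reg 11) hD (by simpa using hs1)
    (fun s' he => by simpa [Expr.eval, he1.reg 8 (by norm_num), h8] using he.reg 8 (by norm_num))
    (fun s' he => by simpa [Expr.eval, he1.reg 9 (by norm_num), h9] using he.reg 9 (by norm_num))
    (fun s' he => by simpa [Expr.eval, he1.reg 11 (by norm_num)] using he.reg 11 (by norm_num))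
    (hA.ext k1) (hv.ext k1) hAs hAM hvM ?_
  intro t2 s2 r' ht2 he2 f50 f15 hr'
  have k2 : Ext 13 s s2 := k1.trans (he2.mono (by norm_num))
  have f13 : s2.reg 13 = r := by simpa [Expr.eval, g15] using he2.reg 13 (by norm_num)
  have f8 : s2.reg 8 = b := (k2.reg 8 (by norm_num)).trans h8
  have f9 : s2.reg 9 = A.length := (k2.reg 9 (by norm_num)).trans h9
  have f10 : s2.reg 10 = s.reg 10 := k2.reg 10 (by norm_num)
  have hW2 : OpenTab s2 wb W := hW.ext k2 (by rw [f50]; simp [g50])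
  have hs2 := hs.ext k2 (by norm_num)
  simp only [Expr.cost] at ht1 ht2
  rw [wp_seq, wp_set, wp_ite]
  simp only [Expr.eval, Expr.cost, State.setReg_reg, f13, f15, f9, Nat.cast_lt, Nat.reduceEqDiff,
    if_false]
  constructor
  · intro hrA
    rw [wp_ite]
    simp only [Expr.eval, Expr.cost, State.setReg_reg, f9, Nat.cast_lt, Nat.reduceEqDiff,
      if_false, if_true]
    constructor
    · intro hrA'
      simp only [wp_seq, wp_set, Expr.eval, State.setReg_reg, State.setReg_mem, Nat.reduceEqDiff,
        if_false, if_true, f8, f13]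
      have hAr := (hA.ext k2).2 r hrA
      have hAr' := (hA.ext k2).2 r' hrA'
      refine wp_splitCmp (p := A[r]) (q := A[r']) (a := s2.mem (b + r)) (b := s2.mem (b + r')) hD
        (by simp [hs2.1]) (by simp [hs2.2]) (by simp [Expr.eval]) (by simp [Expr.eval])
        (by simpa using hAr) (by simpa using hAr') (hAM _ (List.getElem_mem _))
        (hAM _ (List.getElem_mem _)) ?_
      intro t3 s3 ht3 he3 g50' g34 g35 hsplit g36 g28
      have k3' : Ext 13 s2 s3 := by
        refine Ext.trans ?_ (he3.mono (k' := 13) (by norm_num))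
        simp
      have k3 : Ext 13 s s3 := k2.trans k3'
      have hs3 := hs.ext k3 (by norm_num)
      have f10' : s3.reg 10 = s.reg 10 := k3.reg 10 (by norm_num)
      have f13' : s3.reg 13 = s2.mem (b + r) := by simpa using he3.reg 13 (by norm_num)
      have hW3 : OpenTab s3 wb W := hW2.ext k3' (by simpa using g50')
      refine wp_pushAnc_openTab (l := u.lev) hD hs3 f10' (fun v => ?_) (hu.ext k3) hW3 ?_
      · exact levExpr_eval hD (by simp [hs3.1]) (by simpa [Expr.eval, f10'] using hu.ext k3)
      intro t4 s4 ht4 he4 hW4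
      rw [up_min_lev] at hW4
      refine wp_pushAnc_openTab (l := max A[r].lev A[r'].lev + diffLog A[r] A[r']) hD
        (hs3.ext he4 (by norm_num)) ((he4.reg 13 (by norm_num)).trans f13') (fun v => by
        simp [Expr.eval, he4.reg 34 (by norm_num), he4.reg 28 (by norm_num), g34, g28])
        ((hAr.ext k3').ext he4) hW4 ?_
      intro t5 s5 ht5 he5 hW5
      have he45 := he4.trans he5
      refine wp_pushAnc_openTab (l := max A[r].lev A[r'].lev + diffLog A[r] A[r'] + 1) hD
        (hs3.ext he45 (by norm_num)) ((he45.reg 13 (by norm_num)).trans f13') (fun v => by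
        simp [Expr.eval, he45.reg 34 (by norm_num), he45.reg 28 (by norm_num), g34, g28])
        ((hAr.ext k3').ext he45) hW5 ?_
      intro t6 s6 ht6 he6 hW6
      have he46 := he45.trans he6
      simp only [Expr.cost, levExpr_cost] at ht3 ht4 ht5 ht6
      refine H _ _ (u :: candCells M A[r] A[r']) ?_ (k3.trans (he46.mono (by norm_num)))
        (by simpa [candCells] using hW6) (by simp [candCells]) ?_
        (Or.inr ⟨_, List.getElem_mem _, _, List.getElem_mem _, rfl⟩)
      · rw [hd]
        omega
      · intro x x' hx hx' hlx hlx'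
        obtain rfl := hr.unique hlx
        obtain rfl := hr'.unique hlx'
        rfl
    · intro hrA'
      rw [wp_skip]
      refine H _ _ [] (by rw [hd]; omega) (by simpa using k2) (by simpa using hW2) (by simp) ?_
        (Or.inl rfl)
      intro x x' hx hx' hlx hlx'
      exact absurd (hr'.unique hlx' ▸ hx') hrA'
  · intro hrA
    rw [wp_skip]
    refine H _ _ [] (by rw [hd]; omega) (by simpa using k2) (by simpa using hW2) (by simp) ?_
      (Or.inl rfl)
    intro x x' hx hx' hlx hlx'
    exact absurd (hr.unique hlx ▸ hx) hrA

/-- Runs `candBody` for all pairs of the table between the addresses `x` and `e` and the table at the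
address `y`. -/
def candProg (b n x y e : Expr) : Program :=
  .set 8 b ;; .set 9 n ;; .set 11 y ;; .set 12 e ;;
  .forStep 10 x (.reg 1) (.reg 12) (candBody ;; .set 11 (.add (.reg 11) (.reg 1)))

theorem wp_candProg {eb en ex ey ee : Expr} {s : State} {t : ℕ} {Q : ℕ → State → Prop}
    {b x y M : ℤ} {A : List (Cell D)} {Z : List (Cell D × Cell D)} (hD : 1 ≤ D) (hs : Env D M s)
    (hb : eb.eval s = b) (hn : ∀ s', Ext 8 s s' → en.eval s' = A.length)
    (hx : ∀ s', Ext 8 s s' → ex.eval s' = x) (hy : ∀ s', Ext 8 s s' → ey.eval s' = y)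
    (he : ∀ s', Ext 8 s s' → ee.eval s' = x + Z.length * D)
    (hA : Arr s b A) (hAs : SortedCells M A) (hAM : ∀ p ∈ A, Bdd M 4 p)
    (hZ : PairTab s x y D Z) (hZM : ∀ uv ∈ Z, Bdd M 4 uv.1 ∧ Bdd M 4 uv.2)
    (H : ∀ t' s' W, t' ≤ t + (eb.cost + en.cost + ex.cost + ey.cost + ee.cost +
        1100 * D * (Nat.log 2 A.length + 2) * (Z.length + 1)) → Ext 8 s s' →
      OpenTab s' (s.reg 50) W → W.length ≤ 3 * Z.length →
      (∀ uv ∈ Z, ∀ r r' (h : r < A.length) (h' : r' < A.length), IsLowerBound M A uv.1 r →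
        IsLowerBound M A uv.2 r' → ∀ w ∈ uv.1 :: candCells M A[r] A[r'], w ∈ W) →
      (∀ w ∈ W, (∃ uv ∈ Z, w = uv.1) ∨ ∃ p ∈ A, ∃ q ∈ A, w ∈ candCells M p q) → Q t' s') :
    WP (candProg eb en ex ey ee) s t Q := by
  simp only [candProg, wp_seq, wp_set]
  rw [hb, hn _ (by simp), hy _ (by simp), he _ (by simp)]
  set K := 1100 * D * (Nat.log 2 A.length + 2) with hK
  have hK' : K = 1000 * D * (Nat.log 2 A.length + 2) + 100 * (D * Nat.log 2 A.length) +
    200 * D := by rw [hK]; ring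
  refine wp_forStep Z.length x D (by omega) (fun i s1 => Ext 8 s s1 ∧ s1.reg 8 = b ∧
    s1.reg 9 = A.length ∧ s1.reg 10 = x + i * D ∧ s1.reg 11 = y + i * D ∧
    s1.reg 12 = x + Z.length * D ∧ ∃ W, OpenTab s1 (s.reg 50) W ∧ W.length ≤ 3 * i ∧
      (∀ uv ∈ Z.take i, ∀ r r' (h : r < A.length) (h' : r' < A.length), IsLowerBound M A uv.1 r →
        IsLowerBound M A uv.2 r' → ∀ w ∈ uv.1 :: candCells M A[r] A[r'], w ∈ W) ∧
      (∀ w ∈ W, (∃ uv ∈ Z, w = uv.1) ∨ ∃ p ∈ A, ∃ q ∈ A, w ∈ candCells M p q)) K ?_ ?_ ?_ ?_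
  · rw [hx _ (by simp)]
    refine ⟨by simp, by simp, by simp, by simp, by simp, by simp, [], by simp [openTab_nil],
      by simp, by simp, by simp⟩
  · rintro i s1 ⟨h1, h8, h9, h10, h11, h12, -⟩
    exact ⟨h10, (hs.ext h1 (by norm_num)).1, h12⟩
  · rintro i s1 t1 hi ⟨h1, h8, h9, h10, h11, h12, W, hW, hWl, hW1, hW2⟩
    have hs1 := hs.ext h1 (by norm_num)
    obtain ⟨hu, hv⟩ := hZ i hi
    have hZi := hZM _ (List.getElem_mem hi)
    rw [wp_seq]
    refine wp_candBody hD hs1 h8 h9 (hA.ext h1) hAs hAM (h10 ▸ hu.ext h1) (h11 ▸ hv.ext h1)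
      hZi.1 hZi.2 hW ?_
    intro t2 s2 W' ht2 he2 hW' hlen hspec hspec'
    have f1 := (he2.reg 1 (by norm_num)).trans hs1.1
    have f8 := (he2.reg 8 (by norm_num)).trans h8
    have f9 := (he2.reg 9 (by norm_num)).trans h9
    have f10 := (he2.reg 10 (by norm_num)).trans h10
    have f11 := (he2.reg 11 (by norm_num)).trans h11
    have f12 := (he2.reg 12 (by norm_num)).trans h12
    rw [wp_set]
    refine ⟨by simp [f10], by simp [Expr.eval, f1], ⟨?_, by simp [f8], by simp [f9], by simp,
      ?_, by simp [f12], W ++ W', by simpa using hW', ?_, ?_, ?_⟩, ?_⟩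
    · simpa using h1.trans (he2.mono (by norm_num))
    · simp [Expr.eval, f11, f1]
      ring
    · rw [List.length_append]
      omega
    · intro uv huv r r' h h' hr hr' w hw
      rw [List.take_succ_eq_append_getElem hi, List.mem_append, List.mem_singleton] at huv
      rw [List.mem_append]
      rcases huv with huv | rfl
      · exact Or.inl (hW1 uv huv r r' h h' hr hr' w hw)
      · right
        rw [hspec r r' h h' hr hr']
        exact hw
    · intro w hw
      rcases List.mem_append.1 hw with hw | hw
      · exact hW2 w hw
      · rcases hspec' with rfl | ⟨p, hp, q, hq, rfl⟩
        · simp at hw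
        · rcases List.mem_cons.1 hw with rfl | hw
          · exact Or.inl ⟨_, List.getElem_mem hi, rfl⟩
          · exact Or.inr ⟨p, hp, q, hq, hw⟩
    · simp only [Expr.cost]
      omega
  · rintro s1 t1 ⟨h1, h8, h9, h10, h11, h12, W, hW, hWl, hW1, hW2⟩ ht1
    simp only [Expr.cost] at ht1
    refine H _ _ W (by rw [mul_add K]; omega) h1 hW hWl ?_ hW2
    rwa [List.take_length] at hW1

/-! ### Tables of edges -/

/-- The list is strictly sorted by the keys of its cells. -/
def StrictSorted (M : ℤ) (L : List (Cell D)) : Prop :=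
  L.Pairwise fun p q => key (M + 2) p < key (M + 2) q

theorem StrictSorted.sorted {M : ℤ} {L : List (Cell D)} (h : StrictSorted M L) :
    SortedCells M L :=
  List.Pairwise.imp le_of_lt h

theorem StrictSorted.key_lt {M : ℤ} {L : List (Cell D)} (h : StrictSorted M L) {i j : ℕ}
    (hij : i < j) (hj : j < L.length) : key (M + 2) L[i] < key (M + 2) L[j] :=
  List.pairwise_iff_getElem.1 h i j (by omega) hj hij

theorem IsLowerBound.getElem_eq {M : ℤ} {L : List (Cell D)} {x : Cell D} {r : ℕ}
    (h : IsLowerBound M L x r) (hLM : ∀ p ∈ L, Bdd M 4 p) (hL : SortedCells M L) (hx : x ∈ L) :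
    ∃ hr : r < L.length, L[r] = x := by
  obtain ⟨i, hi, rfl⟩ := List.mem_iff_getElem.1 hx
  have hri : r ≤ i := by
    by_contra! hc
    exact lt_irrefl _ (h.lt i hi hc)
  refine ⟨by omega, key_injective (R := M + 2) ?_ ?_
    (le_antisymm (hL.key_le hri hi) (h.ge r (by omega) le_rfl))⟩
  · have := (hLM _ (List.getElem_mem (show r < L.length by omega))).1
    omega
  · have := (hLM _ (List.getElem_mem hi)).1
    omega

open Classical in
/-- The pairs of cells of `V` among the pairs in `Z` whose first cell precedes the second one. -/
noncomputable def edgePairs (M : ℤ) (V : List (Cell D)) (Z : List (Cell D × Cell D)) :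
    List (Cell D × Cell D) :=
  Z.filter fun xy => xy.1 ∈ V ∧ xy.2 ∈ V ∧ key (M + 2) xy.1 < key (M + 2) xy.2

theorem mem_edgePairs {M : ℤ} {V : List (Cell D)} {Z : List (Cell D × Cell D)}
    {xy : Cell D × Cell D} :
    xy ∈ edgePairs M V Z ↔
      xy ∈ Z ∧ xy.1 ∈ V ∧ xy.2 ∈ V ∧ key (M + 2) xy.1 < key (M + 2) xy.2 := by
  simp [edgePairs]

/-- The length of the edge from `p` down or across to `q`. -/
def edgeLength (p q : Cell D) : ℤ := max 1 (p.lev - q.lev)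

/-- The memory from the address `b` to the first free address is the table of the edges `E` on the
vertices `V`. -/
def OpenEdges (s : State) (b : ℤ) (V : List (Cell D)) (E : List (Cell D × Cell D)) : Prop :=
  s.reg 50 = b + 3 * E.length ∧ ∀ i (h : i < E.length), ∃ (r r' : ℕ) (hr : r < V.length)
    (hr' : r' < V.length), V[r] = E[i].1 ∧ V[r'] = E[i].2 ∧ s.mem (b + 3 * i) = r ∧
      s.mem (b + 3 * i + 1) = r' ∧ s.mem (b + 3 * i + 2) = edgeLength E[i].1 E[i].2

theorem openEdges_nil {s : State} {b : ℤ} {V : List (Cell D)} (h : s.reg 50 = b) :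
    OpenEdges s b V [] := by
  simp [OpenEdges, h]

theorem OpenEdges.ext {k : ℕ} {s s' : State} {b : ℤ} {V : List (Cell D)}
    {E : List (Cell D × Cell D)} (h : OpenEdges s b V E) (he : Ext k s s')
    (h50 : s'.reg 50 = s.reg 50) : OpenEdges s' b V E := by
  refine ⟨h50.trans h.1, fun i hi => ?_⟩
  have := h.1
  obtain ⟨r, r', hr, hr', h1, h2, h3, h4, h5⟩ := h.2 i hi
  refine ⟨r, r', hr, hr', h1, h2, ?_, ?_, ?_⟩
  · rw [he.mem _ (by omega), h3]
  · rw [he.mem _ (by omega), h4]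
  · rw [he.mem _ (by omega), h5]

@[simp] theorem openEdges_setReg {s : State} {r : ℕ} {v b : ℤ} {V : List (Cell D)}
    {E : List (Cell D × Cell D)} (hr : 50 ≠ r) :
    OpenEdges (s.setReg r v) b V E ↔ OpenEdges s b V E := by
  simp [OpenEdges, hr]

theorem OpenEdges.append {s : State} {b : ℤ} {V : List (Cell D)} {E : List (Cell D × Cell D)}
    (h : OpenEdges s b V E) {r r' : ℕ} (hr : r < V.length) (hr' : r' < V.length) {w : ℤ}
    (hw : w = edgeLength V[r] V[r']) :
    OpenEdges (((s.pushed r).pushed r').pushed w) b V (E ++ [(V[r], V[r'])]) := by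
  have h0 := h.1
  refine ⟨by simp [h0]; ring, fun i hi => ?_⟩
  rw [List.length_append, List.length_singleton] at hi
  by_cases hiE : i < E.length
  · obtain ⟨x, x', hx, hx', h1, h2, h3, h4, h5⟩ := h.2 i hiE
    refine ⟨x, x', hx, hx', ?_, ?_, ?_, ?_, ?_⟩
    · rw [List.getElem_append_left hiE, h1]
    · rw [List.getElem_append_left hiE, h2]
    all_goals
      simp only [State.pushed_mem, State.pushed_reg, if_true]
      rw [if_neg (by omega), if_neg (by omega), if_neg (by omega)]
    · exact h3
    · exact h4
    · rw [List.getElem_append_left hiE]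
      exact h5
  · obtain rfl : i = E.length := by omega
    refine ⟨r, r', hr, hr', by simp, by simp, ?_, ?_, ?_⟩ <;>
      simp only [State.pushed_mem, State.pushed_reg, if_true]
    · rw [if_neg (by omega), if_neg (by omega), if_pos (by omega)]
    · rw [if_neg (by omega), if_pos (by omega)]
    · rw [if_pos (by omega), hw]
      simp

/-- Searches the two cells at the addresses in the registers 10 and 11 in the array of pointers
described by the registers 8 and 9. If both are found, in this order, appends an edge. -/
def edgesBody : Program :=
  bsearch (.reg 8) (.reg 9) (.reg 10) ;; .set 13 (.reg 15) ;;
  bsearch (.reg 8) (.reg 9) (.reg 11) ;;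
  .ite (.reg 13) (.reg 15)
    (.ite (.reg 15) (.reg 9)
      (.set 20 (.mem (.add (.reg 8) (.reg 13))) ;; .set 21 (.mem (.add (.reg 8) (.reg 15))) ;;
      splitCmp (.reg 10) (.reg 20) ;; .set 22 (.reg 36) ;;
      splitCmp (.reg 11) (.reg 21) ;;
      .ite (.lit 0) (.add (.reg 22) (.reg 36))
        .skip
        (.set 23 (.sub (levExpr (.reg 10)) (levExpr (.reg 11))) ;;
        .setIf 23 (.lit 1) (.reg 23) (.reg 23) (.lit 1) ;;
        push (.reg 13) ;; push (.reg 15) ;; push (.reg 23)))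
      .skip)
    .skip

open Classical in
theorem wp_edgesBody {s : State} {t : ℕ} {Q : ℕ → State → Prop} {b M eb : ℤ}
    {V : List (Cell D)} {E : List (Cell D × Cell D)} {x y : Cell D} (hD : 1 ≤ D) (hs : Env D M s)
    (h8 : s.reg 8 = b) (h9 : s.reg 9 = V.length) (hV : Arr s b V) (hVs : StrictSorted M V)
    (hVM : ∀ p ∈ V, Bdd M 4 p) (hx : At s (s.reg 10) x) (hy : At s (s.reg 11) y)
    (hxM : Bdd M 4 x) (hyM : Bdd M 4 y) (hE : OpenEdges s eb V E)
    (H : ∀ t' s', t' ≤ t + 1000 * D * (Nat.log 2 V.length + 2) → Ext 13 s s' → s'.reg 14 = s.reg 14 →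
      OpenEdges s' eb V (E ++ edgePairs M V [(x, y)]) → Q t' s') :
    WP edgesBody s t Q := by
  have hd : 1000 * D * (Nat.log 2 V.length + 2) =
    2 * (200 * D * (Nat.log 2 V.length + 2)) + 600 * (D * Nat.log 2 V.length) + 1200 * D := by ring
  have hfil : edgePairs M V [(x, y)] = if x ∈ V ∧ y ∈ V ∧ key (M + 2) x < key (M + 2) y then
      [(x, y)] else [] := by
    simp [edgePairs, List.filter_cons]
  have hkey : ∀ {p q : Cell D}, Bdd M 4 p → Bdd M 4 q → key (M + 2) p = key (M + 2) q → p = q :=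
    fun hp hq h => key_injective (by have := hp.1; omega) (by have := hq.1; omega) h
  rw [hfil] at H
  rw [edgesBody, wp_seq]
  refine wp_bsearch (b := b) (a := s.reg 10) hD hs
    (fun s' he => (he.reg 8 (by norm_num)).trans h8)
    (fun s' he => (he.reg 9 (by norm_num)).trans h9) (fun s' he => he.reg 10 (by norm_num))
    hV hx hVs.sorted hVM hxM ?_
  intro t1 s1 r ht1 he1 g50 g15 hr
  have hs1 := hs.ext he1 (by norm_num)
  rw [wp_seq, wp_set, wp_seq]
  have k1 : Ext 13 s (s1.setReg 13 (s1.reg 15)) := by simpa using he1.mono (by norm_num)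
  refine wp_bsearch (b := b) (a := s.reg 11) hD (by simpa using hs1)
    (fun s' he => by simpa [Expr.eval, he1.reg 8 (by norm_num), h8] using he.reg 8 (by norm_num))
    (fun s' he => by simpa [Expr.eval, he1.reg 9 (by norm_num), h9] using he.reg 9 (by norm_num))
    (fun s' he => by simpa [Expr.eval, he1.reg 11 (by norm_num)] using he.reg 11 (by norm_num))
    (hV.ext k1) (hy.ext k1) hVs.sorted hVM hyM ?_
  intro t2 s2 r' ht2 he2 f50 f15 hr'
  have k2 : Ext 13 s s2 := k1.trans (he2.mono (by norm_num))
  have f13 : s2.reg 13 = r := by simpa [Expr.eval, g15] using he2.reg 13 (by norm_num)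
  have f14 : s2.reg 14 = s.reg 14 := by
    simpa [Expr.eval, he1.reg 14 (by norm_num)] using he2.reg 14 (by norm_num)
  have f8 : s2.reg 8 = b := (k2.reg 8 (by norm_num)).trans h8
  have f9 : s2.reg 9 = V.length := (k2.reg 9 (by norm_num)).trans h9
  have f10 : s2.reg 10 = s.reg 10 := k2.reg 10 (by norm_num)
  have f11 : s2.reg 11 = s.reg 11 := k2.reg 11 (by norm_num)
  have hE2 : OpenEdges s2 eb V E := hE.ext k2 (by rw [f50]; simp [g50])
  have hs2 := hs.ext k2 (by norm_num)
  simp only [Expr.cost] at ht1 ht2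
  have hfound : x ∈ V ∧ y ∈ V ∧ key (M + 2) x < key (M + 2) y →
      ∃ (h : r < V.length) (h' : r' < V.length), V[r] = x ∧ V[r'] = y ∧ r < r' := by
    rintro ⟨hxV, hyV, hlt⟩
    obtain ⟨h, hrx⟩ := hr.getElem_eq hVM hVs.sorted hxV
    obtain ⟨h', hry⟩ := hr'.getElem_eq hVM hVs.sorted hyV
    refine ⟨h, h', hrx, hry, ?_⟩
    by_contra! hc
    have := hVs.sorted.key_le hc h
    rw [hrx, hry] at this
    exact absurd hlt (not_lt.2 this)
  have fail : ∀ {t' s'}, t' ≤ t + 1000 * D * (Nat.log 2 V.length + 2) → Ext 13 s s' →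
      s'.reg 14 = s.reg 14 → OpenEdges s' eb V E →
      ¬ (∃ (h : r < V.length) (h' : r' < V.length), V[r] = x ∧ V[r'] = y ∧ r < r') → Q t' s' := by
    intro t' s' ht' he' h14 hE' hno
    refine H t' s' ht' he' h14 ?_
    rw [if_neg fun h => hno (hfound h), List.append_nil]
    exact hE'
  rw [wp_ite]
  simp only [Expr.eval, Expr.cost, f13, f15, Nat.cast_lt]
  constructor
  swap
  · intro hlt
    rw [wp_skip]
    exact fail (by rw [hd]; omega) k2 f14 hE2 fun ⟨_, _, _, _, h⟩ => hlt h
  intro hlt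
  rw [wp_ite]
  simp only [Expr.eval, Expr.cost, f15, f9, Nat.cast_lt]
  constructor
  swap
  · intro hlt'
    rw [wp_skip]
    exact fail (by rw [hd]; omega) k2 f14 hE2 fun ⟨_, h, _, _, _⟩ => hlt' h
  intro hlt'
  have hrV : r < V.length := by omega
  simp only [wp_seq, wp_set, Expr.eval, State.setReg_reg, State.setReg_mem, Nat.reduceEqDiff,
    if_false, f8, f13, f15]
  have hAr := (hV.ext k2).2 r hrV
  have hAr' := (hV.ext k2).2 r' hlt'
  have hx2 := hx.ext k2
  have hy2 := hy.ext k2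
  refine wp_splitCmp (p := x) (q := V[r]) (a := s.reg 10) (b := s2.mem (b + r)) hD
    (by simp [hs2.1]) (by simp [hs2.2]) (by simp [Expr.eval, f10]) (by simp [Expr.eval])
    (by simpa using hx2) (by simpa using hAr) hxM (hVM _ (List.getElem_mem _)) ?_
  intro t3 s3 ht3 he3 g50' _ _ _ g36 _
  have k3' : Ext 20 s2 s3 := by
    refine Ext.trans ?_ (he3.mono (k' := 20) (by norm_num))
    simp
  have g21 : s3.reg 21 = s2.mem (b + r') := by simpa using he3.reg 21 (by norm_num)
  have k3 : Ext 13 s s3 := k2.trans (k3'.mono (by norm_num))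
  have hs3 := hs.ext k3 (by norm_num)
  have hE3 : OpenEdges s3 eb V E := hE2.ext k3' (by simpa using g50')
  refine wp_splitCmp (p := y) (q := V[r']) (a := s.reg 11) (b := s2.mem (b + r')) hD
    (by simp [hs3.1]) (by simp [hs3.2])
    (by simp [Expr.eval, k3.reg 11 (by norm_num)]) (by simp [Expr.eval, g21])
    (by simpa using hy.ext k3) (by simpa using hAr'.ext k3') hyM (hVM _ (List.getElem_mem _)) ?_
  intro t4 s4 ht4 he4 g50'' _ _ _ g36' _
  have k4' : Ext 20 s2 s4 := by
    refine k3'.trans (Ext.trans ?_ (he4.mono (k' := 20) (by norm_num)))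
    simp
  have k4 : Ext 13 s s4 := k2.trans (k4'.mono (by norm_num))
  have hs4 := hs.ext k4 (by norm_num)
  have g22 : s4.reg 22 = flag (key (M + 2) x < key (M + 2) V[r]) := by
    simpa [g36] using he4.reg 22 (by norm_num)
  have g14 : s4.reg 14 = s.reg 14 := (k4'.reg 14 (by norm_num)).trans f14
  have hE4 : OpenEdges s4 eb V E :=
    hE3.ext (k := 0) (Ext.trans (by simp) (he4.mono (by norm_num))) (by simpa using g50'')
  simp only [Expr.cost] at ht3 ht4
  rw [wp_ite]
  simp only [Expr.eval, Expr.cost, g22, g36', flag]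
  have hle1 := hr.ge r hrV le_rfl
  have hle2 := hr'.ge r' hlt' le_rfl
  constructor
  · intro hpos
    rw [wp_skip]
    refine fail (by rw [hd]; omega) k4 g14 hE4 ?_
    rintro ⟨_, _, hxr, hyr, _⟩
    rw [hxr, hyr] at hpos
    have h1 : ¬ key (M + 2) x < key (M + 2) x := fun h => lt_irrefl _ h
    have h2 : ¬ key (M + 2) y < key (M + 2) y := fun h => lt_irrefl _ h
    rw [if_neg h1, if_neg h2] at hpos
    exact absurd hpos (by norm_num)
  · intro hneg
    have hnot : ¬ key (M + 2) x < key (M + 2) V[r] ∧ ¬ key (M + 2) y < key (M + 2) V[r'] := by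
      split_ifs at hneg with h1 h2 h2
      · exact absurd hneg (by norm_num)
      · exact absurd hneg (by norm_num)
      · exact absurd hneg (by norm_num)
      · exact ⟨h1, h2⟩
    have hxr : x = V[r] := hkey hxM (hVM _ (List.getElem_mem _))
      (le_antisymm hle1 (not_lt.1 hnot.1))
    have hyr : y = V[r'] := hkey hyM (hVM _ (List.getElem_mem _))
      (le_antisymm hle2 (not_lt.1 hnot.2))
    have hlx : (levExpr (.reg 10)).eval s4 = x.lev :=
      levExpr_eval hD hs4.1 (by simpa [Expr.eval, k4.reg 10 (by norm_num)] using hx.ext k4)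
    have hly : (levExpr (.reg 11)).eval s4 = y.lev :=
      levExpr_eval hD hs4.1 (by simpa [Expr.eval, k4.reg 11 (by norm_num)] using hy.ext k4)
    rw [wp_seq, wp_set, wp_seq]
    simp only [Expr.eval, hlx, hly]
    refine wp_setIf fun t5 ht5 => ?_
    have e13 : s4.reg 13 = r := (k4'.reg 13 (by norm_num)).trans f13
    have e15 : s4.reg 15 = r' := (k4'.reg 15 (by norm_num)).trans f15
    simp only [wp_seq, wp_push, Expr.eval, Expr.cost, levExpr_cost, State.setReg_reg,
      State.pushed_reg, Nat.reduceEqDiff, if_true, if_false, e13, e15] at ht5 ⊢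
    refine H _ _ (by rw [hd]; omega) ?_ (by simp [g14]) ?_
    · refine Ext.pushed (Ext.pushed (Ext.pushed ?_ _ (by norm_num)) _ (by norm_num)) _ (by norm_num)
      simpa using k4
    · have hpos : x ∈ V ∧ y ∈ V ∧ key (M + 2) x < key (M + 2) y := by
        rw [hxr, hyr]
        exact ⟨List.getElem_mem _, List.getElem_mem _, hVs.key_lt hlt hlt'⟩
      rw [if_pos hpos, show (x, y) = (V[r], V[r']) by rw [← hxr, ← hyr]]
      refine OpenEdges.append (by simpa using hE4) hrV hlt' ?_
      rw [← hxr, ← hyr, edgeLength]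
      omega

/-- Runs `edgesBody` for all pairs of the tables with the distance `d` between the addresses `x` and
`e`, and at the address `y`. -/
def edgesProg (b n x y d e : Expr) : Program :=
  .set 8 b ;; .set 9 n ;; .set 11 y ;; .set 12 e ;; .set 14 d ;;
  .forStep 10 x (.reg 14) (.reg 12) (edgesBody ;; .set 11 (.add (.reg 11) (.reg 14)))

theorem wp_edgesProg {eb en ex ey ed ee : Expr} {s : State} {t : ℕ} {Q : ℕ → State → Prop}
    {b x y M ob : ℤ} {d : ℕ} {V : List (Cell D)} {Z E : List (Cell D × Cell D)} (hD : 1 ≤ D)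
    (hd : 1 ≤ d) (hs : Env D M s)
    (hb : eb.eval s = b) (hn : ∀ s', Ext 8 s s' → en.eval s' = V.length)
    (hx : ∀ s', Ext 8 s s' → ex.eval s' = x) (hy : ∀ s', Ext 8 s s' → ey.eval s' = y)
    (hde : ∀ s', Ext 8 s s' → ed.eval s' = d)
    (he : ∀ s', Ext 8 s s' → ee.eval s' = x + Z.length * d)
    (hV : Arr s b V) (hVs : StrictSorted M V) (hVM : ∀ p ∈ V, Bdd M 4 p)
    (hZ : PairTab s x y d Z) (hZM : ∀ uv ∈ Z, Bdd M 4 uv.1 ∧ Bdd M 4 uv.2)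
    (hE : OpenEdges s ob V E)
    (H : ∀ t' s', t' ≤ t + (eb.cost + en.cost + ex.cost + ey.cost + ed.cost + ee.cost +
        1100 * D * (Nat.log 2 V.length + 2) * (Z.length + 1)) → Ext 8 s s' →
      OpenEdges s' ob V (E ++ edgePairs M V Z) → Q t' s') :
    WP (edgesProg eb en ex ey ed ee) s t Q := by
  simp only [edgesProg, wp_seq, wp_set]
  rw [hb, hn _ (by simp), hy _ (by simp), he _ (by simp), hde _ (by simp)]
  set K := 1100 * D * (Nat.log 2 V.length + 2) with hK
  have hK' : K = 1000 * D * (Nat.log 2 V.length + 2) + 100 * (D * Nat.log 2 V.length) +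
    200 * D := by rw [hK]; ring
  refine wp_forStep Z.length x d (by omega) (fun i s1 => Ext 8 s s1 ∧ s1.reg 8 = b ∧
    s1.reg 9 = V.length ∧ s1.reg 10 = x + i * d ∧ s1.reg 11 = y + i * d ∧
    s1.reg 12 = x + Z.length * d ∧ s1.reg 14 = d ∧
    OpenEdges s1 ob V (E ++ edgePairs M V (Z.take i))) K ?_ ?_ ?_ ?_
  · rw [hx _ (by simp)]
    refine ⟨by simp, by simp, by simp, by simp, by simp, by simp, by simp, ?_⟩
    simpa [edgePairs] using hE
  · rintro i s1 ⟨h1, h8, h9, h10, h11, h12, h14, -⟩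
    exact ⟨h10, h14, h12⟩
  · rintro i s1 t1 hi ⟨h1, h8, h9, h10, h11, h12, h14, hE1⟩
    have hs1 := hs.ext h1 (by norm_num)
    obtain ⟨hu, hv⟩ := hZ i hi
    have hZi := hZM _ (List.getElem_mem hi)
    rw [wp_seq]
    refine wp_edgesBody hD hs1 h8 h9 (hV.ext h1) hVs hVM (h10 ▸ hu.ext h1) (h11 ▸ hv.ext h1)
      hZi.1 hZi.2 hE1 ?_
    intro t2 s2 ht2 he2 g14 hE2
    have f8 := (he2.reg 8 (by norm_num)).trans h8
    have f9 := (he2.reg 9 (by norm_num)).trans h9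
    have f10 := (he2.reg 10 (by norm_num)).trans h10
    have f11 := (he2.reg 11 (by norm_num)).trans h11
    have f12 := (he2.reg 12 (by norm_num)).trans h12
    have f14 := g14.trans h14
    rw [wp_set]
    refine ⟨by simp [f10], by simp [Expr.eval, f14], ⟨?_, by simp [f8], by simp [f9], by simp,
      ?_, by simp [f12], by simp [f14], ?_⟩, ?_⟩
    · simpa using h1.trans (he2.mono (by norm_num))
    · simp [Expr.eval, f11, f14]
      ring
    · rw [openEdges_setReg (by norm_num), openEdges_setReg (by norm_num),
        List.take_succ_eq_append_getElem hi, edgePairs, List.filter_append, ← List.append_assoc]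
      exact hE2
    · simp only [Expr.cost]
      omega
  · rintro s1 t1 ⟨h1, h8, h9, h10, h11, h12, h14, hE1⟩ ht1
    simp only [Expr.cost] at ht1
    refine H _ _ (by rw [mul_add K]; omega) h1 ?_
    rwa [List.take_length] at hE1

/-! ### Pairs of cells from tables -/

/-- Each cell of `L`, paired with its translates by `-1`, `0` and `1` along the first `k`
coordinates. -/
def expandPairsTo (L : List (Cell D)) : ℕ → List (Cell D × Cell D)
  | 0 => L.map fun c => (c, c)
  | k + 1 => if h : k < D - 1 then (expandPairsTo L k).flatMap fun cd =>
      [(cd.1, cd.2.shift ⟨k, h⟩ (-1)), (cd.1, cd.2.shift ⟨k, h⟩ 0), (cd.1, cd.2.shift ⟨k, h⟩ 1)]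
    else expandPairsTo L k

/-- The cells of `L`, paired with themselves and their horizontal neighbors. -/
def expandPairs (L : List (Cell D)) : List (Cell D × Cell D) := expandPairsTo L (D - 1)

theorem map_fst_expandPairsTo (L : List (Cell D)) (k : ℕ) :
    (expandPairsTo L k).map Prod.fst = expandTo 0 L k := by
  induction k with
  | zero => simp [expandPairsTo, expandTo, Function.comp_def]
  | succ k ih =>
    rw [expandPairsTo, expandTo]
    split_ifs with h
    · rw [← ih, expandStep, List.flatMap_map, List.map_flatMap]
      simp
    · exact ih

theorem map_snd_expandPairsTo (L : List (Cell D)) (k : ℕ) :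
    (expandPairsTo L k).map Prod.snd = expandTo 1 L k := by
  induction k with
  | zero => simp [expandPairsTo, expandTo, Function.comp_def]
  | succ k ih =>
    rw [expandPairsTo, expandTo]
    split_ifs with h
    · rw [← ih, expandStep, List.flatMap_map, List.map_flatMap]
      simp
    · exact ih

theorem length_expandPairs (L : List (Cell D)) :
    (expandPairs L).length = 3 ^ (D - 1) * L.length := by
  rw [← length_expand 0 L, expand, ← map_fst_expandPairsTo, List.length_map, expandPairs]

theorem mem_expandPairsTo {L : List (Cell D)} {k : ℕ} (hk : k ≤ D - 1) {u v : Cell D} :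
    (u, v) ∈ expandPairsTo L k ↔ u ∈ L ∧ u.lev = v.lev ∧
      ∀ j : Fin (D - 1), |u.idx j - v.idx j| ≤ if (j : ℕ) < k then 1 else 0 := by
  induction k generalizing u v with
  | zero =>
    simp only [expandPairsTo, List.mem_map, Prod.mk.injEq, not_lt_zero, if_false]
    constructor
    · rintro ⟨c, hc, rfl, rfl⟩
      simp [hc]
    · rintro ⟨hu, hl, hj⟩
      refine ⟨u, hu, rfl, Cell.ext (funext fun j => ?_) hl⟩
      have := abs_nonpos_iff.1 (hj j)
      omega
  | succ k ih =>
    rw [expandPairsTo, dif_pos (by omega), List.mem_flatMap]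
    have hk' : k < D - 1 := by omega
    constructor
    · rintro ⟨⟨c, d⟩, hcd, huv⟩
      obtain ⟨hc, hl, hj⟩ := (ih (by omega)).1 hcd
      have key : ∀ e : ℤ, |e| ≤ 1 → (u, v) = (c, d.shift ⟨k, hk'⟩ e) → u ∈ L ∧ u.lev = v.lev ∧
          ∀ j : Fin (D - 1), |u.idx j - v.idx j| ≤ if (j : ℕ) < k + 1 then 1 else 0 := by
        intro e he h
        rw [Prod.mk.injEq] at h
        obtain ⟨rfl, rfl⟩ := h
        refine ⟨hc, hl, fun j => ?_⟩
        have := hj j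
        by_cases hjk : j = ⟨k, hk'⟩
        · subst hjk
          simp only [Cell.shift, Function.update_self, lt_irrefl, if_false, abs_nonpos_iff,
            Nat.lt_succ_self, if_true] at this ⊢
          rw [show u.idx ⟨k, hk'⟩ - (d.idx ⟨k, hk'⟩ + e) = -e by omega, abs_neg]
          exact he
        · have hne : (j : ℕ) ≠ k := fun h => hjk (Fin.ext h)
          simp only [Cell.shift, Function.update_of_ne hjk]
          by_cases hlt : (j : ℕ) < k
          · rw [if_pos (by omega)]
            rwa [if_pos hlt] at this
          · rw [if_neg (by omega)]
            rwa [if_neg hlt] at this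
      simp only [List.mem_cons, List.not_mem_nil, or_false] at huv
      rcases huv with h | h | h
      · exact key _ (by norm_num) h
      · exact key _ (by norm_num) h
      · exact key _ (by norm_num) h
    · rintro ⟨hu, hl, hj⟩
      refine ⟨(u, ⟨Function.update v.idx ⟨k, hk'⟩ (u.idx ⟨k, hk'⟩), v.lev⟩),
        (ih (by omega)).2 ⟨hu, hl, fun j => ?_⟩, ?_⟩
      · by_cases hjk : j = ⟨k, hk'⟩
        · subst hjk
          simp
        · have hne : (j : ℕ) ≠ k := fun h => hjk (Fin.ext h)
          have := hj j
          simp only [Function.update_of_ne hjk]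
          by_cases hlt : (j : ℕ) < k
          · rw [if_pos hlt]
            rwa [if_pos (by omega)] at this
          · rw [if_neg hlt]
            rwa [if_neg (by omega)] at this
      · have h1 := hj ⟨k, hk'⟩
        simp only [Nat.lt_succ_self, if_true] at h1
        have h2 := abs_le.1 h1
        have h3 : ∀ e : ℤ, u.idx ⟨k, hk'⟩ + e = v.idx ⟨k, hk'⟩ →
            v = Cell.shift ⟨k, hk'⟩ e
              ⟨Function.update v.idx ⟨k, hk'⟩ (u.idx ⟨k, hk'⟩), v.lev⟩ := by
          intro e he
          ext j
          · simp [Cell.shift, he]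
          · rfl
        simp only [List.mem_cons, List.not_mem_nil, or_false, Prod.mk.injEq, true_and]
        rcases (show v.idx ⟨k, hk'⟩ = u.idx ⟨k, hk'⟩ + -1 ∨ v.idx ⟨k, hk'⟩ = u.idx ⟨k, hk'⟩ + 0 ∨
          v.idx ⟨k, hk'⟩ = u.idx ⟨k, hk'⟩ + 1 by omega) with h | h | h
        · exact Or.inl (h3 _ h.symm)
        · exact Or.inr (Or.inl (h3 _ h.symm))
        · exact Or.inr (Or.inr (h3 _ h.symm))

theorem mem_expandPairs {L : List (Cell D)} {u v : Cell D} :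
    (u, v) ∈ expandPairs L ↔ u ∈ L ∧ u.lev = v.lev ∧ Near 1 u v := by
  rw [expandPairs, mem_expandPairsTo le_rfl]
  simp [Near]

theorem mem_expand_one {L : List (Cell D)} {v : Cell D} :
    v ∈ expand 1 L ↔ ∃ u ∈ L, u.lev = v.lev ∧ Near 1 u v := by
  rw [expand, ← map_snd_expandPairsTo, List.mem_map]
  constructor
  · rintro ⟨⟨u, w⟩, h, rfl⟩
    exact ⟨u, mem_expandPairs.1 h⟩
  · rintro ⟨u, h⟩
    exact ⟨(u, v), mem_expandPairs.2 h, rfl⟩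

theorem nodup_expandPairs {L : List (Cell D)} (hL : L.Nodup) : (expandPairs L).Nodup := by
  have key : ∀ k ≤ D - 1, (expandPairsTo L k).Nodup := by
    intro k
    induction k with
    | zero =>
      intro _
      exact hL.map fun a b h => (Prod.mk.injEq _ _ _ _ ▸ h).1
    | succ k ih =>
      intro hk
      have hk' : k < D - 1 := by omega
      have hval : ∀ (e : ℤ) (d : Cell D),
          (d.shift ⟨k, hk'⟩ e).idx ⟨k, hk'⟩ = d.idx ⟨k, hk'⟩ + e := by
        intro e d
        simp [Cell.shift]
      rw [expandPairsTo, dif_pos hk', List.nodup_flatMap]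
      refine ⟨fun cd _ => ?_, ?_⟩
      · have h1 : ∀ e e' : ℤ, e ≠ e' → cd.2.shift ⟨k, hk'⟩ e ≠ cd.2.shift ⟨k, hk'⟩ e' := by
          intro e e' he h
          have := congrArg (fun c => c.idx ⟨k, hk'⟩) h
          simp only [hval] at this
          omega
        simp [h1 (-1) 1 (by norm_num), h1 0 1 (by norm_num), h1 (-1) 0 (by norm_num),
          -Cell.shift_zero]
      · refine (ih (by omega)).imp_of_mem ?_
        rintro ⟨c, d⟩ ⟨c', d'⟩ hcd hcd' hne ⟨u, v⟩ huv huv'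
        apply hne
        obtain ⟨-, -, hj⟩ := (mem_expandPairsTo (by omega)).1 hcd
        obtain ⟨-, -, hj'⟩ := (mem_expandPairsTo (by omega)).1 hcd'
        have e1 : ∃ e, u = c ∧ v = d.shift ⟨k, hk'⟩ e := by
          simp only [List.mem_cons, List.not_mem_nil, or_false, Prod.mk.injEq] at huv
          rcases huv with h | h | h <;> exact ⟨_, h⟩
        have e2 : ∃ e, u = c' ∧ v = d'.shift ⟨k, hk'⟩ e := by
          simp only [List.mem_cons, List.not_mem_nil, or_false, Prod.mk.injEq] at huv'
          rcases huv' with h | h | h <;> exact ⟨_, h⟩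
        obtain ⟨e, rfl, rfl⟩ := e1
        obtain ⟨e', rfl, h⟩ := e2
        have h4 := hj ⟨k, hk'⟩
        have h5 := hj' ⟨k, hk'⟩
        simp only [lt_irrefl, if_false, abs_nonpos_iff] at h4 h5
        have hlev := congrArg Cell.lev h
        rw [Prod.mk.injEq]
        refine ⟨rfl, Cell.ext (funext fun j => ?_) hlev⟩
        by_cases hjk : j = ⟨k, hk'⟩
        · rw [hjk]
          omega
        · have := congrFun (congrArg Cell.idx h) j
          simpa [Cell.shift, Function.update_of_ne hjk] using this
  exact key _ le_rfl

theorem pairTab_expandPairs {s : State} {x y : ℤ} {L : List (Cell D)}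
    (hx : Tab s x (expand 0 L)) (hy : Tab s y (expand 1 L)) :
    PairTab s x y D (expandPairs L) := by
  rw [expand, ← map_fst_expandPairsTo] at hx
  rw [expand, ← map_snd_expandPairsTo] at hy
  intro i hi
  have h1 := hx i (by rw [List.length_map]; exact hi)
  have h2 := hy i (by rw [List.length_map]; exact hi)
  rw [List.getElem_map] at h1 h2
  exact ⟨h1, h2⟩

/-- The cells of `V`, each with the lowest cell above it and its predecessor. -/
noncomputable def closePairs (M : ℤ) (V : List (Cell D)) : List (Cell D × Cell D) :=
  (prevPairs V).map fun pq => (pq.2.up (min (split (M + 2) pq.1 pq.2 + 1) M), pq.2)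

@[simp] theorem length_closePairs (M : ℤ) (V : List (Cell D)) :
    (closePairs M V).length = V.length := by
  simp [closePairs]

theorem getElem?_flatMap_closeBlock (M : ℤ) (L : List (Cell D × Cell D)) (i k : ℕ) (hk : k < 4)
    (hi : i < L.length) : (L.flatMap (closeBlock M))[4 * i + k]? = (closeBlock M L[i])[k]? := by
  induction L generalizing i with
  | nil => simp at hi
  | cons a L ih =>
    rw [List.flatMap_cons]
    have hl : (closeBlock M a).length = 4 := by simp [closeBlock]
    rcases i with _ | i
    · rw [List.getElem?_append_left (by omega)]
      simp
    · rw [List.getElem?_append_right (by omega), hl, show 4 * (i + 1) + k - 4 = 4 * i + k by omega,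
        ih i (by simpa using hi)]
      simp

theorem pairTab_closePairs {s : State} {M b : ℤ} {V : List (Cell D)}
    (h : Tab s b (closeList M V)) : PairTab s (b + D) b (4 * D : ℕ) (closePairs M V) := by
  intro i hi
  rw [length_closePairs] at hi
  have hi' : i < (prevPairs V).length := by simpa using hi
  have key : ∀ k (hk : k < 4) (C : Cell D), (closeBlock M (prevPairs V)[i])[k]? = some C →
      At s (b + ((4 * i + k : ℕ) : ℤ) * D) C := by
    intro k hk C hC
    have hlen : 4 * i + k < (closeList M V).length := by
      rw [length_closeList]
      omega
    have := h _ hlen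
    have e := getElem?_flatMap_closeBlock M (prevPairs V) i k hk hi'
    rw [hC] at e
    rw [List.getElem_eq_iff hlen |>.2 e] at this
    exact this
  constructor
  · have := key 1 (by norm_num) (closePairs M V)[i].1 (by simp [closeBlock, closePairs])
    convert this using 1
    push_cast
    ring
  · have := key 0 (by norm_num) (closePairs M V)[i].2 (by simp [closeBlock, closePairs])
    convert this using 1
    push_cast
    ring

/-! ### Bounds -/

theorem bdd_closeList {M c : ℤ} {L : List (Cell D)} (hL : ∀ p ∈ L, Bdd M c p) :
    ∀ p ∈ closeList M L, Bdd M c p := by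
  intro p hp
  obtain ⟨⟨x, y⟩, hxy, hp⟩ := List.mem_flatMap.1 hp
  rw [prevPairs, List.mem_ofFn] at hxy
  obtain ⟨i, hi⟩ := hxy
  rw [Prod.mk.injEq] at hi
  have hx : Bdd M c x := hi.1 ▸ hL _ (List.getElem_mem _)
  have hy : Bdd M c y := hi.2 ▸ hL _ (List.getElem_mem _)
  simp only [closeBlock, List.mem_cons, List.not_mem_nil, or_false] at hp
  rcases hp with rfl | rfl | rfl | rfl
  · exact hy
  · exact hy.up (min_le_right _ _)
  · exact hx.up (min_le_right _ _)
  · exact hy.up (min_le_right _ _)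

theorem bdd_candCells {M c : ℤ} {p q : Cell D} (hp : Bdd M c p) :
    ∀ w ∈ candCells M p q, Bdd M c w := by
  intro w hw
  simp only [candCells, List.mem_cons, List.not_mem_nil, or_false] at hw
  rcases hw with rfl | rfl
  · exact hp.up (min_le_right _ _)
  · exact hp.up (min_le_right _ _)

theorem bdd_expandPairs {M c : ℤ} {L : List (Cell D)} (hL : ∀ p ∈ L, Bdd M c p) :
    ∀ uv ∈ expandPairs L, Bdd M c uv.1 ∧ Bdd M (c + 1) uv.2 := by
  rintro ⟨u, v⟩ h
  obtain ⟨hu, hl, hn⟩ := mem_expandPairs.1 h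
  exact ⟨hL u hu, (hL u hu).near hl hn⟩

theorem bdd_expand_one {M c : ℤ} {L : List (Cell D)} (hL : ∀ p ∈ L, Bdd M c p) :
    ∀ v ∈ expand 1 L, Bdd M (c + 1) v := by
  intro v hv
  obtain ⟨u, hu, hl, hn⟩ := mem_expand_one.1 hv
  exact (hL u hu).near hl hn

theorem bdd_closePairs {M c : ℤ} {V : List (Cell D)} (hV : ∀ p ∈ V, Bdd M c p) :
    ∀ uv ∈ closePairs M V, Bdd M c uv.1 ∧ Bdd M c uv.2 := by
  intro uv h
  obtain ⟨pq, hpq, rfl⟩ := List.mem_map.1 h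
  have := bdd_closeList (M := M) hV
  refine ⟨this _ (List.mem_flatMap.2 ⟨pq, hpq, ?_⟩), this _ (List.mem_flatMap.2 ⟨pq, hpq, ?_⟩)⟩
  · simp [closeBlock]
  · simp [closeBlock]

/-! ### The algorithm -/

/-- A bound, up to a constant factor, for the number of steps of each of the routines on lists of at
most `K` cells. -/
def work (D K : ℕ) : ℕ := D * D * (K + 1) * (Nat.log 2 K + 2)

theorem one_le_work {K : ℕ} (hD : 1 ≤ D) : 1 ≤ work D K := by
  have : 0 < D * D * (K + 1) * (Nat.log 2 K + 2) := by positivity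
  exact this

theorem mul_mul_log_le_work {c m m' K : ℕ} (hD : 1 ≤ D) (hm : m ≤ K) (hm' : m' ≤ K) :
    c * D * (Nat.log 2 m + 2) * (m' + 1) ≤ c * work D K := by
  have h1 : Nat.log 2 m ≤ Nat.log 2 K := Nat.log_mono_right hm
  calc c * D * (Nat.log 2 m + 2) * (m' + 1)
      = c * (1 * D * (m' + 1) * (Nat.log 2 m + 2)) := by ring
    _ ≤ c * (D * D * (K + 1) * (Nat.log 2 K + 2)) := by gcongr

theorem mul_le_work {c m K : ℕ} (hD : 1 ≤ D) (hm : m ≤ K) :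
    c * D * (m + 1) ≤ c * work D K := by
  calc c * D * (m + 1) = c * (1 * D * (m + 1) * 1) := by ring
    _ ≤ c * (D * D * (K + 1) * (Nat.log 2 K + 2)) := by gcongr; omega

theorem mul_mul_le_work {c m K : ℕ} (hm : m ≤ K) :
    c * D * D * (m + 1) ≤ c * work D K := by
  calc c * D * D * (m + 1) = c * (D * D * (m + 1) * 1) := by ring
    _ ≤ c * (D * D * (K + 1) * (Nat.log 2 K + 2)) := by gcongr; omega

/-- Sets register 50 to the end of the input, and register 2 to a bound for the levels for which all
points of the input are below the cells next to the origin. -/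
def initProg : Program :=
  .set 50 (.lit 0) ;; .forUpto 8 (.reg 0) (.set 50 (.add (.reg 50) (.reg 1))) ;;
  .set 2 (.lit 0) ;;
  .forStep 8 (.lit 0) (.reg 1) (.reg 50)
    (.set 9 (levExpr (.reg 8)) ;;
    .forUpto 10 (.sub (.reg 1) (.lit 1))
      (.set 11 (.add (.add (.reg 9) (.log (.mem (.add (.reg 8) (.reg 10))))) (.lit 1)) ;;
      .setIf 2 (.reg 2) (.reg 11) (.reg 11) (.reg 2)))

/-- The lowest level for which the coordinate `j` of `p` is that of a cell next to the origin. -/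
def rootLevel (p : Cell D) (j : Fin (D - 1)) : ℤ := p.lev + Nat.log 2 (p.idx j).natAbs + 1

theorem bdd_of_rootLevel {M : ℤ} {p : Cell D} (hD : 2 ≤ D) (h : ∀ j, rootLevel p j ≤ M) :
    Bdd M 1 p := by
  have h0 := h ⟨0, by omega⟩
  refine ⟨by unfold rootLevel at h0; omega, fun j => ?_⟩
  have hj := h j
  unfold rootLevel at hj
  have h1 : (p.idx j).natAbs < 2 ^ (M - p.lev).toNat :=
    (Nat.lt_pow_succ_log_self one_lt_two _).trans_le (Nat.pow_le_pow_right (by norm_num) (by omega))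
  have h2 : (((p.idx j).natAbs : ℕ) : ℤ) < 2 ^ (M - p.lev).toNat := by exact_mod_cast h1
  omega

theorem wp_initProg {n : ℕ} {pts : Fin n → Cell D} {s : State} {t K : ℕ}
    {Q : ℕ → State → Prop} (hD : 2 ≤ D) (hs : IsInput pts s) (hK : n ≤ K)
    (H : ∀ t' s' M, t' ≤ t + 200 * work D K → Env D M s' →
      s'.reg 0 = n → Tab s' 0 (List.ofFn pts) → s'.reg 50 = n * D →
      (∀ p ∈ List.ofFn pts, Bdd M 1 p) → Q t' s') :
    WP initProg s t Q := by
  obtain ⟨h0, h1, hp⟩ := hs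
  obtain ⟨N, hN⟩ : ∃ N, D = N + 1 := ⟨D - 1, by omega⟩
  have hN' : D - 1 = N := by omega
  have h1' : (D : ℤ) - 1 = N := by rw [hN]; push_cast; ring
  simp only [initProg, wp_seq, wp_set, Expr.eval]
  refine wp_forUpto n (fun i s1 => s1.mem = s.mem ∧ s1.reg 0 = n ∧ s1.reg 1 = D ∧ s1.reg 8 = i ∧
    s1.reg 50 = i * D) 20 ?_ ?_ ?_ ?_
  · simp [h0, h1]
  · rintro i s1 ⟨gm, g0, g1, g8, g50⟩
    exact ⟨g8, g0⟩
  · rintro i s1 t1 hi ⟨gm, g0, g1, g8, g50⟩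
    simp only [wp_set, Expr.eval, Expr.cost, g50, g1]
    refine ⟨by simp [g8], ⟨by simp [gm], by simp [g0], by simp [g1], by simp, ?_⟩, by omega⟩
    simp
    ring
  rintro s2 t2 ⟨gm, g0, g1, g8, g50⟩ ht2
  simp only [Expr.cost] at ht2
  have htab : ∀ s' : State, s'.mem = s.mem → s'.reg 50 = n * D → Tab s' 0 (List.ofFn pts) := by
    intro s' hm h50 i hi
    have hi' : i < n := by simpa using hi
    refine ⟨?_, ?_⟩
    · have := hp ⟨i, hi'⟩
      simpa [HoldsPoint, hm] using this
    · rw [h50, zero_add]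
      have : (i : ℤ) + 1 ≤ n := by exact_mod_cast hi'
      have h2 : ((i : ℤ) + 1) * D ≤ n * D := mul_le_mul_of_nonneg_right this (by positivity)
      rw [add_mul] at h2
      omega
  refine wp_forStep n 0 D (by omega) (fun i s1 => s1.mem = s.mem ∧ s1.reg 0 = n ∧ s1.reg 1 = D ∧
    s1.reg 8 = i * D ∧ s1.reg 50 = n * D ∧ ∀ k : Fin n, (k : ℕ) < i → ∀ j,
      rootLevel (pts k) j ≤ s1.reg 2) (60 * D) ?_ ?_ ?_ ?_
  · simp [gm, g0, g1, g50, Expr.eval]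
  · rintro i s1 ⟨k0, k1, k2, k8, k50, k3⟩
    exact ⟨by simp [k8], k2, by simp [Expr.eval, k50]⟩
  · rintro i s1 t1 hi ⟨k0, k1, k2, k8, k50, k3⟩
    have hA : At s1 (i * D) (pts ⟨i, hi⟩) := by
      have := htab s1 k0 k50 i (by simpa using hi)
      simpa using this
    have hlev : (levExpr (.reg 8)).eval s1 = (pts ⟨i, hi⟩).lev :=
      levExpr_eval (by omega) k2 (by simpa [Expr.eval, k8] using hA)
    rw [wp_seq, wp_set, hlev]
    refine wp_forUpto N (fun m s2 => s2.mem = s.mem ∧ s2.reg 0 = n ∧ s2.reg 1 = D ∧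
      s2.reg 8 = i * D ∧ s2.reg 50 = n * D ∧ s2.reg 9 = (pts ⟨i, hi⟩).lev ∧ s2.reg 10 = m ∧
      s1.reg 2 ≤ s2.reg 2 ∧ ∀ j : Fin (D - 1), (j : ℕ) < m →
        rootLevel (pts ⟨i, hi⟩) j ≤ s2.reg 2) 40 ?_ ?_ ?_ ?_
    · simp [k0, k1, k2, k8, k50]
    · rintro m s2 ⟨l0, l1, l2, l8, l50, l9, l10, l3, l4⟩
      exact ⟨l10, by simp [Expr.eval, l2, h1']⟩
    · rintro m s2 t2 hm ⟨l0, l1, l2, l8, l50, l9, l10, l3, l4⟩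
      have hmem : s2.mem (i * D + m) = (pts ⟨i, hi⟩).idx ⟨m, by omega⟩ := by
        rw [l0, ← k0]
        exact hA.1.1 ⟨m, by omega⟩
      rw [wp_seq, wp_set]
      refine wp_setIf fun t3 ht3 => ?_
      simp only [Expr.eval, Expr.cost, l9, l8, l10, hmem, State.setReg_reg, Nat.reduceEqDiff,
        if_true, if_false] at ht3 ⊢
      refine ⟨by simp, ⟨by simp [l0], by simp [l1], by simp [l2], by simp, by simp [l50],
        by simp, by simp, ?_, ?_⟩, by omega⟩
      · split_ifs <;> omega
      · intro j hj
        by_cases hjm : (j : ℕ) = m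
        · have hj' : j = ⟨m, by omega⟩ := Fin.ext hjm
          rw [hj']
          unfold rootLevel
          split_ifs <;> omega
        · have := l4 j (by omega)
          unfold rootLevel at this ⊢
          split_ifs <;> omega
    · rintro s3 t3 ⟨l0, l1, l2, l8, l50, l9, l10, l3, l4⟩ ht3
      simp only [levExpr_cost, Expr.cost] at ht3
      refine ⟨by simp [l8], by simp [Expr.eval, l2], ⟨by simp [l0], by simp [l1], by simp [l2],
        by simp, by simp [l50], ?_⟩, ?_⟩
      · intro k hk j
        simp only [State.setReg_reg, Nat.reduceEqDiff, if_false]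
        by_cases hki : (k : ℕ) = i
        · obtain rfl : k = ⟨i, hi⟩ := Fin.ext hki
          exact l4 j (by have := j.2; omega)
        · exact (k3 k (by omega) j).trans l3
      · simp only [Expr.cost]
        omega
  · rintro s3 t3 ⟨k0, k1, k2, k8, k50, k3⟩ ht3
    simp only [Expr.cost] at ht3
    refine H t3 s3 (s3.reg 2) ?_ ⟨k2, rfl⟩ k1 (htab s3 k0 k50) k50 ?_
    · have e1 := mul_le_work (D := D) (c := 60) (by omega) hK
      have e2 := mul_le_work (D := D) (c := 20) (by omega) hK
      have e3 := one_le_work (D := D) (K := K) (by omega)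
      have e4 : 20 * (n + 1) ≤ 20 * D * (n + 1) := Nat.mul_le_mul_right _ (by omega)
      rw [mul_add] at e1 e4
      omega
    · intro p hp
      obtain ⟨k, rfl⟩ := List.mem_ofFn.1 hp
      exact bdd_of_rootLevel hD fun j => k3 k k.2 j

/-- Sorts the table of cells between the addresses in the registers 4 and 5. The registers 6 and 7
receive the address and the number of the sorted pointers. -/
def sortTab : Program :=
  .set 6 (.reg 50) ;; mkPtr (.reg 4) (.reg 5) ;; .set 7 (.sub (.reg 50) (.reg 6)) ;;
  mergeSort (.reg 6) (.reg 7) ;; .set 6 (.reg 15)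

theorem wp_sortTab {s : State} {t K : ℕ} {Q : ℕ → State → Prop} {M : ℤ} {L : List (Cell D)}
    (hD : 1 ≤ D) (hs : Env D M s) (hL : Tab s (s.reg 4) L)
    (h5 : s.reg 5 = s.reg 4 + L.length * D) (hLM : ∀ p ∈ L, Bdd M 4 p) (hK : L.length ≤ K)
    (H : ∀ t' s' L', t' ≤ t + 500 * work D K → Ext 6 s s' → Arr s' (s'.reg 6) L' →
      s'.reg 7 = L'.length → L'.Perm L → SortedCells M L' → Q t' s') :
    WP sortTab s t Q := by
  simp only [sortTab, wp_seq, wp_set, Expr.eval]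
  refine wp_mkPtr (b := s.reg 4) (L := L) hD (by simpa using hs) (by simp [Expr.eval])
    (fun s' he => by simpa [Expr.eval, h5] using he.reg 5 (by norm_num)) (by simpa using hL) ?_
  intro t1 s1 ht1 he1 hA1
  have k1 : Ext 6 s s1 := Ext.trans (by simp) (he1.mono (k' := 6) (by norm_num))
  have g6 : s1.reg 6 = s.reg 50 := by simpa using he1.reg 6 (by norm_num)
  simp only [State.setReg_reg, Nat.reduceEqDiff, if_false] at hA1
  have g50 : s1.reg 50 - s1.reg 6 = L.length := by rw [hA1.2, g6]; ring
  rw [g50]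
  refine wp_mergeSort (b := s.reg 50) (L := L) hD (by simpa using hs.ext k1 (by norm_num))
    (by simp [Expr.eval, g6]) (fun s' he => by simpa [Expr.eval] using he.reg 7 (by norm_num))
    (by simpa using hA1.1) hLM ?_
  intro t2 s2 L' ht2 he2 hA2 hperm hsort
  simp only [Expr.cost] at ht1 ht2
  have g7 : s2.reg 7 = L.length := by simpa using he2.reg 7 (by norm_num)
  refine H _ _ L' ?_ ?_ ?_ ?_ hperm hsort
  · have e1 := mul_mul_log_le_work (D := D) (c := 400) hD hK hK
    have e2 := mul_le_work (D := D) (c := 21) hD hK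
    have e3 := one_le_work (D := D) (K := K) hD
    have e4 : 21 * (L.length + 1) ≤ 21 * D * (L.length + 1) := Nat.mul_le_mul_right _ (by omega)
    rw [mul_right_comm] at e1
    simp only [Expr.cost]
    omega
  · rw [ext_setReg (by norm_num) (by norm_num)]
    exact k1.trans (Ext.trans (by simp) (he2.mono (k' := 6) (by norm_num)))
  · simpa using hA2
  · simp [g7, hperm.length_eq]

/-- Appends the table of `closeList` for the array of pointers described by the registers 6 and 7.
The registers 4 and 5 receive its bounds. -/
def closeTab : Program :=
  .set 4 (.reg 50) ;; closeProg (.reg 6) (.reg 7) ;; .set 5 (.reg 50)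

theorem wp_closeTab {s : State} {t K : ℕ} {Q : ℕ → State → Prop} {M : ℤ} {L : List (Cell D)}
    (hD : 1 ≤ D) (hs : Env D M s) (hL : Arr s (s.reg 6) L) (h7 : s.reg 7 = L.length)
    (hLM : ∀ p ∈ L, Bdd M 4 p) (hK : L.length ≤ K)
    (H : ∀ t' s', t' ≤ t + 520 * work D K → Ext 4 s s' → s'.reg 6 = s.reg 6 → s'.reg 7 = s.reg 7 →
      Tab s' (s'.reg 4) (closeList M L) →
      s'.reg 5 = s'.reg 4 + (closeList M L).length * D → Q t' s') :
    WP closeTab s t Q := by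
  simp only [closeTab, wp_seq, wp_set, Expr.eval]
  refine wp_closeProg (b := s.reg 6) (L := L) hD (by simpa using hs) (by simp [Expr.eval])
    (by simp [Expr.eval, h7]) (by simpa using hL) hLM ?_
  intro t1 s1 ht1 he1 hT
  simp only [Expr.cost] at ht1
  have g4 : s1.reg 4 = s.reg 50 := by simpa using he1.reg 4 (by norm_num)
  have g6 : s1.reg 6 = s.reg 6 := by simpa using he1.reg 6 (by norm_num)
  have g7 : s1.reg 7 = s.reg 7 := by simpa using he1.reg 7 (by norm_num)
  simp only [State.setReg_reg, Nat.reduceEqDiff, if_false] at hT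
  refine H _ _ ?_ ?_ (by simp [g6]) (by simp [g7]) (by simpa [g4] using hT.1)
    (by simp [g4, hT.2])
  · have e1 := mul_le_work (D := D) (c := 500) hD hK
    have e3 := one_le_work (D := D) (K := K) hD
    simp only [Expr.cost]
    omega
  · rw [ext_setReg (by norm_num) (by norm_num)]
    exact Ext.trans (by simp) (he1.mono (k' := 4) (by norm_num))

/-- `W` contains, for each cell `u` of `U` and each cell `v` next to `u`, the cell `u` and the two
cells of `candCells` for the first cells of `A` that do not precede `u` and `v`. -/
structure IsCandList (M : ℤ) (A U W : List (Cell D)) : Prop where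
  length_le : W.length ≤ 3 * (3 ^ (D - 1) * U.length)
  mem : ∀ u v, (u, v) ∈ expandPairs U → ∀ r r' (h : r < A.length) (h' : r' < A.length),
    IsLowerBound M A u r → IsLowerBound M A v r' → ∀ w ∈ u :: candCells M A[r] A[r'], w ∈ W
  bdd : ∀ w ∈ W, Bdd M 1 w

/-- From the sorted array described by the registers 0 and 6, and its closure between the addresses
in the registers 4 and 5, computes the candidates and their neighbors. The registers 4 and 5 receive
the bounds of the result. -/
def candTab : Program :=
  .set 3 (.reg 6) ;; expandProg 0 (.reg 4) (.reg 5) ;; .set 6 (.reg 16) ;; .set 7 (.reg 17) ;;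
  expandProg 1 (.reg 4) (.reg 5) ;; .set 5 (.reg 16) ;; .set 4 (.reg 50) ;;
  candProg (.reg 3) (.reg 0) (.reg 6) (.reg 5) (.reg 7) ;; .set 5 (.reg 50) ;;
  expandProg 1 (.reg 4) (.reg 5) ;; .set 4 (.reg 16) ;; .set 5 (.reg 17)

theorem wp_candTab {s : State} {t K : ℕ} {Q : ℕ → State → Prop} {M : ℤ} {A U : List (Cell D)}
    (hD : 1 ≤ D) (hs : Env D M s) (hA : Arr s (s.reg 6) A) (h0 : s.reg 0 = A.length)
    (hAs : SortedCells M A) (hAM : ∀ p ∈ A, Bdd M 1 p)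
    (hU : Tab s (s.reg 4) U) (h5 : s.reg 5 = s.reg 4 + U.length * D) (hUM : ∀ p ∈ U, Bdd M 1 p)
    (hAK : A.length ≤ K) (hUK : 3 ^ (D - 1) * U.length ≤ K)
    (hWK : 3 ^ (D - 1) * (3 * (3 ^ (D - 1) * U.length)) ≤ K)
    (H : ∀ t' s' W, t' ≤ t + 3000 * work D K → Env D M s' → IsCandList M A U W →
      Tab s' (s'.reg 4) (expand 1 W) →
      s'.reg 5 = s'.reg 4 + (expand 1 W).length * D → Q t' s') :
    WP candTab s t Q := by
  have c1 := mul_mul_le_work (D := D) (c := 400) hUK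
  have c2 := mul_mul_log_le_work (D := D) (c := 1100) hD hAK hUK
  have c3 := one_le_work (D := D) (K := K) hD
  simp only [candTab, wp_seq, wp_set, Expr.eval]
  refine wp_expandProg (b := s.reg 4) (L := U) hD (by simpa using hs) (by simp [Expr.eval])
    (by simp [Expr.eval, h5]) (by simpa using hU) ?_
  intro t1 s1 ht1 he1 hT1 h17
  have k1 : Ext 3 s s1 := Ext.trans (by simp) (he1.mono (k' := 3) (by norm_num))
  have f3 : s1.reg 3 = s.reg 6 := by simpa using he1.reg 3 (by norm_num)
  have f4 : s1.reg 4 = s.reg 4 := by simpa using he1.reg 4 (by norm_num)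
  have f5 : s1.reg 5 = s.reg 5 := by simpa using he1.reg 5 (by norm_num)
  simp only [State.setReg_reg, Nat.reduceEqDiff, if_false]
  refine wp_expandProg (b := s.reg 4) (L := U) hD (by simpa using hs.ext k1 (by norm_num))
    (by simp [Expr.eval, f4]) (by simp [Expr.eval, h5, f5]) (by simpa using hU.ext k1) ?_
  intro t2 s2 ht2 he2 hT2 h17'
  have k12 : Ext 6 s1 s2 := Ext.trans (by simp) (he2.mono (k' := 6) (by norm_num))
  have k2 : Ext 3 s s2 := k1.trans (k12.mono (by norm_num))
  have g3 : s2.reg 3 = s.reg 6 := (k12.reg 3 (by norm_num)).trans f3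
  have g6 : s2.reg 6 = s1.reg 16 := by simpa using he2.reg 6 (by norm_num)
  have g7 : s2.reg 7 = s1.reg 17 := by simpa using he2.reg 7 (by norm_num)
  have g0 : s2.reg 0 = A.length := (k2.reg 0 (by norm_num)).trans h0
  have hlen : (expand 0 U).length = (expandPairs U).length := by
    rw [length_expand, length_expandPairs]
  refine wp_candProg (b := s.reg 6) (A := A) (Z := expandPairs U) (x := s1.reg 16)
    (y := s2.reg 16) hD (by simpa using hs.ext k2 (by norm_num))
    (by simp [Expr.eval, g3]) (fun s' he => by simpa [Expr.eval, g0] using he.reg 0 (by norm_num))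
    (fun s' he => by simpa [Expr.eval, g6] using he.reg 6 (by norm_num))
    (fun s' he => by simpa [Expr.eval] using he.reg 5 (by norm_num))
    (fun s' he => by simpa [Expr.eval, g7, h17, hlen] using he.reg 7 (by norm_num))
    (by simpa using hA.ext k2) hAs (fun p hp => (hAM p hp).mono (by norm_num))
    (pairTab_expandPairs (by simpa using hT1.ext k12) (by simpa using hT2))
    (fun uv huv => ⟨(bdd_expandPairs hUM uv huv).1.mono (by norm_num),
      (bdd_expandPairs hUM uv huv).2.mono (by norm_num)⟩) ?_
  intro t3 s3 W ht3 he3 hW hWl hW1 hW2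
  have k3 : Ext 3 s s3 := k2.trans (Ext.trans (by simp) (he3.mono (k' := 3) (by norm_num)))
  have e4 : s3.reg 4 = s2.reg 50 := by simpa using he3.reg 4 (by norm_num)
  simp only [State.setReg_reg, Nat.reduceEqDiff, if_false] at hW
  rw [length_expandPairs] at hWl ht3
  refine wp_expandProg (b := s2.reg 50) (L := W) hD (by simpa using hs.ext k3 (by norm_num))
    (by simp [Expr.eval, e4]) (by simp [Expr.eval, hW.2]) (by simpa using hW.1) ?_
  intro t4 s4 ht4 he4 hT4 h17''
  have k4 : Ext 3 s s4 := k3.trans (Ext.trans (by simp) (he4.mono (k' := 3) (by norm_num)))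
  have c4 := mul_mul_le_work (D := D) (c := 400)
    ((Nat.mul_le_mul_left (3 ^ (D - 1)) hWl).trans hWK)
  simp only [Expr.cost] at ht1 ht2 ht3 ht4
  refine H _ _ W ?_ (by simpa using hs.ext k4 (by norm_num)) ⟨hWl, ?_, ?_⟩ (by simpa using hT4)
    (by simp [h17''])
  · simp only [Expr.cost]
    omega
  · exact fun u v huv => hW1 (u, v) huv
  · intro w hw
    rcases hW2 w hw with ⟨uv, huv, rfl⟩ | ⟨p, hp, q, hq, hw⟩
    · exact (bdd_expandPairs hUM uv huv).1
    · exact bdd_candCells (hAM p hp) w hw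

/-- From the sorted array described by the registers 6 and 7, computes the table of its different
cells, and a table of pointers. The registers 3 and 4 receive the addresses of the two tables, and
register 0 the number of cells. -/
def vertexTab : Program :=
  .set 3 (.reg 50) ;; dedupProg (.reg 6) (.reg 7) ;; .set 4 (.reg 50) ;;
  mkPtr (.reg 3) (.reg 4) ;; .set 0 (.sub (.reg 50) (.reg 4))

theorem wp_vertexTab {s : State} {t K : ℕ} {Q : ℕ → State → Prop} {M : ℤ} {C : List (Cell D)}
    (hD : 1 ≤ D) (hs : Env D M s) (hC : Arr s (s.reg 6) C) (h7 : s.reg 7 = C.length)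
    (hCs : SortedCells M C) (hCM : ∀ p ∈ C, Bdd M 4 p) (hCK : C.length ≤ K)
    (H : ∀ t' s' V, t' ≤ t + 400 * work D K → Env D M s' → StrictSorted M V →
      (∀ x, x ∈ V ↔ x ∈ C) → Tab s' (s'.reg 3) V → Arr s' (s'.reg 4) V →
      s'.reg 4 = s'.reg 3 + V.length * D → s'.reg 0 = V.length → Q t' s') :
    WP vertexTab s t Q := by
  simp only [vertexTab, wp_seq, wp_set, Expr.eval]
  refine wp_dedupProg (b := s.reg 6) (L := C) hD (by simpa using hs) (by simp [Expr.eval])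
    (by simp [Expr.eval, h7]) (by simpa using hC) hCs hCM ?_
  intro t1 s1 V ht1 he1 hV hVs hVm
  simp only [State.setReg_reg, Nat.reduceEqDiff, if_false] at hV
  have f3 : s1.reg 3 = s.reg 50 := by simpa using he1.reg 3 (by norm_num)
  have k1 : Ext 3 s s1 := Ext.trans (by simp) (he1.mono (k' := 3) (by norm_num))
  refine wp_mkPtr (b := s.reg 50) (L := V) hD (by simpa using hs.ext k1 (by norm_num))
    (by simp [Expr.eval, f3]) (fun s' he => by simpa [Expr.eval, hV.2] using he.reg 4 (by norm_num))
    (by simpa using hV.1) ?_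
  intro t2 s2 ht2 he2 hA2
  have g3 : s2.reg 3 = s.reg 50 := by simpa [f3] using he2.reg 3 (by norm_num)
  have g4 : s2.reg 4 = s1.reg 50 := by simpa using he2.reg 4 (by norm_num)
  have k12 : Ext 3 s1 s2 := Ext.trans (by simp) (he2.mono (k' := 3) (by norm_num))
  have hs2 := hs.ext (k1.trans k12) (by norm_num)
  simp only [State.setReg_reg, Nat.reduceEqDiff, if_false] at hA2
  have hVC : V.length ≤ C.length := by
    have hnd : V.Nodup := List.Pairwise.imp (fun {a b} h hab => by
      rw [hab] at h; exact lt_irrefl _ h) hVs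
    exact (List.subperm_of_subset hnd fun x hx => (hVm x).1 hx).length_le
  simp only [Expr.cost] at ht1 ht2
  refine H _ _ V ?_ ⟨by simpa using hs2.1, by simpa using hs2.2⟩ hVs hVm
    (by simpa [g3] using hV.1.ext k12) (by simpa [g4] using hA2.1) (by simp [g3, g4, hV.2])
    (by simp [hA2.2, g4])
  have c1 := mul_le_work (D := D) (c := 300) hD hCK
  have c2 := mul_le_work (D := D) (c := 21) hD (hVC.trans hCK)
  have c3 := one_le_work (D := D) (K := K) hD
  have e4 : 21 * (V.length + 1) ≤ 21 * D * (V.length + 1) := Nat.mul_le_mul_right _ (by omega)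
  simp only [Expr.cost]
  omega

/-- The edges of the spanner: from each cell of `V` up to the next cell of `V` above it, and between
horizontal neighbors. -/
noncomputable def edgeList (M : ℤ) (V : List (Cell D)) : List (Cell D × Cell D) :=
  edgePairs M V (closePairs M V) ++ edgePairs M V (expandPairs V)

/-- From the tables computed by `vertexTab`, computes the table of the edges and the output
registers. -/
def edgeTab : Program :=
  expandProg 0 (.reg 3) (.reg 4) ;; .set 5 (.reg 16) ;; .set 6 (.reg 17) ;;
  expandProg 1 (.reg 3) (.reg 4) ;; .set 7 (.reg 16) ;;
  push (.reg 3) ;; push (.reg 7) ;; .set 3 (.sub (.reg 50) (.lit 2)) ;;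
  closeProg (.reg 4) (.reg 0) ;; .set 7 (.reg 50) ;;
  edgesProg (.reg 4) (.reg 0) (.add (.add (.reg 3) (.lit 2)) (.reg 1)) (.add (.reg 3) (.lit 2))
    (.add (.add (.reg 1) (.reg 1)) (.add (.reg 1) (.reg 1))) (.add (.reg 7) (.reg 1)) ;;
  edgesProg (.reg 4) (.reg 0) (.reg 5) (.mem (.add (.reg 3) (.lit 1))) (.reg 1) (.reg 6) ;;
  .set 8 (.lit 0) ;;
  .forStep 9 (.reg 7) (.lit 3) (.reg 50) (.set 8 (.add (.reg 8) (.lit 1))) ;;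
  .set 1 (.reg 8) ;; .set 2 (.mem (.reg 3)) ;; .set 3 (.reg 7)

theorem wp_edgeTab {s : State} {t K : ℕ} {Q : ℕ → State → Prop} {M : ℤ} {V : List (Cell D)}
    (hD : 1 ≤ D) (hs : Env D M s) (hVs : StrictSorted M V) (hVM : ∀ p ∈ V, Bdd M 2 p)
    (hT : Tab s (s.reg 3) V) (hA : Arr s (s.reg 4) V) (h4 : s.reg 4 = s.reg 3 + V.length * D)
    (h0 : s.reg 0 = V.length) (hK : 3 ^ (D - 1) * V.length ≤ K)
    (H : ∀ t' s', t' ≤ t + 5000 * work D K → Tab s' (s'.reg 2) V →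
      OpenEdges s' (s'.reg 3) V (edgeList M V) → s'.reg 0 = V.length →
      s'.reg 1 = (edgeList M V).length → (edgeList M V).length ≤ 2 * K → Q t' s') :
    WP edgeTab s t Q := by
  have hVK : V.length ≤ K := (Nat.le_mul_of_pos_left _ (by positivity)).trans hK
  have c1 := mul_mul_le_work (D := D) (c := 400) hK
  have c2 := mul_mul_log_le_work (D := D) (c := 1100) hD hVK hK
  have c2' := mul_mul_log_le_work (D := D) (c := 1100) hD hVK hVK
  have c3 := one_le_work (D := D) (K := K) hD
  have c4 := mul_le_work (D := D) (c := 500) hD hVK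
  have hVM4 : ∀ p ∈ V, Bdd M 4 p := fun p hp => (hVM p hp).mono (by norm_num)
  simp only [edgeTab, wp_seq]
  refine wp_expandProg (b := s.reg 3) (L := V) hD hs rfl (by simp [Expr.eval, h4]) hT ?_
  intro t1 s1 ht1 he1 hT1 h17
  have f3 := he1.reg 3 (by norm_num)
  have f4 := he1.reg 4 (by norm_num)
  rw [wp_set, wp_set]
  refine wp_expandProg (b := s.reg 3) (L := V) hD (by simpa using hs.ext he1 (by norm_num))
    (by simp [Expr.eval, f3]) (by simp [Expr.eval, f4, h4]) (by simpa using hT.ext he1) ?_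
  intro t2 s2 ht2 he2 hT2 _
  have k12 : Ext 5 s1 s2 := Ext.trans (by simp) (he2.mono (k' := 5) (by norm_num))
  have k2 : Ext 5 s s2 := (he1.mono (by norm_num)).trans k12
  have g5 : s2.reg 5 = s1.reg 16 := by simpa [Expr.eval] using he2.reg 5 (by norm_num)
  have g6 : s2.reg 6 = s1.reg 17 := by simpa [Expr.eval] using he2.reg 6 (by norm_num)
  have g3 := k2.reg 3 (by norm_num)
  have g4 := k2.reg 4 (by norm_num)
  rw [wp_set, wp_push, wp_push, wp_set]
  simp only [Expr.eval, State.setReg_reg, State.pushed_reg, Nat.reduceEqDiff, if_true, if_false]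
  set s3 := (((s2.setReg 7 (s2.reg 16)).pushed (s2.reg 3)).pushed (s2.reg 16)).setReg 3
    (s2.reg 50 + 1 + 1 - 2) with hs3def
  have k23 : Ext 3 s2 s3 := by
    rw [hs3def, ext_setReg (by norm_num) (by norm_num)]
    refine Ext.pushed (Ext.pushed ?_ _ (by norm_num)) _ (by norm_num)
    simp
  have i3 : s3.reg 3 = s2.reg 50 := by simp [hs3def]; ring
  have i4 : s3.reg 4 = s.reg 4 := by simp [hs3def, g4]
  have i5 : s3.reg 5 = s1.reg 16 := by simp [hs3def, g5]
  have i6 : s3.reg 6 = s1.reg 17 := by simp [hs3def, g6]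
  have i0 : s3.reg 0 = V.length := (k23.reg 0 (by norm_num)).trans ((k2.reg 0 (by norm_num)).trans h0)
  have i50 : s3.reg 50 = s2.reg 50 + 2 := by simp [hs3def]; ring
  have m0 : s3.mem (s2.reg 50) = s.reg 3 := by
    simp [hs3def, State.pushed_mem, g3]
  have m1 : s3.mem (s2.reg 50 + 1) = s2.reg 16 := by
    simp [hs3def, State.pushed_mem]
  have k3 : Ext 3 s s3 := (k2.mono (by norm_num)).trans k23
  clear_value s3
  refine wp_closeProg (b := s.reg 4) (L := V) hD (hs.ext k3 (by norm_num)) i4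
    (by simp [Expr.eval, i0]) (hA.ext k3) hVM4 ?_
  intro t4 s4 ht4 he4 hT4
  have k4 : Ext 3 s s4 := k3.trans (he4.mono (by norm_num))
  rw [wp_set]
  simp only [Expr.eval]
  set s5 := s4.setReg 7 (s4.reg 50) with hs5def
  have k35 : Ext 7 s3 s5 := by
    rw [hs5def, ext_setReg (by norm_num) (by norm_num)]
    exact he4.mono (by norm_num)
  have k5 : Ext 3 s s5 := k3.trans (k35.mono (by norm_num))
  have hs5 := hs.ext k5 (by norm_num)
  have j3 := (k35.reg 3 (by norm_num)).trans i3
  have j4 := (k35.reg 4 (by norm_num)).trans i4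
  have j5 := (k35.reg 5 (by norm_num)).trans i5
  have j6 := (k35.reg 6 (by norm_num)).trans i6
  have j0 := (k35.reg 0 (by norm_num)).trans i0
  have j7 : s5.reg 7 = s4.reg 50 := by simp [hs5def]
  have j50 : s5.reg 50 = s4.reg 50 := by simp [hs5def]
  have n0 : s5.mem (s2.reg 50) = s.reg 3 := (k35.mem _ (by omega)).trans m0
  have n1 : s5.mem (s2.reg 50 + 1) = s2.reg 16 := (k35.mem _ (by omega)).trans m1
  have hT5 : Tab s5 (s2.reg 50 + 2) (closeList M V) := by
    rw [i50] at hT4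
    simpa [hs5def] using hT4.1
  have h7' : s5.reg 7 = s2.reg 50 + 2 + V.length * (4 * D) := by
    rw [j7, hT4.2, i50, length_closeList]
    push_cast
    ring
  clear_value s5
  have hN : (closePairs M V).length = V.length := length_closePairs M V
  have reg8 : ∀ {s' : State} {r : ℕ}, Ext 8 s5 s' → r < 8 → s'.reg r = s5.reg r :=
    fun he hr => he.reg _ hr
  refine wp_edgesProg (b := s.reg 4) (x := s2.reg 50 + 2 + D) (y := s2.reg 50 + 2) (d := 4 * D)
    (ob := s4.reg 50) (V := V) (Z := closePairs M V) (E := []) hD (by omega) hs5 j4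
    (fun s' he => (reg8 he (by norm_num)).trans j0)
    (fun s' he => by
      simp only [Expr.eval, reg8 he (show 3 < 8 by norm_num), reg8 he (show 1 < 8 by norm_num), j3,
        hs5.1])
    (fun s' he => by simp only [Expr.eval, reg8 he (show 3 < 8 by norm_num), j3])
    (fun s' he => by
      simp only [Expr.eval, reg8 he (show 1 < 8 by norm_num), hs5.1]; push_cast; ring)
    (fun s' he => by
      simp only [Expr.eval, reg8 he (show 7 < 8 by norm_num), reg8 he (show 1 < 8 by norm_num), h7',
        hs5.1, hN]; push_cast; ring)
    (hA.ext k5) hVs hVM4 (pairTab_closePairs hT5) (bdd_closePairs hVM4) (openEdges_nil j50) ?_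
  intro t6 s6 ht6 he6 hE6
  have k6 : Ext 3 s s6 := k5.trans (he6.mono (by norm_num))
  have hs6 := hs.ext k6 (by norm_num)
  have top5 : s2.reg 50 + 2 ≤ s5.reg 50 := by
    have := k35.top
    omega
  have reg8' : ∀ {s' : State} {r : ℕ}, Ext 8 s6 s' → r < 8 → s'.reg r = s5.reg r :=
    fun he hr => (he.reg _ hr).trans (he6.reg _ hr)
  have top6 := he6.top
  refine wp_edgesProg (b := s.reg 4) (x := s1.reg 16) (y := s2.reg 16) (d := D)
    (ob := s4.reg 50) (V := V) (Z := expandPairs V) (E := [] ++ edgePairs M V (closePairs M V)) hD hD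
    hs6 ((reg8 he6 (by norm_num)).trans j4)
    (fun s' he => (reg8' he (by norm_num)).trans j0)
    (fun s' he => (reg8' he (by norm_num)).trans j5)
    (fun s' he => by
      simp only [Expr.eval, reg8' he (show 3 < 8 by norm_num), j3]
      rw [he.mem _ (by omega), he6.mem _ (by omega), n1])
    (fun s' he => (reg8' he (by norm_num)).trans hs5.1)
    (fun s' he => by
      simp only [Expr.eval, reg8' he (show 6 < 8 by norm_num), j6, h17, length_expandPairs,
        length_expand])
    (hA.ext k6) hVs hVM4
    (pairTab_expandPairs (((hT1.ext k12).ext k23).ext (k35.trans (he6.mono (by norm_num))))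
      ((hT2.ext k23).ext (k35.trans (he6.mono (by norm_num)))))
    (fun uv huv => ⟨(bdd_expandPairs hVM uv huv).1.mono (by norm_num),
      (bdd_expandPairs hVM uv huv).2.mono (by norm_num)⟩) hE6 ?_
  intro t7 s7 ht7 he7 hE7
  rw [List.nil_append, ← edgeList] at hE7
  have k7 : Ext 3 s s7 := k6.trans (he7.mono (by norm_num))
  have l7 : s7.reg 7 = s4.reg 50 := (reg8' he7 (by norm_num)).trans j7
  have l3 : s7.reg 3 = s2.reg 50 := (reg8' he7 (by norm_num)).trans j3
  have l0 : s7.reg 0 = V.length := (reg8' he7 (by norm_num)).trans j0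
  have o0 : s7.mem (s2.reg 50) = s.reg 3 := by
    rw [he7.mem _ (by omega), he6.mem _ (by omega), n0]
  have hlen : (edgeList M V).length ≤ 2 * K := by
    have h1 : (edgePairs M V (closePairs M V)).length ≤ (closePairs M V).length :=
      List.length_filter_le _ _
    have h2 : (edgePairs M V (expandPairs V)).length ≤ (expandPairs V).length :=
      List.length_filter_le _ _
    rw [length_expandPairs] at h2
    rw [edgeList, List.length_append]
    omega
  rw [hN] at ht6
  rw [length_expandPairs] at ht7
  rw [wp_set]
  refine wp_forStep (edgeList M V).length (s4.reg 50) 3 (by norm_num) (fun i s8 => Ext 8 s7 s8 ∧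
    s8.reg 50 = s7.reg 50 ∧ s8.reg 8 = i ∧ s8.reg 9 = s4.reg 50 + i * 3) 20 ?_ ?_ ?_ ?_
  · simp [Expr.eval, l7]
  · rintro i s8 ⟨p1, p2, p3, p4⟩
    refine ⟨p4, rfl, ?_⟩
    simp only [Expr.eval, p2, hE7.1]
    ring
  · rintro i s8 t8 hi ⟨p1, p2, p3, p4⟩
    rw [wp_set]
    refine ⟨by simp [p4], rfl, ⟨by simpa using p1, by simp [p2], by simp [Expr.eval, p3], by simp⟩,
      ?_⟩
    simp only [Expr.cost]
    omega
  · rintro s8 t8 ⟨p1, p2, p3, p4⟩ ht8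
    simp only [wp_set, Expr.eval, State.setReg_reg, State.setReg_mem, Nat.reduceEqDiff, if_false]
    have q3 : s8.reg 3 = s2.reg 50 := (p1.reg 3 (by norm_num)).trans l3
    have q7 : s8.reg 7 = s4.reg 50 := (p1.reg 7 (by norm_num)).trans l7
    have q0 : s8.reg 0 = V.length := (p1.reg 0 (by norm_num)).trans l0
    have r0 : s8.mem (s2.reg 50) = s.reg 3 := by
      rw [p1.mem _ (by have := he7.top; omega), o0]
    refine H _ _ ?_ ?_ ?_ (by simp [q0]) (by simp [p3]) hlen
    · have c5 : K + 1 ≤ work D K := by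
        have := mul_le_work (D := D) (c := 1) hD (le_refl K)
        have h1 : 1 * (K + 1) ≤ 1 * D * (K + 1) := Nat.mul_le_mul_right _ (by omega)
        omega
      simp only [Expr.cost] at ht1 ht2 ht4 ht6 ht7 ht8 ⊢
      omega
    · simpa [q3, r0] using (hT.ext k7).ext p1
    · simpa [q7] using hE7.ext p1 p2

/-- The list `V` of the vertices of the spanner of the cells in `P`: in the sorted list `A` of these
cells and its closure, candidates `W` are determined; `V` is the sorted closure of the sorted list
`B` of the candidates and their horizontal neighbors. -/
def IsVertexList (M : ℤ) (P V : List (Cell D)) : Prop :=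
  ∃ A W B, A.Perm P ∧ SortedCells M A ∧ IsCandList M A (closeList M A) W ∧
    B.Perm (expand 1 W) ∧ SortedCells M B ∧ StrictSorted M V ∧ ∀ x, x ∈ V ↔ x ∈ closeList M B

theorem StrictSorted.nodup {M : ℤ} {V : List (Cell D)} (h : StrictSorted M V) : V.Nodup :=
  List.Pairwise.imp (fun {a b} h hab => by rw [hab] at h; exact lt_irrefl _ h) h

theorem IsVertexList.length_le {M : ℤ} {P V : List (Cell D)} (h : IsVertexList M P V) :
    3 ^ (D - 1) * V.length ≤ 48 * 27 ^ (D - 1) * P.length := by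
  obtain ⟨A, W, B, hA, -, hW, hB, -, hV, hVm⟩ := h
  have h1 : V.length ≤ (closeList M B).length :=
    (List.subperm_of_subset hV.nodup fun x hx => (hVm x).1 hx).length_le
  have h2 := hW.length_le
  rw [length_closeList, hA.length_eq] at h2
  rw [length_closeList, hB.length_eq, length_expand] at h1
  calc 3 ^ (D - 1) * V.length
      ≤ 3 ^ (D - 1) * (4 * (3 ^ (D - 1) * (3 * (3 ^ (D - 1) * (4 * P.length))))) := by
        gcongr
        exact h1.trans (by gcongr)
    _ = 48 * (3 * 3 * 3) ^ (D - 1) * P.length := by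
        rw [mul_pow, mul_pow]
        ring
    _ = 48 * 27 ^ (D - 1) * P.length := by norm_num

/-- The algorithm. -/
def spannerProg : Program :=
  initProg ;; .set 4 (.lit 0) ;; .set 5 (.reg 50) ;; sortTab ;; closeTab ;; candTab ;;
  sortTab ;; closeTab ;; sortTab ;; vertexTab ;; edgeTab

theorem wp_spannerProg {n : ℕ} {pts : Fin n → Cell D} {s : State} {t : ℕ}
    {Q : ℕ → State → Prop} (hD : 2 ≤ D) (hs : IsInput pts s)
    (H : ∀ t' s' M V, t' ≤ t + 20000 * work D (48 * 27 ^ (D - 1) * n) →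
      (∀ p ∈ List.ofFn pts, Bdd M 1 p) → (∀ p ∈ V, Bdd M 2 p) →
      IsVertexList M (List.ofFn pts) V → Tab s' (s'.reg 2) V →
      OpenEdges s' (s'.reg 3) V (edgeList M V) → s'.reg 0 = V.length →
      s'.reg 1 = (edgeList M V).length → (edgeList M V).length ≤ 2 * (48 * 27 ^ (D - 1) * n) →
      Q t' s') :
    WP spannerProg s t Q := by
  have hD1 : 1 ≤ D := by omega
  have h27 : 48 * 27 ^ (D - 1) * n = 3 ^ (D - 1) * (4 * (3 ^ (D - 1) * (3 * (3 ^ (D - 1) *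
      (4 * n))))) := by
    rw [show (27 : ℕ) = 3 * 3 * 3 by norm_num, mul_pow, mul_pow]
    ring
  have h3 : 1 ≤ 3 ^ (D - 1) := Nat.one_le_pow _ _ (by norm_num)
  have hle : ∀ m : ℕ, m ≤ 3 ^ (D - 1) * m := fun m => Nat.le_mul_of_pos_left _ h3
  set K := 48 * 27 ^ (D - 1) * n with hK
  -- the lengths of the lists that occur, from the largest to the smallest
  have l1 : 4 * (3 ^ (D - 1) * (3 * (3 ^ (D - 1) * (4 * n)))) ≤ K := h27 ▸ hle _
  have l2 : 3 ^ (D - 1) * (3 * (3 ^ (D - 1) * (4 * n))) ≤ K := by omega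
  have l3 : 3 ^ (D - 1) * (4 * n) ≤ K := by
    have := hle (3 * (3 ^ (D - 1) * (4 * n)))
    omega
  have l4 : n ≤ K := by
    have := hle (4 * n)
    omega
  have hw := one_le_work (D := D) (K := K) hD1
  simp only [spannerProg, wp_seq]
  refine wp_initProg hD hs l4 ?_
  intro t1 s1 M ht1 hs1 h0 hT1 h50 hPM
  have hlen : (List.ofFn pts).length = n := List.length_ofFn
  rw [wp_set, wp_set]
  refine wp_sortTab (M := M) (K := K) (L := List.ofFn pts) hD1 (by simpa using hs1)
    (by simpa [Expr.eval] using hT1) (by simp [Expr.eval, h50])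
    (fun p hp => (hPM p hp).mono (by norm_num)) (by omega) ?_
  intro t2 s2 A ht2 he2 hA2 h7 hAP hAs
  have hs2 : Env D M s2 := Env.ext (by simpa using hs1) he2 (by norm_num)
  have hAM : ∀ p ∈ A, Bdd M 1 p := fun p hp => hPM p (hAP.mem_iff.1 hp)
  have hAn : A.length = n := hAP.length_eq.trans hlen
  have g0 : s2.reg 0 = n := by simpa [h0] using he2.reg 0 (by norm_num)
  refine wp_closeTab (M := M) (K := K) (L := A) hD1 hs2 hA2 h7
    (fun p hp => (hAM p hp).mono (by norm_num)) (by omega) ?_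
  intro t3 s3 ht3 he3 h36 h37 hU3 h35
  have hs3 := hs2.ext he3 (by norm_num)
  refine wp_candTab (M := M) (K := K) (A := A) (U := closeList M A) hD1 hs3
    (h36 ▸ hA2.ext he3) (by rw [he3.reg 0 (by norm_num), g0, hAn]) hAs hAM hU3 h35
    (bdd_closeList hAM) (by omega) (by rw [length_closeList, hAn]; exact l3)
    (by rw [length_closeList, hAn]; exact l2) ?_
  intro t4 s4 W ht4 hs4 hW hT4 h45
  have hWM := hW.bdd
  have hBl : (expand 1 W).length ≤ 3 ^ (D - 1) * (3 * (3 ^ (D - 1) * (4 * n))) := by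
    rw [length_expand]
    refine Nat.mul_le_mul_left _ ?_
    have := hW.length_le
    rwa [length_closeList, hAn] at this
  have hVM0 := bdd_expand_one hWM
  refine wp_sortTab (M := M) (K := K) (L := expand 1 W) hD1 hs4 hT4 h45
    (fun p hp => (hVM0 p hp).mono (by norm_num)) (by omega) ?_
  intro t5 s5 B ht5 he5 hB5 h57 hBP hBs
  have hs5 := hs4.ext he5 (by norm_num)
  have hBM : ∀ p ∈ B, Bdd M 2 p := fun p hp => hVM0 p (hBP.mem_iff.1 hp)
  have hBl' := hBP.length_eq
  refine wp_closeTab (M := M) (K := K) (L := B) hD1 hs5 hB5 h57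
    (fun p hp => (hBM p hp).mono (by norm_num)) (by omega) ?_
  intro t6 s6 ht6 he6 _ _ hC6 h65
  have hs6 := hs5.ext he6 (by norm_num)
  have hCM := bdd_closeList (M := M) hBM
  have hCl := length_closeList M B
  refine wp_sortTab (M := M) (K := K) (L := closeList M B) hD1 hs6 hC6 h65
    (fun p hp => (hCM p hp).mono (by norm_num)) (by omega) ?_
  intro t7 s7 C ht7 he7 hC7 h77 hCP hCs
  have hs7 := hs6.ext he7 (by norm_num)
  refine wp_vertexTab (M := M) (K := K) (C := C) hD1 hs7 hC7 h77 hCs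
    (fun p hp => (hCM p (hCP.mem_iff.1 hp)).mono (by norm_num))
    (by have := hCP.length_eq; omega) ?_
  intro t8 s8 V ht8 hs8 hVs hVm hT8 hA8 h84 h80
  have hVC : ∀ x, x ∈ V ↔ x ∈ closeList M B := fun x => (hVm x).trans hCP.mem_iff
  have hVM : ∀ p ∈ V, Bdd M 2 p := fun p hp => hCM p ((hVC p).1 hp)
  have hV : IsVertexList M (List.ofFn pts) V :=
    ⟨A, W, B, hAP, hAs, hW, hBP, hBs, hVs, hVC⟩
  have hVK := hV.length_le
  rw [hlen, ← hK] at hVK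
  refine wp_edgeTab (M := M) (K := K) hD1 hs8 hVs hVM hT8 hA8 h84 h80 hVK ?_
  intro t9 s9 ht9 hT9 hE9 h90 h91 hEl
  refine H t9 s9 M V ?_ hPM hVM hV hT9 hE9 h90 h91 hEl
  simp only [Expr.cost] at ht2
  omega

/-! ### Branching cells -/

theorem exists_isSplit {R : ℤ} {p q : Cell D} (hp : p.lev ≤ R) (hq : q.lev ≤ R) :
    ∃ m, IsSplit R p q m := by
  obtain ⟨m, ⟨hm1, hm2⟩, hm3⟩ := Int.exists_greatest_of_bdd
    (P := fun m => m ≤ R ∧ (m = max p.lev q.lev - 1 ∨ max p.lev q.lev ≤ m ∧ p.up m ≠ q.up m))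
    ⟨R, fun z hz => hz.1⟩ ⟨max p.lev q.lev - 1, by omega, Or.inl rfl⟩
  refine ⟨m, by omega, by omega, hm1, fun i hi hiR => ?_, fun h1 h2 => ?_⟩
  · by_contra hne
    have := hm3 i ⟨hiR, Or.inr ⟨by omega, hne⟩⟩
    omega
  · rcases hm2 with h | h
    · omega
    · exact h.2

theorem exists_isLowerBound {M : ℤ} {L : List (Cell D)} (hL : SortedCells M L) (x : Cell D) :
    ∃ r, IsLowerBound M L x r := by
  classical
  have hex : ∃ r, r = L.length ∨ ∃ h : r < L.length, key (M + 2) x ≤ key (M + 2) L[r] :=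
    ⟨_, Or.inl rfl⟩
  have hmin := fun i => Nat.find_min hex (m := i)
  refine ⟨Nat.find hex, Nat.find_min' hex (Or.inl rfl), fun i hi hlt => ?_, fun i hi hle => ?_⟩
  · have := hmin i hlt
    by_contra hc
    exact this (Or.inr ⟨hi, not_lt.1 hc⟩)
  · rcases Nat.find_spec hex with h | ⟨h, h'⟩
    · omega
    · exact h'.trans (hL.key_le hle hi)

/-- A property that holds at one of two positions and not at the other one changes between two
consecutive positions. -/
theorem exists_change {P : ℕ → Prop} {i j : ℕ} (hij : i ≤ j) (h : ¬ (P i ↔ P j)) :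
    ∃ k, i < k ∧ k ≤ j ∧ ¬ (P (k - 1) ↔ P k) := by
  induction j, hij using Nat.le_induction with
  | base => exact absurd Iff.rfl h
  | succ j hij ih =>
    by_cases hj : P i ↔ P j
    · exact ⟨j + 1, by omega, le_rfl, fun hc => h (hj.trans hc)⟩
    · obtain ⟨k, h1, h2, h3⟩ := ih hj
      exact ⟨k, h1, by omega, h3⟩

theorem closeBlock_subset_closeList {M : ℤ} {L : List (Cell D)} {k : ℕ} (hk : k < L.length) :
    closeBlock M (L[k - 1], L[k]) ⊆ closeList M L := by
  intro x hx
  refine List.mem_flatMap.2 ⟨_, ?_, hx⟩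
  rw [prevPairs, List.mem_ofFn]
  exact ⟨⟨k, hk⟩, rfl⟩

theorem subset_closeList {M : ℤ} {L : List (Cell D)} : L ⊆ closeList M L := by
  intro x hx
  obtain ⟨k, hk, rfl⟩ := List.mem_iff_getElem.1 hx
  exact closeBlock_subset_closeList hk (by simp [closeBlock])

/-- Each cell of the closure lies above a cell of the list. -/
theorem exists_isAnc_of_mem_closeList {M : ℤ} {L : List (Cell D)} {x : Cell D}
    (hx : x ∈ closeList M L) : ∃ p ∈ L, IsAnc x p := by
  obtain ⟨⟨p, q⟩, hpq, hx⟩ := List.mem_flatMap.1 hx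
  rw [prevPairs, List.mem_ofFn] at hpq
  obtain ⟨i, hi⟩ := hpq
  rw [Prod.mk.injEq] at hi
  have hp : p ∈ L := hi.1 ▸ List.getElem_mem _
  have hq : q ∈ L := hi.2 ▸ List.getElem_mem _
  simp only [closeBlock, List.mem_cons, List.not_mem_nil, or_false] at hx
  rcases hx with rfl | rfl | rfl | rfl
  · exact ⟨_, hq, isAnc_refl _⟩
  · exact ⟨_, hq, isAnc_up⟩
  · exact ⟨_, hp, isAnc_up⟩
  · exact ⟨_, hq, isAnc_up⟩

/-- If `p` and `p'` split at the level `m`, then the closure contains the ancestor of `p` at the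
level `m`, and the lowest cell above `p` and `p'`: on the way from `p` to `p'` in the sorted list,
there is a step out of the subtree of the former, and the two cells of this step split at `m`,
too. -/
theorem up_split_mem_closeList {M : ℤ} {L : List (Cell D)} (hL : SortedCells M L)
    (hLM : ∀ p ∈ L, p.lev ≤ M) {p p' : Cell D} (hp : p ∈ L) (hp' : p' ∈ L) {m : ℤ}
    (hm : IsSplit (M + 2) p p' m) (hpm : p.lev ≤ m) :
    p.up (min m M) ∈ closeList M L ∧ (m < M → p.up (m + 1) ∈ closeList M L) := by
  have hpM := hLM p hp
  have hpM' := hLM p' hp'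
  set c := p.up (min m M) with hc
  have hcl : c.lev = min m M := by rw [hc, up_lev]; omega
  have hcp : IsAnc c p := isAnc_up
  have hcp' : ¬ IsAnc c p' := by
    intro h
    have := hm.lt_of_isAnc hcp h
    have := h.1
    have h2 := hm.le
    by_cases hmM : m ≤ M
    · omega
    · -- here `c` has the level `M < m`, and the ancestors at the level `m` differ
      refine hm.ne hpm (by omega) ?_
      rw [hcp.up_eq (by omega), h.up_eq (by omega)]
  -- a change of the property to lie below `c`, between `p` and `p'`
  obtain ⟨k, hk, hch, hmid⟩ : ∃ k, ∃ hk : k < L.length, ¬ (IsAnc c L[k - 1] ↔ IsAnc c L[k]) ∧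
      ∀ z : Cell D, z.lev ≤ M → IsAnc z p → IsAnc z p' → IsAnc z L[k - 1] ∧ IsAnc z L[k] := by
    obtain ⟨i, hi, rfl⟩ := List.mem_iff_getElem.1 hp
    obtain ⟨j, hj, rfl⟩ := List.mem_iff_getElem.1 hp'
    set P : ℕ → Prop := fun k => ∃ h : k < L.length, IsAnc c L[k] with hP
    have hPi : P i := ⟨hi, hcp⟩
    have hPj : ¬ P j := fun ⟨_, h⟩ => hcp' h
    have hPk : ∀ k (hk : k < L.length), P k ↔ IsAnc c L[k] :=
      fun k hk => ⟨fun ⟨_, h⟩ => h, fun h => ⟨hk, h⟩⟩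
    rcases le_total i j with hij | hij
    · obtain ⟨k, h1, h2, h3⟩ := exists_change (P := P) hij (by tauto)
      refine ⟨k, by omega, ?_, fun z hz hzi hzj => ⟨?_, ?_⟩⟩
      · rwa [hPk (k - 1) (by omega), hPk k (by omega)] at h3
      · exact IsAnc.of_key_mem' (R := M + 2) (by omega) hzi hzj (hL.key_le (by omega) _)
          (hL.key_le (by omega) _)
      · exact IsAnc.of_key_mem' (R := M + 2) (by omega) hzi hzj (hL.key_le (by omega) _)
          (hL.key_le (by omega) _)
    · obtain ⟨k, h1, h2, h3⟩ := exists_change (P := P) hij (by tauto)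
      refine ⟨k, by omega, ?_, fun z hz hzi hzj => ⟨?_, ?_⟩⟩
      · rwa [hPk (k - 1) (by omega), hPk k (by omega)] at h3
      · exact IsAnc.of_key_mem' (R := M + 2) (by omega) hzj hzi (hL.key_le (by omega) _)
          (hL.key_le (by omega) _)
      · exact IsAnc.of_key_mem' (R := M + 2) (by omega) hzj hzi (hL.key_le (by omega) _)
          (hL.key_le (by omega) _)
  have hq1M := hLM L[k - 1] (List.getElem_mem _)
  have hq2M := hLM L[k] (List.getElem_mem _)
  have hsub := closeBlock_subset_closeList (M := M) hk
  obtain ⟨m', hm'⟩ := exists_isSplit (R := M + 2) (p := L[k - 1]) (q := L[k]) (by omega) (by omega)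
  simp only [closeBlock, hm'.split_eq] at hsub
  have h1 : min m M ≤ m' := by
    by_contra! hlt
    refine hch ?_
    have e := hm'.eq (min m M) hlt (by omega)
    have := hm'.left
    have := hm'.right
    unfold IsAnc
    rw [hcl, e]
    simp only [show L[k - 1].lev ≤ min m M by omega, show L[k].lev ≤ min m M by omega]
  have h2 : m < M → m' = m ∧ IsAnc (p.up (m + 1)) L[k] := by
    intro hmM
    have hz : IsAnc (p.up (m + 1)) p' := by
      rw [hm.eq (m + 1) (by omega) (by omega)]
      exact isAnc_up
    have hzl : (p.up (m + 1)).lev = m + 1 := by rw [up_lev]; omega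
    have hz2 := hmid _ (by omega) isAnc_up hz
    have := hm'.lt_of_isAnc hz2.1 hz2.2
    exact ⟨by omega, hz2.2⟩
  have hmin : min m' M = min m M := by
    by_cases hmM : m < M
    · rw [(h2 hmM).1]
    · omega
  constructor
  · by_cases h : IsAnc c L[k]
    · refine hsub ?_
      rw [hmin, ← hcl, h.2]
      simp
    · have h' : IsAnc c L[k - 1] := by tauto
      refine hsub ?_
      rw [hmin, ← hcl, h'.2]
      simp
  · intro hmM
    obtain ⟨e, hz⟩ := h2 hmM
    refine hsub ?_
    have hzl : (p.up (m + 1)).lev = m + 1 := by rw [up_lev]; omega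
    have h3 := hz.2
    rw [hzl] at h3
    rw [e, min_eq_left (by omega : m + 1 ≤ M), h3]
    simp

/-! ### The candidates are sufficient -/

/-- The critical level is determined, up to one, by the distance at the lowest common level. -/
theorem IsCrit.eq_add_diffLog {p q : Cell D} {l : ℤ} (h : IsCrit p q l) (hp : p.lev < l)
    (hq : q.lev < l) :
    l = max p.lev q.lev + diffLog p q ∨ l = max p.lev q.lev + diffLog p q + 1 := by
  set L := max p.lev q.lev with hL
  have hidx : ∀ (s : ℕ) (x : Cell D) (_ : x.lev ≤ L) (j),
      (x.up (L + s)).idx j = (x.up L).idx j / 2 ^ s := by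
    intro s x hx j
    rw [← up_up (show L ≤ L + s by omega) x, up_idx, up_lev, max_eq_left hx]
    congr 2
    omega
  have hup : l ≤ L + diffLog p q + 1 := by
    by_contra! hlt
    refine h.not_near hp hq (Near.up (i := L + (diffLog p q + 1 : ℕ)) ?_ (by push_cast; omega)
      (by push_cast; omega) (by push_cast; omega))
    intro j
    rw [hidx _ _ (by omega), hidx _ _ (by omega)]
    refine abs_ediv_sub_ediv_le_one ?_
    have h1 : Nat.log 2 ((p.up L).idx j - (q.up L).idx j).natAbs ≤ diffLog p q :=
      Finset.le_sup (f := fun j => Nat.log 2 ((p.up L).idx j - (q.up L).idx j).natAbs)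
        (Finset.mem_univ j)
    have h2 := (Nat.lt_pow_succ_log_self one_lt_two ((p.up L).idx j - (q.up L).idx j).natAbs).trans_le
      (Nat.pow_le_pow_right (by norm_num) (Nat.add_le_add_right h1 1))
    have h3 : ((((p.up L).idx j - (q.up L).idx j).natAbs : ℕ) : ℤ) < 2 ^ (diffLog p q + 1) := by
      exact_mod_cast h2
    rw [Int.abs_eq_natAbs]
    exact h3.le
  have hlo : L + diffLog p q ≤ l := by
    obtain ⟨s, hs⟩ : ∃ s : ℕ, l = L + s := ⟨(l - L).toNat, by omega⟩
    have hsup : diffLog p q ≤ s := by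
      refine Finset.sup_le fun j _ => ?_
      rw [← hL]
      by_cases h0 : ((p.up L).idx j - (q.up L).idx j).natAbs = 0
      · simp [h0]
      have h1 := h.near j
      rw [hs, hidx _ _ (by omega), hidx _ _ (by omega)] at h1
      have h2 := abs_sub_lt_of_abs_ediv_sub_ediv_le_one h1
      rw [Int.abs_eq_natAbs] at h2
      have h3 : ((p.up L).idx j - (q.up L).idx j).natAbs < 2 ^ (s + 1) := by exact_mod_cast h2
      exact Nat.lt_succ_iff.1 (Nat.log_lt_of_lt_pow h0 h3)
    omega
  omega

theorem IsLowerBound.le_of_key_le {M : ℤ} {A : List (Cell D)} {x : Cell D} {r i : ℕ}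
    (h : IsLowerBound M A x r) (hi : i < A.length) (hx : key (M + 2) x ≤ key (M + 2) A[i]) :
    r ≤ i := by
  by_contra! hc
  exact absurd (h.lt i hi hc) (not_lt.2 hx)

/-- If there is a cell below `x` in the list, then `x` lies above the first cell that does not
precede it. -/
theorem IsLowerBound.isAnc {M : ℤ} {A : List (Cell D)} (hA : SortedCells M A) {x p : Cell D} {r : ℕ}
    (h : IsLowerBound M A x r) (hx : x.lev ≤ M) (hp : p ∈ A) (hxp : IsAnc x p) :
    ∃ hr : r < A.length, IsAnc x A[r] := by
  obtain ⟨i, hi, rfl⟩ := List.mem_iff_getElem.1 hp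
  have hri := h.le_of_key_le hi (hxp.key_le (by omega))
  exact ⟨by omega, hxp.of_key_mem (R := M + 2) (by omega) (h.ge r (by omega) le_rfl)
    (hA.key_le hri hi)⟩

theorem closeList_subset_of_isCandList {M : ℤ} {A W : List (Cell D)} (hA : SortedCells M A)
    (hAM : ∀ p ∈ A, Bdd M 1 p) (hW : IsCandList M A (closeList M A) W) :
    closeList M A ⊆ W := by
  intro u hu
  obtain ⟨p, hp, hup⟩ := exists_isAnc_of_mem_closeList hu
  obtain ⟨r, hr⟩ := exists_isLowerBound hA u
  obtain ⟨hr', -⟩ := hr.isAnc hA (bdd_closeList hAM u hu).1 hp hup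
  exact hW.mem u u (mem_expandPairs.2 ⟨hu, rfl, near_refl (by norm_num) u⟩) r r hr' hr' hr hr u
    (by simp)

/-- The path that determines the length of the shortest path from `p` to `q` with at most one
horizontal move turns at cells one of which is a candidate. Starting from the critical level `l`, go
up to the first level `m` at which the subtree of `p` or that of `q` is left by a cell of `A`. If
`m = l - 1`, then one of the two cells branches. Otherwise, the cell `u` at the level `m` above, say,
`p` belongs to the closure, and below `u` and below its neighbor above `q` the list `A` only has
cells that have the same ancestors at the level `l - 1` as `p` and `q`. So the critical level can be
found from the first of these cells. -/
theorem IsCrit.up_mem_of_isCandList {M : ℤ} {A W : List (Cell D)} (hA : SortedCells M A)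
    (hAM : ∀ p ∈ A, Bdd M 1 p) (hW : IsCandList M A (closeList M A) W) {p q : Cell D} (hp : p ∈ A)
    (hq : q ∈ A) {l : ℤ} (h : IsCrit p q l) (hl : l ≤ M) : p.up l ∈ W ∨ q.up l ∈ W := by
  classical
  have hAl : ∀ p ∈ A, p.lev ≤ M := fun p hp => (hAM p hp).1
  have hsub := closeList_subset_of_isCandList hA hAM hW
  by_cases hpl : l ≤ p.lev
  · left
    rw [up_of_le hpl]
    exact hsub (subset_closeList hp)
  by_cases hql : l ≤ q.lev
  · right
    rw [up_of_le hql]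
    exact hsub (subset_closeList hq)
  have hsplit : ∀ x ∈ A, ∀ y ∈ A, ∃ m, IsSplit (M + 2) x y m := fun x hx y hy =>
    exists_isSplit (by have := hAl x hx; omega) (by have := hAl y hy; omega)
  -- some cell of `A` leaves the subtree of `x` at the level `k`
  set br : Cell D → ℤ → Prop := fun x k => ∃ y ∈ A, ∃ m, IsSplit (M + 2) x y m ∧ min m M = k
    with hbr
  have core : ∀ {p q : Cell D}, p ∈ A → q ∈ A → IsCrit p q l → p.lev < l → q.lev < l → ∀ m,
      l - 1 ≤ m → br p m → (∀ k, l - 1 ≤ k → k < m → ¬ br p k ∧ ¬ br q k) → p.up l ∈ W := by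
    intro p q hp hq h hpl hql m hm ⟨y, hy, m', hm', hmM⟩ hmin
    have hup := up_split_mem_closeList hA hAl hp hy hm' (by omega)
    rw [hmM] at hup
    by_cases hml : m = l - 1
    · have := hup.2 (by omega)
      rw [show m' + 1 = l by omega] at this
      exact hsub this
    have below : ∀ x ∈ A, x.lev < l → (∀ k, l - 1 ≤ k → k < m → ¬ br x k) → ∀ y ∈ A,
        IsAnc (x.up m) y → y.lev ≤ l - 1 ∧ x.up (l - 1) = y.up (l - 1) := by
      intro x hx hxl hxm y hy hxy
      obtain ⟨k, hk⟩ := hsplit x hx y hy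
      have h1 := hk.lt_of_isAnc isAnc_up hxy
      rw [up_lev] at h1
      have h2 : k < l - 1 := by
        by_contra! hc
        exact hxm k hc (by omega) ⟨y, hy, k, hk, by omega⟩
      have h3 := hk.right
      exact ⟨by omega, hk.eq _ h2 (by omega)⟩
    have hul : (p.up m).lev = m := by rw [up_lev]; omega
    have hvl : (q.up m).lev = m := by rw [up_lev]; omega
    obtain ⟨r, hr⟩ := exists_isLowerBound hA (p.up m)
    obtain ⟨r', hr'⟩ := exists_isLowerBound hA (q.up m)
    obtain ⟨hrA, hpr⟩ := hr.isAnc hA (by omega) hp isAnc_up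
    obtain ⟨hrA', hqr⟩ := hr'.isAnc hA (by omega) hq isAnc_up
    have b1 := below p hp hpl (fun k h1 h2 => (hmin k h1 h2).1) _ (List.getElem_mem hrA) hpr
    have b2 := below q hq hql (fun k h1 h2 => (hmin k h1 h2).2) _ (List.getElem_mem hrA') hqr
    have e1 := up_eq_of_le (show l - 1 ≤ l by omega) b1.2
    have e2 := up_eq_of_le (show l - 1 ≤ l by omega) b2.2
    have hcrit : IsCrit A[r] A[r'] l := by
      refine ⟨by omega, by omega, ?_, fun _ _ => ?_⟩
      · rw [← e1, ← e2]
        exact h.near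
      · rw [← b1.2, ← b2.2]
        exact h.not_near hpl hql
    have hmem := hW.mem (p.up m) (q.up m) (mem_expandPairs.2 ⟨hup.1, hul.trans hvl.symm,
      h.near.up (by omega) hpl.le hql.le⟩) r r' hrA hrA' hr hr' (p.up l)
    refine hmem (List.mem_cons_of_mem _ ?_)
    rcases hcrit.eq_add_diffLog (by omega) (by omega) with he | he
    · rw [candCells, ← he, min_eq_left hl, ← e1]
      simp
    · rw [candCells, ← he, min_eq_left hl, ← e1]
      simp
  obtain ⟨m0, hm0⟩ := hsplit p hp q hq
  have hm0l : l - 1 ≤ m0 := by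
    by_contra! hc
    refine h.not_near (by omega) (by omega) ?_
    rw [hm0.eq (l - 1) hc (by omega)]
    exact near_refl (by norm_num) _
  have hex : ∃ n : ℕ, br p (l - 1 + n) ∨ br q (l - 1 + n) :=
    ⟨(min m0 M - (l - 1)).toNat, Or.inl ⟨q, hq, m0, hm0, by omega⟩⟩
  have hmin : ∀ k, l - 1 ≤ k → k < l - 1 + (Nat.find hex : ℕ) → ¬ br p k ∧ ¬ br q k := by
    intro k h1 h2
    have := Nat.find_min hex (m := (k - (l - 1)).toNat) (by omega)
    rw [show l - 1 + ((k - (l - 1)).toNat : ℤ) = k by omega] at this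
    exact not_or.1 this
  rcases Nat.find_spec hex with hb | hb
  · exact Or.inl (core hp hq h (by omega) (by omega) _ (by omega) hb hmin)
  · exact Or.inr (core hq hp h.symm (by omega) (by omega) _ (by omega) hb
      fun k h1 h2 => (hmin k h1 h2).symm)

/-! ### The vertices of the spanner -/

theorem IsVertexList.bdd_of_mem {M : ℤ} {P V : List (Cell D)} (h : IsVertexList M P V) {v : Cell D}
    (hv : v ∈ V) : Bdd M 2 v := by
  obtain ⟨A, W, B, hAP, hA, hW, hBW, hB, hV, hVB⟩ := h
  exact bdd_closeList (fun p hp => bdd_expand_one hW.bdd p (hBW.mem_iff.1 hp)) v ((hVB v).1 hv)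

theorem IsVertexList.strictSorted {M : ℤ} {P V : List (Cell D)} (h : IsVertexList M P V) :
    StrictSorted M V := by
  obtain ⟨A, W, B, hAP, hA, hW, hBW, hB, hV, hVB⟩ := h
  exact hV

theorem IsVertexList.mem_of_mem {M : ℤ} {P V : List (Cell D)} (h : IsVertexList M P V)
    (hP : ∀ p ∈ P, Bdd M 1 p) {p : Cell D} (hp : p ∈ P) : p ∈ V := by
  obtain ⟨A, W, B, hAP, hA, hW, hBW, hB, hV, hVB⟩ := h
  have hAM : ∀ p ∈ A, Bdd M 1 p := fun p hp => hP p (hAP.mem_iff.1 hp)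
  have h1 := closeList_subset_of_isCandList hA hAM hW (subset_closeList (hAP.mem_iff.2 hp))
  rw [hVB]
  exact subset_closeList (hBW.mem_iff.2 (mem_expand_one.2 ⟨p, h1, rfl, near_refl (by norm_num) p⟩))

/-- The cells at which the shortest path between two points with at most one horizontal move turns
are vertices. -/
theorem IsVertexList.up_mem {M : ℤ} {P V : List (Cell D)} (h : IsVertexList M P V)
    (hP : ∀ p ∈ P, Bdd M 1 p) {p q : Cell D} (hp : p ∈ P) (hq : q ∈ P) {l : ℤ} (hl : l ≤ M)
    (hc : IsCrit p q l) : p.up l ∈ V ∧ q.up l ∈ V := by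
  obtain ⟨A, W, B, hAP, hA, hW, hBW, hB, hV, hVB⟩ := h
  have hAM : ∀ p ∈ A, Bdd M 1 p := fun p hp => hP p (hAP.mem_iff.1 hp)
  have hlev : (p.up l).lev = (q.up l).lev := by
    rw [up_lev, up_lev, max_eq_left hc.left, max_eq_left hc.right]
  have key : ∀ w ∈ W, ∀ v, w.lev = v.lev → Near 1 w v → v ∈ V := by
    intro w hw v h1 h2
    rw [hVB]
    exact subset_closeList (hBW.mem_iff.2 (mem_expand_one.2 ⟨w, hw, h1, h2⟩))
  have hn := near_refl (D := D) (d := 1) (by norm_num)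
  rcases hc.up_mem_of_isCandList hA hAM hW (hAP.mem_iff.2 hp) (hAP.mem_iff.2 hq) hl with hw | hw
  · exact ⟨key _ hw _ rfl (hn _), key _ hw _ hlev hc.near⟩
  · exact ⟨key _ hw _ hlev.symm hc.near.symm, key _ hw _ rfl (hn _)⟩

/-- Each vertex below another one has an edge to the lowest vertex above it. -/
theorem IsVertexList.exists_edge {M : ℤ} {P V : List (Cell D)} (h : IsVertexList M P V)
    {v x : Cell D} (hv : v ∈ V) (hx : x ∈ V) (hxv : IsAnc x v) (hne : x ≠ v) :
    ∃ y, (y, v) ∈ edgeList M V ∧ v.lev < y.lev ∧ IsAnc y v ∧ IsAnc x y := by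
  classical
  have hVM : ∀ p ∈ V, p.lev ≤ M := fun p hp => (h.bdd_of_mem hp).1
  have hVs := h.strictSorted
  have lev_lt : ∀ {y : Cell D}, IsAnc y v → y ≠ v → v.lev < y.lev := fun hy hn =>
    lt_of_le_of_ne hy.1 fun he => hn (hy.eq_of_lev (isAnc_refl v) he.symm)
  -- the lowest vertex above `v`
  obtain ⟨y, ⟨hy, hyv, hyne⟩, hymin⟩ : ∃ y, (y ∈ V ∧ IsAnc y v ∧ y ≠ v) ∧
      ∀ z ∈ V, IsAnc z v → z ≠ v → y.lev ≤ z.lev := by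
    have hs : (V.toFinset.filter fun y => IsAnc y v ∧ y ≠ v).Nonempty :=
      ⟨x, by simp [hx, hxv, hne]⟩
    obtain ⟨y, hy, hmin⟩ := Finset.exists_min_image _ (fun y => y.lev) hs
    refine ⟨y, by simpa using hy, fun z h1 h2 h3 => hmin z (by simp [h1, h2, h3])⟩
  refine ⟨y, ?_, lev_lt hyv hyne, hyv, hxv.isAnc_of_le hyv (hymin x hx hxv hne)⟩
  have hyM := hVM y hy
  have hvM := hVM v hv
  have hkey : key (M + 2) y < key (M + 2) v := lt_of_le_of_ne (hyv.key_le (by omega)) fun he =>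
    hyne (key_injective (by omega) (by omega) he)
  rw [edgeList, List.mem_append]
  refine Or.inl (mem_edgePairs.2 ⟨?_, hy, hv, hkey⟩)
  obtain ⟨i, hi, rfl⟩ := List.mem_iff_getElem.1 hv
  obtain ⟨j, hj, rfl⟩ := List.mem_iff_getElem.1 hy
  have hji : j < i := by
    by_contra! hc
    exact absurd hkey (not_lt.2 (hVs.sorted.key_le hc hj))
  set w := V[i - 1] with hw
  set v := V[i]
  set y := V[j]
  have hwM : w.lev ≤ M := hVM _ (List.getElem_mem _)
  have hwv : key (M + 2) w < key (M + 2) v := hVs.key_lt (by omega) hi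
  have hyw : IsAnc y w := hyv.of_key_mem (R := M + 2) (by omega)
    (hVs.sorted.key_le (by omega) (by omega)) hwv.le
  obtain ⟨m, hm⟩ := exists_isSplit (R := M + 2) (p := w) (q := v) (by omega) (by omega)
  have hmy := hm.lt_of_isAnc hyw hyv
  have hml := hm.left
  have hmr := hm.right
  have hz : w.up (m + 1) = v.up (m + 1) := hm.eq _ (by omega) (by omega)
  have hvm : v.lev ≤ m := by
    by_contra! hc
    have : IsAnc v w := ⟨by omega, by
      rw [show v.lev = m + 1 by omega, hz, up_of_le (by omega)]⟩
    exact absurd (this.key_le (R := M + 2) (by omega)) (not_le.2 hwv)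
  have hzl : (v.up (m + 1)).lev = m + 1 := by rw [up_lev]; omega
  have hzV : v.up (m + 1) ∈ V := by
    by_cases hwm : w.lev ≤ m
    · obtain ⟨A, W, B, hAP, hA, hW, hBW, hB, hV, hVB⟩ := h
      obtain ⟨w', hw', hww⟩ := exists_isAnc_of_mem_closeList ((hVB w).1 (List.getElem_mem _))
      obtain ⟨v', hv', hvv⟩ := exists_isAnc_of_mem_closeList ((hVB v).1 hv)
      have hBM : ∀ p ∈ B, p.lev ≤ M := fun p hp =>
        (bdd_expand_one hW.bdd p (hBW.mem_iff.1 hp)).1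
      have hww1 := hww.1
      have hvv1 := hvv.1
      have hm' : IsSplit (M + 2) v' w' m := by
        refine ⟨by omega, by omega, hm.le, fun k h1 h2 => ?_, fun _ _ => ?_⟩
        · rw [hvv.up_eq (by omega), hww.up_eq (by omega), hm.eq k h1 h2]
        · rw [hvv.up_eq (by omega), hww.up_eq (by omega)]
          exact (hm.ne hwm hvm).symm
      have := (up_split_mem_closeList hB hBM hv' hw' hm' (by omega)).2 (by omega)
      rw [hvv.up_eq (by omega)] at this
      exact (hVB _).2 this
    · rw [← hz, up_of_le (by omega)]
      exact List.getElem_mem _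
  have hzy : v.up (m + 1) = y := by
    have h1 := hymin _ hzV isAnc_up fun he => by rw [he] at hzl; omega
    exact isAnc_up.eq_of_lev hyv (by omega)
  refine List.mem_map.2 ⟨(w, v), ?_, ?_⟩
  · rw [prevPairs, List.mem_ofFn]
    exact ⟨⟨i, hi⟩, rfl⟩
  · simp only [hm.split_eq]
    rw [min_eq_left (by omega), hzy]

theorem mem_edgeList_of_near {M : ℤ} {V : List (Cell D)} (hV : ∀ p ∈ V, p.lev ≤ M) {u v : Cell D}
    (hu : u ∈ V) (hv : v ∈ V) (hl : u.lev = v.lev) (hn : Near 1 u v) (hne : u ≠ v) :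
    (u, v) ∈ edgeList M V ∨ (v, u) ∈ edgeList M V := by
  have hk : key (M + 2) u ≠ key (M + 2) v := fun he =>
    hne (key_injective (by have := hV u hu; omega) (by have := hV v hv; omega) he)
  simp only [edgeList, List.mem_append, mem_edgePairs, mem_expandPairs]
  rcases lt_or_gt_of_ne hk with h | h
  · exact Or.inl (Or.inr ⟨⟨hu, hl, hn⟩, hu, hv, h⟩)
  · exact Or.inr (Or.inr ⟨⟨hv, hl.symm, hn.symm⟩, hv, hu, h⟩)

/-! ### The spanner -/

theorem map_snd_closePairs (M : ℤ) (V : List (Cell D)) :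
    (closePairs M V).map Prod.snd = V := by
  rw [closePairs, List.map_map, prevPairs, List.map_ofFn]
  exact List.ofFn_getElem

/-- The length of an edge between cells that are on top of each other or horizontal neighbors. -/
def edgeWeight : Sym2 (Cell D) → ℕ :=
  Sym2.lift ⟨fun x y => max 1 (x.lev - y.lev).natAbs, fun x y => by
    dsimp only
    rw [← Int.natAbs_neg, neg_sub]⟩

theorem edgeWeight_mk (x y : Cell D) : edgeWeight s(x, y) = max 1 (x.lev - y.lev).natAbs := rfl

theorem mem_of_mem_edgeList {M : ℤ} {V : List (Cell D)} {x y : Cell D}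
    (h : (x, y) ∈ edgeList M V) : x ∈ V ∧ y ∈ V ∧ key (M + 2) x < key (M + 2) y := by
  rcases List.mem_append.1 h with h | h
  · exact (mem_edgePairs.1 h).2
  · exact (mem_edgePairs.1 h).2

theorem ne_of_mem_edgeList {M : ℤ} {V : List (Cell D)} {x y : Cell D}
    (h : (x, y) ∈ edgeList M V) : x ≠ y := by
  have h1 := (mem_of_mem_edgeList h).2.2
  rintro rfl
  exact lt_irrefl _ h1

theorem lev_lt_of_mem_closePairs {M : ℤ} {V : List (Cell D)} {x y : Cell D}
    (h : (x, y) ∈ edgePairs M V (closePairs M V)) : IsAnc x y ∧ y.lev < x.lev := by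
  obtain ⟨hxy, -, -, hk⟩ := mem_edgePairs.1 h
  obtain ⟨⟨p, q⟩, -, he⟩ := List.mem_map.1 hxy
  rw [Prod.mk.injEq] at he
  obtain ⟨rfl, rfl⟩ := he
  refine ⟨isAnc_up, lt_of_le_of_ne isAnc_up.1 fun he => ?_⟩
  have h2 := isAnc_up.eq_of_lev (isAnc_refl q) he.symm
  simp only [h2] at hk
  exact lt_irrefl _ hk

theorem edge_cases {M : ℤ} {V : List (Cell D)} {x y : Cell D} (h : (x, y) ∈ edgeList M V) :
    (IsAnc x y ∧ y.lev < x.lev) ∨ x.HorizontalNeighbor y := by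
  have hne := ne_of_mem_edgeList h
  rcases List.mem_append.1 h with h | h
  · exact Or.inl (lev_lt_of_mem_closePairs h)
  · obtain ⟨hxy, -, -, -⟩ := mem_edgePairs.1 h
    obtain ⟨-, hl, hn⟩ := mem_expandPairs.1 hxy
    exact Or.inr (horizontalNeighbor_iff.2 ⟨hl, hne, hn⟩)

theorem edgeLength_eq {M : ℤ} {V : List (Cell D)} {x y : Cell D} (h : (x, y) ∈ edgeList M V) :
    edgeLength x y = edgeWeight s(x, y) := by
  have hl : y.lev ≤ x.lev := by
    rcases edge_cases h with h | h
    · exact h.2.le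
    · exact h.1.ge
  rw [edgeLength, edgeWeight_mk]
  omega

theorem d1_eq_of_mem_edgeList {M : ℤ} {V : List (Cell D)} {x y : Cell D}
    (h : (x, y) ∈ edgeList M V) : d1 x y = edgeWeight s(x, y) := by
  rw [edgeWeight_mk]
  rcases edge_cases h with ⟨h1, h2⟩ | h
  · rw [d1_comm, ← h1.2, d1_up, up_lev]
    norm_cast
    omega
  · rw [d1_horizontalNeighbor h, h.1]
    norm_num

theorem nodup_edges {M : ℤ} {V : List (Cell D)} (hV : V.Nodup) :
    ((edgeList M V).map fun xy => s(xy.1, xy.2)).Nodup := by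
  have hnd : (edgeList M V).Nodup := by
    rw [edgeList, List.nodup_append']
    refine ⟨?_, ?_, ?_⟩
    · refine List.Nodup.filter _ (List.Nodup.of_map Prod.snd ?_)
      rwa [map_snd_closePairs]
    · exact List.Nodup.filter _ (nodup_expandPairs hV)
    · rintro ⟨x, y⟩ h1 h2
      have h3 := (lev_lt_of_mem_closePairs h1).2
      have h4 := (mem_expandPairs.1 (mem_edgePairs.1 h2).1).2.1
      omega
  refine hnd.map_on ?_
  rintro ⟨x, y⟩ h1 ⟨x', y'⟩ h2 he
  rcases Sym2.eq_iff.1 he with ⟨rfl, rfl⟩ | ⟨rfl, rfl⟩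
  · rfl
  · exact absurd (mem_of_mem_edgeList h1).2.2 (not_lt.2 (mem_of_mem_edgeList h2).2.2.le)

open Classical in
/-- The spanner with the vertices `V`. -/
noncomputable def spanner (M : ℤ) (V : List (Cell D)) : EmbeddedGraph D where
  verts := V.toFinset
  edges := ((edgeList M V).map fun xy => s(xy.1, xy.2)).toFinset
  not_isDiag := by
    intro e he
    obtain ⟨⟨x, y⟩, hxy, rfl⟩ := List.mem_map.1 (List.mem_toFinset.1 he)
    simpa using ne_of_mem_edgeList hxy
  mem_verts := by
    intro e he v hv
    obtain ⟨⟨x, y⟩, hxy, rfl⟩ := List.mem_map.1 (List.mem_toFinset.1 he)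
    have := mem_of_mem_edgeList hxy
    rw [List.mem_toFinset]
    rcases Sym2.mem_iff.1 hv with rfl | rfl
    · exact this.1
    · exact this.2.1
  weight := edgeWeight

theorem mem_edges_spanner {M : ℤ} {V : List (Cell D)} {u v : Cell D} :
    s(u, v) ∈ (spanner M V).edges ↔ (u, v) ∈ edgeList M V ∨ (v, u) ∈ edgeList M V := by
  simp only [spanner, List.mem_toFinset, List.mem_map, Prod.exists]
  constructor
  · rintro ⟨x, y, hxy, he⟩
    rcases Sym2.eq_iff.1 he with ⟨rfl, rfl⟩ | ⟨rfl, rfl⟩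
    · exact Or.inl hxy
    · exact Or.inr hxy
  · rintro (h | h)
    · exact ⟨_, _, h, rfl⟩
    · exact ⟨_, _, h, Sym2.eq_swap⟩

theorem adj_spanner {M : ℤ} {V : List (Cell D)} {u v : Cell D} :
    (spanner M V).graph.Adj u v ↔ (u, v) ∈ edgeList M V ∨ (v, u) ∈ edgeList M V := by
  rw [EmbeddedGraph.graph, SimpleGraph.fromEdgeSet_adj, Finset.mem_coe, mem_edges_spanner]
  refine and_iff_left_of_imp ?_
  rintro (h | h)
  · exact ne_of_mem_edgeList h
  · exact (ne_of_mem_edgeList h).symm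

theorem weight_spanner {M : ℤ} {V : List (Cell D)} {u v : Cell D}
    (h : s(u, v) ∈ (spanner M V).edges) :
    ((spanner M V).weight s(u, v) : ℕ∞) = d1 u v := by
  rcases mem_edges_spanner.1 h with h | h
  · exact (d1_eq_of_mem_edgeList h).symm
  · rw [Sym2.eq_swap, d1_comm]
    exact (d1_eq_of_mem_edgeList h).symm

namespace EmbeddedGraph

variable (S : EmbeddedGraph D)

theorem length_cons {u v w : Cell D} (h : S.graph.Adj u v) (p : S.graph.Walk v w) :
    S.length (.cons h p) = S.weight s(u, v) + S.length p := by
  simp [length]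

theorem length_append {u v w : Cell D} (p : S.graph.Walk u v) (q : S.graph.Walk v w) :
    S.length (p.append q) = S.length p + S.length q := by
  simp [length]

theorem length_reverse {u v : Cell D} (p : S.graph.Walk u v) :
    S.length p.reverse = S.length p := by
  simp [length, List.sum_reverse]

/-- The distance in a graph whose edges have their lengths in the tiling is at least the distance in
the tiling. -/
theorem d1_le_dist (hS : ∀ u v : Cell D, s(u, v) ∈ S.edges → (S.weight s(u, v) : ℕ∞) = d1 u v)
    (p q : Cell D) : d1 p q ≤ S.dist p q := by
  refine le_iInf fun w => ?_
  induction w with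
  | nil => simp [d1_self]
  | @cons u v w h p ih =>
    refine (d1_triangle u v w).trans ?_
    rw [length_cons, Nat.cast_add, hS]
    · exact add_le_add_right ih _
    · rw [graph, SimpleGraph.fromEdgeSet_adj] at h
      exact h.1

end EmbeddedGraph

theorem _root_.SimpleGraph.Walk.IsPath.append_of_disjoint {X : Type*} {G : SimpleGraph X}
    {u v w : X} {p : G.Walk u v} {q : G.Walk v w} (hp : p.IsPath) (hq : q.IsPath)
    (h : ∀ z ∈ p.support, z ∈ q.support → z = v) : (p.append q).IsPath := by
  rw [SimpleGraph.Walk.isPath_def] at hp hq ⊢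
  rw [SimpleGraph.Walk.support_append, List.nodup_append']
  refine ⟨hp, hq.tail, fun z hz hz' => ?_⟩
  rw [← SimpleGraph.Walk.cons_tail_support] at hq
  obtain rfl := h z hz (List.mem_of_mem_tail hz')
  exact (List.nodup_cons.1 hq).1 hz'

/-- The path in the spanner from a vertex to a vertex above it. -/
theorem IsVertexList.exists_walk_up {M : ℤ} {P V : List (Cell D)} (h : IsVertexList M P V)
    {x : Cell D} (hx : x ∈ V) {v : Cell D} (hv : v ∈ V) (hxv : IsAnc x v) :
    ∃ w : (spanner M V).graph.Walk v x, w.IsPath ∧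
      (spanner M V).length w = (x.lev - v.lev).toNat ∧ ∀ z ∈ w.support, IsAnc z v ∧ IsAnc x z := by
  induction hn : (x.lev - v.lev).toNat using Nat.strong_induction_on generalizing v with
  | _ n ih =>
    by_cases hne : x = v
    · subst hne
      refine ⟨.nil, by simp, ?_, ?_⟩
      · simp [EmbeddedGraph.length, ← hn]
      · simp [isAnc_refl]
    · obtain ⟨y, hy, hl, hyv, hxy⟩ := h.exists_edge hv hx hxv hne
      have hlx := hxy.1
      obtain ⟨w, hw, hwl, hws⟩ := ih _ (by omega) (mem_of_mem_edgeList hy).1 hxy rfl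
      have hadj : (spanner M V).graph.Adj v y := adj_spanner.2 (Or.inr hy)
      refine ⟨.cons hadj w, ?_, ?_, ?_⟩
      · rw [SimpleGraph.Walk.cons_isPath_iff]
        refine ⟨hw, fun hvw => ?_⟩
        have := (hws v hvw).1.1
        omega
      · rw [EmbeddedGraph.length_cons, hwl]
        change edgeWeight s(v, y) + _ = _
        rw [edgeWeight_mk]
        omega
      · intro z hz
        rw [SimpleGraph.Walk.support_cons, List.mem_cons] at hz
        rcases hz with rfl | hz
        · exact ⟨isAnc_refl _, hxv⟩
        · exact ⟨(hws z hz).1.trans hyv, (hws z hz).2⟩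

/-- The spanner contains a shortest path among those with at most one horizontal move. -/
theorem IsVertexList.exists_path {M : ℤ} {P V : List (Cell D)} (h : IsVertexList M P V)
    (hP : ∀ p ∈ P, Bdd M 1 p) {p q : Cell D} (hp : p ∈ P) (hq : q ∈ P) {l : ℤ} (hl : l ≤ M)
    (hc : IsCrit p q l) : ∃ w : (spanner M V).graph.Walk p q, w.IsPath ∧
      ((spanner M V).length w : ℕ∞) = d2 p q := by
  obtain ⟨ha, hb⟩ := h.up_mem hP hp hq hl hc
  obtain ⟨w, hw, hwl, hws⟩ := h.exists_walk_up ha (h.mem_of_mem hP hp) isAnc_up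
  obtain ⟨w', hw', hwl', hws'⟩ := h.exists_walk_up hb (h.mem_of_mem hP hq) isAnc_up
  have hal : (p.up l).lev = l := by rw [up_lev, max_eq_left hc.left]
  have hbl : (q.up l).lev = l := by rw [up_lev, max_eq_left hc.right]
  rw [hal] at hwl
  rw [hbl] at hwl'
  -- a common cell below the level `l` would contradict the choice of `l`
  have hcom : ∀ z, IsAnc z p → IsAnc z q → l ≤ z.lev := by
    intro z hz hz'
    by_contra! hlt
    have h1 := hz.1
    have h2 := hz'.1
    refine hc.not_near (by omega) (by omega) ?_
    rw [hz.up_eq (by omega), hz'.up_eq (by omega)]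
    exact near_refl (by norm_num) _
  have hcom' : ∀ z ∈ w.support, z ∈ w'.support → z = p.up l ∧ z = q.up l := by
    intro z hz hz'
    obtain ⟨h1, h2⟩ := hws z hz
    obtain ⟨h3, h4⟩ := hws' z hz'
    have h5 := hcom z h1 h3
    have h6 := h2.1
    exact ⟨h1.eq_of_lev isAnc_up (by omega), h3.eq_of_lev isAnc_up (by omega)⟩
  rw [hc.d2_eq, critLength]
  by_cases hab : p.up l = q.up l
  · have aux : ∀ b (w' : (spanner M V).graph.Walk q b), p.up l = b → w'.IsPath →
        (∀ z ∈ w.support, z ∈ w'.support → z = p.up l) →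
        (spanner M V).length w' = (l - q.lev).toNat →
        ∃ w : (spanner M V).graph.Walk p q, w.IsPath ∧
        (spanner M V).length w = (l - p.lev).toNat + (l - q.lev).toNat := by
      rintro b w' rfl h1 h2 h3
      refine ⟨w.append w'.reverse, ?_, ?_⟩
      · refine hw.append_of_disjoint h1.reverse fun z hz hz' => h2 z hz ?_
        simpa using hz'
      · rw [EmbeddedGraph.length_append, EmbeddedGraph.length_reverse, hwl, h3]
    obtain ⟨w2, h1, h2⟩ := aux _ w' hab hw' (fun z hz hz' => (hcom' z hz hz').1) hwl'
    exact ⟨w2, h1, by rw [h2, if_pos hab, add_zero]⟩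
  · have hadj : (spanner M V).graph.Adj (p.up l) (q.up l) :=
      adj_spanner.2 (mem_edgeList_of_near (fun v hv => (h.bdd_of_mem hv).1) ha hb
        (hal.trans hbl.symm) hc.near hab)
    have hdis : ∀ z ∈ w.support, z ∉ w'.support := fun z hz hz' => by
      obtain ⟨h1, h2⟩ := hcom' z hz hz'
      exact hab (h1.symm.trans h2)
    refine ⟨w.append (.cons hadj w'.reverse), ?_, ?_⟩
    · refine hw.append_of_disjoint ?_ fun z hz hz' => ?_
      · rw [SimpleGraph.Walk.cons_isPath_iff]
        refine ⟨hw'.reverse, fun hz => hdis _ w.end_mem_support ?_⟩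
        simpa using hz
      · rw [SimpleGraph.Walk.support_cons, List.mem_cons] at hz'
        rcases hz' with h1 | h1
        · exact h1
        · exact absurd (by simpa using h1) (hdis z hz)
    · rw [EmbeddedGraph.length_append, EmbeddedGraph.length_cons, EmbeddedGraph.length_reverse, hwl,
        hwl', if_neg hab]
      change ((_ + (edgeWeight s(p.up l, q.up l) + _) : ℕ) : ℕ∞) = _
      rw [edgeWeight_mk, hal, hbl]
      norm_cast
      omega

theorem Cell.Bdd.near_up {M : ℤ} {p q : Cell D} (hp : Bdd M 1 p) (hq : Bdd M 1 q) :
    Near 1 (p.up M) (q.up M) := by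
  intro j
  have h1 := (hp.up le_rfl).2 j
  have h2 := (hq.up le_rfl).2 j
  rw [up_lev, max_eq_left hp.1, sub_self] at h1
  rw [up_lev, max_eq_left hq.1, sub_self] at h2
  simp only [Int.toNat_zero, pow_zero, mul_one] at h1 h2
  rw [abs_le]
  omega

theorem isOutput_spanner {s : State} {M : ℤ} {V : List (Cell D)} (hV : StrictSorted M V)
    (hT : Tab s (s.reg 2) V) (hE : OpenEdges s (s.reg 3) V (edgeList M V))
    (h0 : s.reg 0 = V.length) (h1 : s.reg 1 = (edgeList M V).length) :
    IsOutput (spanner M V) s := by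
  classical
  have hnd := hV.nodup
  have hv : (spanner M V).verts.card = V.length := by
    exact List.toFinset_card_of_nodup hnd
  have hed := nodup_edges (M := M) hnd
  have he : (spanner M V).edges.card = (edgeList M V).length := by
    rw [← List.length_map (f := fun xy : Cell D × Cell D => s(xy.1, xy.2))]
    exact List.toFinset_card_of_nodup hed
  refine ⟨by rw [h0, hv], by rw [h1, he], ?_⟩
  rw [hv, he]
  have hmem : ∀ x, x ∈ (spanner M V).verts ↔ x ∈ V := fun x => List.mem_toFinset
  refine ⟨fun j => V[j], ?_, ?_, fun j => (hT j j.2).1, ?_⟩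
  · exact List.nodup_iff_injective_get.1 hnd
  · ext x
    rw [Finset.mem_coe, hmem, List.mem_iff_get]
    exact Iff.rfl
  have hE2 : ∀ j : Fin (edgeList M V).length, ∃ a b : Fin V.length, V[a] = (edgeList M V)[j].1 ∧
      V[b] = (edgeList M V)[j].2 ∧ s.mem (s.reg 3 + 3 * (j : ℕ)) = (a : ℕ) ∧
      s.mem (s.reg 3 + 3 * (j : ℕ) + 1) = (b : ℕ) ∧ s.mem (s.reg 3 + 3 * (j : ℕ) + 2) =
        edgeLength (edgeList M V)[j].1 (edgeList M V)[j].2 := by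
    intro j
    obtain ⟨r, r', hr, hr', h⟩ := hE.2 j j.2
    exact ⟨⟨r, hr⟩, ⟨r', hr'⟩, h⟩
  choose a b ha hb h2 h3 h4 using hE2
  have hfun : (fun j => s(V[a j], V[b j])) = fun j : Fin (edgeList M V).length =>
      (fun xy : Cell D × Cell D => s(xy.1, xy.2)) (edgeList M V)[j] := by
    funext j
    rw [ha, hb]
  refine ⟨a, b, ?_, ?_, fun j => ⟨h2 j, h3 j, ?_⟩⟩
  · rw [hfun]
    intro i j hij
    have h5 := List.inj_on_of_nodup_map hed (List.getElem_mem i.2) (List.getElem_mem j.2) hij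
    exact Fin.ext ((List.Nodup.getElem_inj_iff (List.Nodup.of_map _ hed)).1 h5)
  · rw [hfun]
    ext e
    simp only [Set.mem_range, Finset.mem_coe, spanner, List.mem_toFinset, List.mem_map]
    constructor
    · rintro ⟨j, rfl⟩
      exact ⟨_, List.getElem_mem j.2, rfl⟩
    · rintro ⟨xy, hxy, rfl⟩
      obtain ⟨j, hj, rfl⟩ := List.mem_iff_getElem.1 hxy
      exact ⟨⟨j, hj⟩, rfl⟩
  · dsimp only
    rw [h4, ha, hb]
    exact edgeLength_eq (List.getElem_mem j.2)

/-! ### The bounds -/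

theorem vertexBound_le (hD : 2 ≤ D) (n : ℕ) : 48 * 27 ^ (D - 1) * n ≤ 2 ^ (8 * D) * n := by
  refine Nat.mul_le_mul_right n ?_
  obtain ⟨N, rfl⟩ : ∃ N, D = N + 1 := ⟨D - 1, by omega⟩
  calc 48 * 27 ^ (N + 1 - 1) ≤ 2 ^ 8 * (2 ^ 8) ^ N := by
        gcongr <;> norm_num
    _ = 2 ^ (8 * (N + 1)) := by
        rw [← pow_mul, ← pow_add]
        congr 1
        ring

theorem work_le (hD : 2 ≤ D) {n : ℕ} (hn : 2 ≤ n) :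
    20000 * work D (48 * 27 ^ (D - 1) * n) ≤ 2 ^ (22 * D) * (n * Nat.log 2 n) := by
  set K := 48 * 27 ^ (D - 1) * n
  have hK : K ≤ 2 ^ (8 * D) * n := vertexBound_le hD n
  have hDD : D ≤ 2 ^ D := Nat.lt_two_pow_self.le
  have hlog1 : 1 ≤ Nat.log 2 n := Nat.log_pos one_lt_two hn
  have h1 : K + 1 ≤ 2 ^ (9 * D) * n := by
    have e : 2 ^ (9 * D) * n = 2 ^ D * (2 ^ (8 * D) * n) := by
      rw [← mul_assoc, ← pow_add]
      ring_nf
    have h2 : 2 ^ 1 * (2 ^ (8 * D) * n) ≤ 2 ^ D * (2 ^ (8 * D) * n) := by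
      gcongr <;> omega
    have h3 : 0 < 2 ^ (8 * D) * n := by positivity
    omega
  have h2 : Nat.log 2 K + 2 ≤ 2 ^ (3 * D) * Nat.log 2 n := by
    have h3 : Nat.log 2 K ≤ Nat.log 2 n + 8 * D := by
      have h4 : Nat.log 2 (n * 2 ^ (8 * D)) = Nat.log 2 n + 8 * D := by
        generalize 8 * D = m
        induction m with
        | zero => simp
        | succ m ih =>
          rw [pow_succ, ← mul_assoc, Nat.log_mul_base one_lt_two (by positivity), ih, add_assoc]
      rw [← h4, mul_comm n]
      exact Nat.log_mono_right hK
    have h5 : 8 * D + 3 ≤ 2 ^ (3 * D) := by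
      calc 8 * D + 3 ≤ 2 ^ 4 * 2 ^ D := by
            have : 1 ≤ 2 ^ D := Nat.one_le_two_pow
            omega
        _ = 2 ^ (4 + D) := (pow_add _ _ _).symm
        _ ≤ 2 ^ (3 * D) := Nat.pow_le_pow_right (by norm_num) (by omega)
    calc Nat.log 2 K + 2 ≤ (8 * D + 2) * 1 + Nat.log 2 n := by omega
      _ ≤ (8 * D + 2) * Nat.log 2 n + Nat.log 2 n := by gcongr
      _ = (8 * D + 3) * Nat.log 2 n := by ring
      _ ≤ 2 ^ (3 * D) * Nat.log 2 n := by gcongr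
  calc 20000 * work D K = 20000 * (D * D * (K + 1) * (Nat.log 2 K + 2)) := rfl
    _ ≤ 2 ^ (8 * D) * (2 ^ D * 2 ^ D * (2 ^ (9 * D) * n) * (2 ^ (3 * D) * Nat.log 2 n)) := by
        have : 20000 ≤ 2 ^ (8 * D) :=
          le_trans (by norm_num) (Nat.pow_le_pow_right (n := 2) (by norm_num)
            (show 16 ≤ 8 * D by omega))
        gcongr
    _ = 2 ^ (22 * D) * (n * Nat.log 2 n) := by
        have : 22 * D = 8 * D + D + D + 9 * D + 3 * D := by ring
        rw [this]
        simp only [pow_add]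
        ring

end HypTiling

theorem theorem3 :
    ∃ (prog : HypTiling.Program) (c : ℕ),
      ∀ (D : ℕ), 2 ≤ D →
      ∀ (n : ℕ) (pts : Fin n → HypTiling.Cell D), Function.Injective pts →
      ∀ (s : HypTiling.State), HypTiling.IsInput pts s →
      ∃ (t : ℕ) (s' : HypTiling.State) (S : HypTiling.EmbeddedGraph D),
        HypTiling.Exec prog s t s' ∧
        HypTiling.IsOutput S s' ∧
        (2 ≤ n → (t : ℝ) ≤ (2 : ℝ) ^ (c * D) * (n * Real.logb 2 n)) ∧
        ((S.verts : Set (HypTiling.Cell D)) \ Set.range pts).ncard ≤ 2 ^ (c * D) * n ∧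
        S.edges.card ≤ 2 ^ (c * D) * n ∧
        S.IsAdditiveSpanner (Set.range pts) 2 ∧
        ∀ p ∈ Set.range pts, ∀ q ∈ Set.range pts,
          (∃ w : S.graph.Walk p q, w.IsPath ∧ (S.length w : ℕ∞) = HypTiling.d2 p q) ∧
          HypTiling.d1 p q ≤ HypTiling.d2 p q ∧
          HypTiling.d2 p q ≤ HypTiling.d1 p q + 2 := by
  classical
  refine ⟨HypTiling.spannerProg, 22, ?_⟩
  intro D hD n pts _ s hs
  obtain ⟨t, s', hexec, M, V, ht, hP, hV, hVL, hT, hE, h0, h1, hEl⟩ :=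
    HypTiling.wp_spannerProg (t := 0) (Q := fun t' s' => ∃ M V,
      t' ≤ 20000 * HypTiling.work D (48 * 27 ^ (D - 1) * n) ∧
      (∀ p ∈ List.ofFn pts, HypTiling.Cell.Bdd M 1 p) ∧ (∀ p ∈ V, HypTiling.Cell.Bdd M 2 p) ∧
      HypTiling.IsVertexList M (List.ofFn pts) V ∧ HypTiling.Tab s' (s'.reg 2) V ∧
      HypTiling.OpenEdges s' (s'.reg 3) V (HypTiling.edgeList M V) ∧ s'.reg 0 = V.length ∧
      s'.reg 1 = (HypTiling.edgeList M V).length ∧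
      (HypTiling.edgeList M V).length ≤ 2 * (48 * 27 ^ (D - 1) * n)) hD hs
      fun t' s' M V h1 h2 h3 h4 h5 h6 h7 h8 h9 =>
        ⟨M, V, by simpa using h1, h2, h3, h4, h5, h6, h7, h8, h9⟩
  rw [zero_add] at ht
  have hVs := hVL.strictSorted
  have hout := HypTiling.isOutput_spanner hVs hT hE h0 h1
  have hmem : ∀ p, p ∈ Set.range pts → p ∈ List.ofFn pts := fun p hp => by
    rw [List.mem_ofFn]
    exact hp
  have hpath : ∀ p ∈ Set.range pts, ∀ q ∈ Set.range pts,
      (∃ w : (HypTiling.spanner M V).graph.Walk p q, w.IsPath ∧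
        ((HypTiling.spanner M V).length w : ℕ∞) = HypTiling.d2 p q) ∧
      HypTiling.d1 p q ≤ HypTiling.d2 p q ∧ HypTiling.d2 p q ≤ HypTiling.d1 p q + 2 := by
    intro p hp q hq
    have hpM := hP p (hmem p hp)
    have hqM := hP q (hmem q hq)
    obtain ⟨l, hl, hc⟩ := HypTiling.exists_isCrit hpM.1 hqM.1 (hpM.near_up hqM)
    exact ⟨hVL.exists_path hP (hmem p hp) (hmem q hq) hl hc, HypTiling.d1_le_d2 p q, hc.d2_le⟩
  have hpow : 2 * (48 * 27 ^ (D - 1) * n) ≤ 2 ^ (22 * D) * n := by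
    calc 2 * (48 * 27 ^ (D - 1) * n) ≤ 2 ^ (14 * D) * (2 ^ (8 * D) * n) := by
          refine Nat.mul_le_mul ?_ (HypTiling.vertexBound_le hD n)
          exact le_trans (by norm_num) (Nat.pow_le_pow_right (n := 2) (by norm_num)
            (show 1 ≤ 14 * D by omega))
      _ = 2 ^ (22 * D) * n := by
          rw [← mul_assoc, ← pow_add]
          ring_nf
  refine ⟨t, s', HypTiling.spanner M V, hexec, hout, ?_, ?_, ?_, ⟨?_, ?_, ?_⟩, hpath⟩
  · intro hn
    have h2 : ((Nat.log 2 n : ℕ) : ℝ) ≤ Real.logb 2 n := by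
      have := Real.natLog_le_logb n 2
      exact_mod_cast this
    have h3 : (t : ℝ) ≤ ((2 ^ (22 * D) * (n * Nat.log 2 n) : ℕ) : ℝ) := by
      exact_mod_cast ht.trans (HypTiling.work_le hD hn)
    refine h3.trans ?_
    push_cast
    gcongr
  · have h2 := Set.ncard_le_ncard (Set.sdiff_subset (s := ((HypTiling.spanner M V).verts :
      Set (HypTiling.Cell D))) (t := Set.range pts)) (Finset.finite_toSet _)
    rw [Set.ncard_coe_finset] at h2
    have h3 : ((HypTiling.spanner M V).verts.card : ℤ) = V.length := hout.1.symm.trans h0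
    have h4 := hVL.length_le
    rw [List.length_ofFn] at h4
    have h5 : V.length ≤ 3 ^ (D - 1) * V.length := Nat.le_mul_of_pos_left _ (by positivity)
    omega
  · have h3 : ((HypTiling.spanner M V).edges.card : ℤ) = (HypTiling.edgeList M V).length :=
      hout.2.1.symm.trans h1
    omega
  · intro p hp
    exact List.mem_toFinset.2 (hVL.mem_of_mem hP (hmem p hp))
  · exact fun u v huv => HypTiling.weight_spanner huv
  · intro p hp q hq
    refine ⟨HypTiling.EmbeddedGraph.d1_le_dist _ (fun u v => HypTiling.weight_spanner) p q, ?_⟩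
    obtain ⟨⟨w, -, hw⟩, -, h2⟩ := hpath p hp q hq
    refine le_trans ?_ h2
    rw [← hw]
    exact iInf_le _ w
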